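/- Let $F$ be a field of characteristic $0$. Algebras are not necessarily associative or unital $F$-algebras. A superalgebra is an algebra $A=A_0\oplus A_1$ with $A_iA_j\subseteq A_{i+j}$ (indices modulo $2$); its Grassmann envelope is the subalgebra $\mathrm G(A)=\mathrm G_0\otimes A_0+\mathrm G_1\otimes A_1$ of $\mathrm G\otimes A$, where $\mathrm G$ is the Grassmann algebra on countably many generators with its parity grading. For a multilinear nonassociative polynomial $f$, the superalgebra $A$ is said to satisfy the superidentity $\tilde f=0$ if $\mathrm G(A)$ satisfies the identity $f=0$. The supervariety generated by $A$ is the class of all superalgebras satisfying every superidentity $\tilde f=0$ ($f$ multilinear) that holds in $A$. Let $\mathcal V=\mathrm{Alt}^{(2)}$ be the variety of alternative metabelian algebras, defined by the identities $(xx)y=x(xy)$, $(xy)y=x(yy)$, $(xy)(zt)=0$. Let $\tilde{\mathcal V}$ be the class of all $\mathcal V$-superalgebras, i.e. of superalgebras $A$ with $\mathrm G(A)\in\mathcal V$, and let $\mathcal V_{r,s}$ be the supervariety generated by the free $\mathcal V$-superalgebra on $r$ even and $s$ odd generators, $(r,s)\ne(0,0)$. Theorem. The inclusions between the classes $\mathcal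 V_{r,s}$ are as follows, where $\subset$ denotes strict inclusion. 1. $\mathcal V_{r,0}\subset\mathcal V_{r+1,0}$ and $\mathcal V_{r,0}\subset\mathcal V_{r,1}$ for all $r\ge 1$. 2. $\mathcal V_{0,1}=\mathcal V_{0,2}\subset\mathcal V_{0,3}$, $\mathcal V_{0,1}\subset\mathcal V_{1,1}$ and $\mathcal V_{0,2}\subset\mathcal V_{1,2}$. 3. $\mathcal V_{r,s}=\tilde{\mathcal V}$ for all $r\ge1$, $s\ge1$, and for all $r\ge 0$, $s\ge 3$. In particular $\mathcal V_{1,1}=\mathcal V_{r,1}=\mathcal V_{r,2}$ for all $r\ge1$. 4. For every $r\ge1$, neither of $\mathcal V_{r,0}$ and $\mathcal V_{0,1}=\mathcal V_{0,2}$ is contained in the other. -/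

import Mathlib

universe u

open scoped TensorProduct

/-- A superalgebra over `F`: a (not necessarily associative, not necessarily unital)
`F`-algebra `A = A₀ ⊕ A₁` with `Aᵢ Aⱼ ⊆ Aᵢ₊ⱼ`, indices in `ℤ/2`. -/
structure Superalgebra (F : Type u) [Field F] : Type (u + 1) where
  carrier : Type u
  [ring : NonUnitalNonAssocRing carrier]
  [module : Module F carrier]
  [isScalarTower : IsScalarTower F carrier carrier]
  [smulCommClass : SMulCommClass F carrier carrier]
  /-- The even part `part 0` and the odd part `part 1`. -/
  part : ZMod 2 → Submodule F carrier
  isCompl : IsCompl (part 0) (part 1)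
  mul_mem : ∀ (i j : ZMod 2) (a b : carrier), a ∈ part i → b ∈ part j → a * b ∈ part (i + j)

attribute [instance] Superalgebra.ring Superalgebra.module Superalgebra.isScalarTower
  Superalgebra.smulCommClass

section GrassmannEnvelope

variable (F : Type u) [Field F]

/-- The Grassmann algebra on countably many anticommuting generators. -/
noncomputable abbrev Grassmann : Type u := ExteriorAlgebra F (ℕ →₀ F)

/-- The part `Gᵢ` of the Grassmann algebra: the span of the products of generators whose length
is congruent to `i` modulo `2`. -/
noncomputable abbrev grassmannPart (i : ZMod 2) : Submodule F (Grassmann F) :=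
  CliffordAlgebra.evenOdd (0 : QuadraticForm F (ℕ →₀ F)) i

variable {F}

/-- The homogeneous component `Gᵢ ⊗ Aᵢ` of the Grassmann envelope, as a subspace of `G ⊗ A`. -/
noncomputable def envelopePart (A : Superalgebra F) (i : ZMod 2) :
    Submodule F (Grassmann F ⊗[F] A.carrier) :=
  Submodule.map₂ (TensorProduct.mk F (Grassmann F) A.carrier) (grassmannPart F i) (A.part i)

theorem envelopePart_mul_mem (A : Superalgebra F) (i j : ZMod 2)
    {x y : Grassmann F ⊗[F] A.carrier} (hx : x ∈ envelopePart A i) (hy : y ∈ envelopePart A j) :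
    x * y ∈ envelopePart A (i + j) := by
  unfold envelopePart at hx hy
  rw [Submodule.map₂_eq_span_image2] at hx hy
  induction hx using Submodule.span_induction with
  | zero => rw [zero_mul]; exact Submodule.zero_mem _
  | add a b _ _ ha hb => rw [add_mul]; exact Submodule.add_mem _ ha hb
  | smul c a _ ha => rw [smul_mul_assoc]; exact Submodule.smul_mem _ c ha
  | mem x hx =>
    obtain ⟨g, hg, a, ha, rfl⟩ := hx
    induction hy using Submodule.span_induction with
    | zero => rw [mul_zero]; exact Submodule.zero_mem _
    | add a b _ _ ha hb => rw [mul_add]; exact Submodule.add_mem _ ha hb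
    | smul c a _ ha => rw [mul_smul_comm]; exact Submodule.smul_mem _ c ha
    | mem y hy =>
      obtain ⟨h, hh, b, hb, rfl⟩ := hy
      simp only [TensorProduct.mk_apply, Algebra.TensorProduct.tmul_mul_tmul]
      exact Submodule.apply_mem_map₂ (TensorProduct.mk F (Grassmann F) A.carrier)
        (CliffordAlgebra.evenOdd_mul_le _ i j (Submodule.mul_mem_mul hg hh))
        (A.mul_mem i j a b ha hb)

/-- The Grassmann envelope `G(A) = G₀ ⊗ A₀ + G₁ ⊗ A₁`, a subalgebra of `G ⊗ A`. -/
noncomputable def grassmannEnvelope (A : Superalgebra F) :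
    NonUnitalSubalgebra F (Grassmann F ⊗[F] A.carrier) where
  toSubmodule := envelopePart A 0 ⊔ envelopePart A 1
  mul_mem' := by
    intro x y hx hy
    obtain ⟨x₀, hx₀, x₁, hx₁, rfl⟩ := Submodule.mem_sup.1 hx
    obtain ⟨y₀, hy₀, y₁, hy₁, rfl⟩ := Submodule.mem_sup.1 hy
    have h00 := envelopePart_mul_mem A 0 0 hx₀ hy₀
    have h01 := envelopePart_mul_mem A 0 1 hx₀ hy₁
    have h10 := envelopePart_mul_mem A 1 0 hx₁ hy₀
    have h11 := envelopePart_mul_mem A 1 1 hx₁ hy₁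
    rw [show (0 : ZMod 2) + 0 = 0 from rfl] at h00
    rw [show (0 : ZMod 2) + 1 = 1 from rfl] at h01
    rw [show (1 : ZMod 2) + 0 = 1 from rfl] at h10
    rw [show (1 : ZMod 2) + 1 = 0 from rfl] at h11
    have key : (x₀ + x₁) * (y₀ + y₁) = (x₀ * y₀ + x₁ * y₁) + (x₀ * y₁ + x₁ * y₀) := by
      rw [add_mul, mul_add, mul_add]; abel
    change (x₀ + x₁) * (y₀ + y₁) ∈ envelopePart A 0 ⊔ envelopePart A 1
    rw [key]
    exact Submodule.add_mem_sup (Submodule.add_mem _ h00 h11) (Submodule.add_mem _ h01 h10)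

end GrassmannEnvelope

section Identities

variable (F : Type u) [Field F]

/-- `B` satisfies the identity `f = 0`, where `f` is a nonassociative polynomial in `n` variables. -/
def SatisfiesIdentity {n : ℕ} (f : FreeNonUnitalNonAssocAlgebra F (Fin n))
    (B : Type u) [NonUnitalNonAssocRing B] [Module F B] [IsScalarTower F B B]
    [SMulCommClass F B B] : Prop :=
  ∀ b : Fin n → B, FreeNonUnitalNonAssocAlgebra.lift F b f = 0

/-- The number of occurrences of the variable `i` in a nonassociative word. -/
def occurrences {X : Type} [DecidableEq X] (i : X) : FreeMagma X → ℕ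
  | .of j => if j = i then 1 else 0
  | .mul v w => occurrences i v + occurrences i w

variable {F}

/-- `f` is multilinear: each of its `n` variables occurs exactly once in each of its monomials. -/
def IsMultilinearPoly {n : ℕ} (f : FreeNonUnitalNonAssocAlgebra F (Fin n)) : Prop :=
  ∀ w : FreeMagma (Fin n), f.coeff w ≠ 0 → ∀ i, occurrences i w = 1

/-- The superalgebra `A` satisfies the superidentity `f̃ = 0` corresponding to the multilinear
polynomial `f`, that is, the Grassmann envelope of `A` satisfies `f = 0`. -/
def SatisfiesSuperidentity {n : ℕ} (f : FreeNonUnitalNonAssocAlgebra F (Fin n))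
    (A : Superalgebra F) : Prop :=
  SatisfiesIdentity F f (grassmannEnvelope A)

/-- The supervariety generated by a superalgebra `A`: all superalgebras satisfying every
superidentity that holds in `A`. -/
def generatedSupervariety (A : Superalgebra F) : Set (Superalgebra F) :=
  {B | ∀ (n : ℕ) (f : FreeNonUnitalNonAssocAlgebra F (Fin n)), IsMultilinearPoly f →
    SatisfiesSuperidentity f A → SatisfiesSuperidentity f B}

end Identities

/-- Alternative metabelian algebras, the variety `Alt⁽²⁾`:
`(x, x, y) = 0`, `(x, y, y) = 0` and `(x y)(z t) = 0`. -/
def IsAltMetabelian (B : Type u) [NonUnitalNonAssocRing B] : Prop :=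
  (∀ x y : B, associator x x y = 0) ∧ (∀ x y : B, associator x y y = 0) ∧
    ∀ x y z t : B, (x * y) * (z * t) = 0

/-- The class of all `Alt⁽²⁾`-superalgebras: the superalgebras whose Grassmann envelope is an
alternative metabelian algebra. -/
def altMetabelianSupervariety (F : Type u) [Field F] : Set (Superalgebra F) :=
  {A | IsAltMetabelian (grassmannEnvelope A)}

section Quotients

variable {F : Type u} [Field F]

/-- A two-sided ideal of a superalgebra that is homogeneous, i.e. contains the even and the odd
component of each of its elements. -/
structure GradedIdeal (A : Superalgebra F) where
  toSubmodule : Submodule F A.carrier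
  mul_mem_left : ∀ a x : A.carrier, x ∈ toSubmodule → a * x ∈ toSubmodule
  mul_mem_right : ∀ a x : A.carrier, x ∈ toSubmodule → x * a ∈ toSubmodule
  homogeneous : ∀ a₀ ∈ A.part 0, ∀ a₁ ∈ A.part 1, a₀ + a₁ ∈ toSubmodule →
    a₀ ∈ toSubmodule ∧ a₁ ∈ toSubmodule

/-- The intersection of a set of graded ideals (the whole algebra if the set is empty). -/
def GradedIdeal.inter {A : Superalgebra F} (S : Set (GradedIdeal A)) : GradedIdeal A where
  toSubmodule := ⨅ J ∈ S, J.toSubmodule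
  mul_mem_left a x hx := by
    simp only [Submodule.mem_iInf] at hx ⊢
    exact fun J hJ => J.mul_mem_left a x (hx J hJ)
  mul_mem_right a x hx := by
    simp only [Submodule.mem_iInf] at hx ⊢
    exact fun J hJ => J.mul_mem_right a x (hx J hJ)
  homogeneous a₀ h₀ a₁ h₁ hx := by
    simp only [Submodule.mem_iInf] at hx ⊢
    exact ⟨fun J hJ => (J.homogeneous a₀ h₀ a₁ h₁ (hx J hJ)).1,
      fun J hJ => (J.homogeneous a₀ h₀ a₁ h₁ (hx J hJ)).2⟩

namespace GradedIdeal

variable {A : Superalgebra F} (J : GradedIdeal A)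

/-- The underlying vector space of the quotient `A / J`. -/
def Quot : Type u := A.carrier ⧸ J.toSubmodule

instance : AddCommGroup J.Quot := inferInstanceAs (AddCommGroup (A.carrier ⧸ J.toSubmodule))

instance : Module F J.Quot := inferInstanceAs (Module F (A.carrier ⧸ J.toSubmodule))

/-- The canonical projection `A → A / J`. -/
def proj : A.carrier →ₗ[F] J.Quot := J.toSubmodule.mkQ

theorem proj_surjective : Function.Surjective J.proj := Submodule.mkQ_surjective _

theorem proj_eq_zero_iff (a : A.carrier) : J.proj a = 0 ↔ a ∈ J.toSubmodule :=
  Submodule.Quotient.mk_eq_zero _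

theorem proj_eq_iff (a b : A.carrier) : J.proj a = J.proj b ↔ a - b ∈ J.toSubmodule :=
  Submodule.Quotient.eq _

instance : Mul J.Quot where
  mul := Quotient.map₂ (· * ·) (by
    intro a a' ha b b' hb
    replace ha : a - a' ∈ J.toSubmodule := (Submodule.quotientRel_def _).1 ha
    replace hb : b - b' ∈ J.toSubmodule := (Submodule.quotientRel_def _).1 hb
    refine (Submodule.quotientRel_def _).2 ?_
    have h : a * b - a' * b' = (a - a') * b + a' * (b - b') := by
      rw [sub_mul, mul_sub]; abel
    change a * b - a' * b' ∈ J.toSubmodule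
    rw [h]
    exact Submodule.add_mem _ (J.mul_mem_right _ _ ha) (J.mul_mem_left _ _ hb))

theorem proj_mul (a b : A.carrier) : J.proj (a * b) = J.proj a * J.proj b := rfl

instance : NonUnitalNonAssocRing J.Quot where
  left_distrib x y z := by
    obtain ⟨a, rfl⟩ := J.proj_surjective x
    obtain ⟨b, rfl⟩ := J.proj_surjective y
    obtain ⟨c, rfl⟩ := J.proj_surjective z
    rw [← map_add, ← proj_mul, ← proj_mul, ← proj_mul, mul_add, map_add]
  right_distrib x y z := by
    obtain ⟨a, rfl⟩ := J.proj_surjective x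
    obtain ⟨b, rfl⟩ := J.proj_surjective y
    obtain ⟨c, rfl⟩ := J.proj_surjective z
    rw [← map_add, ← proj_mul, ← proj_mul, ← proj_mul, add_mul, map_add]
  zero_mul x := by
    obtain ⟨a, rfl⟩ := J.proj_surjective x
    rw [← map_zero J.proj, ← proj_mul, zero_mul]
  mul_zero x := by
    obtain ⟨a, rfl⟩ := J.proj_surjective x
    rw [← map_zero J.proj, ← proj_mul, mul_zero]

instance : IsScalarTower F J.Quot J.Quot where
  smul_assoc c x y := by
    obtain ⟨a, rfl⟩ := J.proj_surjective x
    obtain ⟨b, rfl⟩ := J.proj_surjective y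
    simp only [smul_eq_mul]
    rw [← map_smul, ← proj_mul, ← proj_mul, ← map_smul, smul_mul_assoc]

instance : SMulCommClass F J.Quot J.Quot where
  smul_comm c x y := by
    obtain ⟨a, rfl⟩ := J.proj_surjective x
    obtain ⟨b, rfl⟩ := J.proj_surjective y
    simp only [smul_eq_mul]
    rw [← map_smul, ← proj_mul, ← proj_mul, ← map_smul, mul_smul_comm]

/-- The quotient superalgebra `A / J`, graded by the images of `A₀` and `A₁`. -/
def quotient : Superalgebra F where
  carrier := J.Quot
  part i := (A.part i).map J.proj
  isCompl := by
    constructor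
    · rw [Submodule.disjoint_def]
      rintro x ⟨a₀, h₀, rfl⟩ ⟨a₁, h₁, h⟩
      have hmem : a₀ + -a₁ ∈ J.toSubmodule := by
        rw [← sub_eq_add_neg]; exact (J.proj_eq_iff a₀ a₁).1 h.symm
      exact (J.proj_eq_zero_iff a₀).2
        (J.homogeneous a₀ h₀ (-a₁) (Submodule.neg_mem _ h₁) hmem).1
    · rw [codisjoint_iff, ← Submodule.map_sup, A.isCompl.sup_eq_top, Submodule.map_top,
        LinearMap.range_eq_top]
      exact J.proj_surjective
  mul_mem := by
    rintro i j _ _ ⟨a, ha, rfl⟩ ⟨b, hb, rfl⟩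
    exact ⟨a * b, A.mul_mem i j a b ha hb, J.proj_mul a b⟩

end GradedIdeal

end Quotients

section Free

variable (F : Type u) [Field F]

/-- The parity of a nonassociative word in `r` even and `s` odd letters. -/
def parity {r s : ℕ} : FreeMagma (Fin r ⊕ Fin s) → ZMod 2
  | .of (.inl _) => 0
  | .of (.inr _) => 1
  | .mul v w => parity v + parity w

/-- The free nonassociative superalgebra on `r` even and `s` odd generators: the free
nonassociative algebra, where part `i` is the span of the words of parity `i`. -/
noncomputable def freeSuperalgebra (r s : ℕ) : Superalgebra F where
  carrier := FreeNonUnitalNonAssocAlgebra F (Fin r ⊕ Fin s)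
  part i := Submodule.span F {f | ∃ w, parity w = i ∧ f = MonoidAlgebra.single w 1}
  isCompl := by
    have hsupp : ∀ (i : ZMod 2) (f : FreeNonUnitalNonAssocAlgebra F (Fin r ⊕ Fin s)),
        f ∈ Submodule.span F {f | ∃ w, parity w = i ∧ f = MonoidAlgebra.single w (1 : F)} →
        ∀ w, f.coeff w ≠ 0 → parity w = i := by
      intro i f hf
      induction hf using Submodule.span_induction with
      | zero => intro w hw; simp at hw
      | add a b _ _ ha hb =>
        intro w hw
        by_cases h : a.coeff w = 0
        · refine hb w fun h' => hw ?_
          simp [h, h']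
        · exact ha w h
      | smul c a _ ha =>
        intro w hw
        refine ha w fun h => hw ?_
        simp [h]
      | mem x hx =>
        obtain ⟨v, hv, rfl⟩ := hx
        intro w hw
        by_cases h : v = w
        · rw [← h]; exact hv
        · exact absurd (by simp [h]) hw
    constructor
    · rw [Submodule.disjoint_def]
      intro f h₀ h₁
      ext w
      by_contra hw
      have := (hsupp 0 f h₀ w hw).symm.trans (hsupp 1 f h₁ w hw)
      exact absurd this (by decide)
    · rw [codisjoint_iff, eq_top_iff]
      rintro f -
      induction f using MonoidAlgebra.induction_linear with
      | zero => exact Submodule.zero_mem _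
      | add a b ha hb => exact Submodule.add_mem _ ha hb
      | single w c =>
        have hc : (MonoidAlgebra.single w c : FreeNonUnitalNonAssocAlgebra F (Fin r ⊕ Fin s)) =
            c • MonoidAlgebra.single w 1 := by simp
        rw [hc]
        refine Submodule.smul_mem _ c ?_
        have h2 : ∀ i : ZMod 2, i = 0 ∨ i = 1 := by decide
        rcases h2 (parity w) with h | h
        · exact Submodule.mem_sup_left (Submodule.subset_span ⟨w, h, rfl⟩)
        · exact Submodule.mem_sup_right (Submodule.subset_span ⟨w, h, rfl⟩)
  mul_mem := by
    intro i j a b ha hb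
    induction ha using Submodule.span_induction with
    | zero => rw [zero_mul]; exact Submodule.zero_mem _
    | add a b _ _ ha hb => rw [add_mul]; exact Submodule.add_mem _ ha hb
    | smul c a _ ha => rw [smul_mul_assoc]; exact Submodule.smul_mem _ c ha
    | mem x hx =>
      obtain ⟨v, hv, rfl⟩ := hx
      induction hb using Submodule.span_induction with
      | zero => rw [mul_zero]; exact Submodule.zero_mem _
      | add a b _ _ ha hb => rw [mul_add]; exact Submodule.add_mem _ ha hb
      | smul c a _ ha => rw [mul_smul_comm]; exact Submodule.smul_mem _ c ha
      | mem y hy =>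
        obtain ⟨w, hw, rfl⟩ := hy
        refine Submodule.subset_span ⟨v * w, ?_, by simp [MonoidAlgebra.single_mul_single]⟩
        change parity v + parity w = i + j
        rw [hv, hw]

/-- The free `Alt⁽²⁾`-superalgebra on `r` even and `s` odd generators: the quotient of the free
superalgebra by the smallest graded ideal modulo which it is an `Alt⁽²⁾`-superalgebra. -/
noncomputable def freeAltMetabelian (r s : ℕ) : Superalgebra F :=
  (GradedIdeal.inter {J : GradedIdeal (freeSuperalgebra F r s) |
    J.quotient ∈ altMetabelianSupervariety F}).quotient

/-- The supervariety `V_{r,s}` generated by the free `Alt⁽²⁾`-superalgebra on `r` even and `s` odd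
generators. -/
def altSV (r s : ℕ) : Set (Superalgebra F) :=
  generatedSupervariety (freeAltMetabelian F r s)

end Free

/-! Everything rests on a normal form for multilinear words in alternative metabelian algebras `B`.
Since `B² B² = 0`, the alternative laws and the middle Moufang identity make products of
multiplications acting on `B²` skew in the letters. A left multiplication differs from a right one
only by a factor φ or φ², depending on the parity of the number of multiplications already made;
here φ² + φ + 1 = 0 and coefficients lie in K = F[φ], written as `F × F`. A word is thus an element
of K acting on a product `p q`, followed by a skew list of letters. Resolving the pair `p q` as well
means inverting a 2 × 2 system over K whose determinant 1 - φ divides 3. The outcome, for n ≥ 3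
variables, is a sum over i of terms with coefficient `T i` in K that are skew in all variables
except the i-th, plus, only for n = 3, a multiple of the symmetrized cube (`exists_coordinates`).

One odd generator detects all these coordinates. In `skewModel` = F y ⊕ K ⊕ K put `1 ⊗ y²` for the
i-th variable and `eⱼ ⊗ y` for the others: by metabelianity only the i-th coordinate survives, as a
nonzero Grassmann monomial tensored with `T i`. Hence a superidentity of the free superalgebra on
one odd generator is, in every algebra of the variety, a multiple of the cube
(`exists_lift_eq_smul_cubeTerm`). For s ≥ 1 the supervariety V_{r,s} therefore depends only on
whether the cube vanishes in the free superalgebra. The cube is zero as soon as an argument is a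
product, so only generators matter. With at most two odd generators, and no even ones, two arguments
coincide and the signs cancel the six terms; an even generator (`x³ ≠ 0`) or three odd generators
(exterior algebra) make it nonzero.

For s = 0 the separating polynomial is `[x₀, x₁] x₂ ⋯ xᵣ₊₁`. On r even generators it vanishes, for r
≥ 2 because skew functions receive more letters than there are generators. It survives on r + 1 even
generators and on one odd generator because 1 - φ² ≠ 0. The cube gives the separations in the other
direction. -/

/-! ### Skew functions of lists and signs of permutations. -/

section SkewFunctions

/-- A function on lists that changes sign when two adjacent entries are exchanged. -/
def IsSkewOnLists {X : Type*} {N : Type*} [AddCommGroup N] (S : List X → N) : Prop :=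
  ∀ (l : List X) (a b : X) (l' : List X), S (l ++ a :: b :: l') = -S (l ++ b :: a :: l')

theorem IsSkewOnLists.comp_map {X Y N : Type*} [AddCommGroup N] {S : List Y → N}
    (hS : IsSkewOnLists S) (g : X → Y) : IsSkewOnLists fun l : List X => S (l.map g) := by
  intro l a b l'
  simpa using hS (l.map g) (g a) (g b) (l'.map g)

theorem IsSkewOnLists.cons {X N : Type*} [AddCommGroup N] {S : List X → N}
    (hS : IsSkewOnLists S) (x : X) : IsSkewOnLists fun l : List X => S (x :: l) := by
  intro l a b l'
  exact hS (x :: l) a b l'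

/-- The sign is chosen before the function, so one sign serves all skew functions at once. This
allows coordinates computed with Grassmann monomials to be transferred to arbitrary algebras. -/
theorem exists_sign_of_perm {X : Type*} {l l' : List X} (h : l.Perm l') :
    ∃ ε : ℤˣ, ∀ {N : Type u} [AddCommGroup N] (S : List X → N), IsSkewOnLists S →
      S l = (ε : ℤ) • S l' := by
  induction h with
  | nil => exact ⟨1, fun S _ => by simp⟩
  | cons x _ ih =>
    obtain ⟨ε, hε⟩ := ih
    exact ⟨ε, fun S hS => hε (fun l => S (x :: l)) (hS.cons x)⟩
  | swap x y l => exact ⟨-1, fun S hS => by simpa using hS [] y x l⟩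
  | trans _ _ ih₁ ih₂ =>
    obtain ⟨ε₁, h₁⟩ := ih₁
    obtain ⟨ε₂, h₂⟩ := ih₂
    exact ⟨ε₁ * ε₂, fun S hS => by rw [h₁ S hS, h₂ S hS, smul_smul, Units.val_mul]⟩

/-- Two equal entries can be brought to the front at the cost of a sign; exchanging them there shows
that the value equals its own negative. -/
theorem IsSkewOnLists.eq_zero_of_not_nodup {F : Type*} [Field F] [CharZero F] {X : Type*}
    {N : Type u} [AddCommGroup N] [Module F N] {S : List X → N} (hS : IsSkewOnLists S)
    {l : List X} (hl : ¬ l.Nodup) : S l = 0 := by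
  classical
  obtain ⟨a, ha⟩ : ∃ a, 2 ≤ l.count a := by
    by_contra! h
    exact hl (List.nodup_iff_count_le_one.2 fun a => Nat.lt_succ_iff.1 (h a))
  have h₁ : l.Perm (a :: l.erase a) :=
    List.perm_cons_erase (List.count_pos_iff.1 (by omega))
  have h₂ : (l.erase a).Perm (a :: (l.erase a).erase a) :=
    List.perm_cons_erase (List.count_pos_iff.1 (by rw [List.count_erase_self]; omega))
  obtain ⟨ε, hε⟩ := exists_sign_of_perm.{u} (h₁.trans (h₂.cons a))
  have h0 := hS [] a a ((l.erase a).erase a)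
  simp only [List.nil_append] at h0
  have h2 : (2 : F) • S (a :: a :: (l.erase a).erase a) = 0 := by
    rw [two_smul]; nth_rewrite 1 [h0]; simp
  rw [hε S hS, (smul_eq_zero.1 h2).resolve_left two_ne_zero, smul_zero]

end SkewFunctions

/-! ### Multiplication operators on the square of an alternative metabelian algebra. -/

section AltMetabelian

variable {F : Type u} [Field F] [CharZero F] {B : Type u} [NonUnitalNonAssocRing B] [Module F B]

theorem IsAltMetabelian.assoc_left (hB : IsAltMetabelian B) (x y z : B) :
    x * y * z - x * (y * z) + (y * x * z - y * (x * z)) = 0 := by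
  have h := hB.1 (x + y) z
  have h₁ := hB.1 x z
  have h₂ := hB.1 y z
  simp only [associator] at h h₁ h₂
  simp only [add_mul, mul_add] at h
  rw [← h, ← sub_eq_zero]
  have e := congrArg₂ (· + ·) h₁ h₂
  simp only [add_zero] at e
  rw [← neg_eq_zero, ← e]
  abel

theorem IsAltMetabelian.assoc_right (hB : IsAltMetabelian B) (x y z : B) :
    x * y * z - x * (y * z) + (x * z * y - x * (z * y)) = 0 := by
  have h := hB.2.1 x (y + z)
  have h₁ := hB.2.1 x y
  have h₂ := hB.2.1 x z
  simp only [associator] at h h₁ h₂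
  simp only [add_mul, mul_add] at h
  rw [← h, ← sub_eq_zero]
  have e := congrArg₂ (· + ·) h₁ h₂
  simp only [add_zero] at e
  rw [← neg_eq_zero, ← e]
  abel

theorem IsAltMetabelian.mul_mul_mul (hB : IsAltMetabelian B) (a b c d : B) :
    (a * b) * (c * d) = 0 := hB.2.2 a b c d

/-- Right multiplications on `B²` anticommute. -/
theorem IsAltMetabelian.right_right (hB : IsAltMetabelian B) (a b x y : B) :
    a * b * x * y = -(a * b * y * x) := by
  have h := hB.assoc_right (a * b) x y
  rw [hB.mul_mul_mul, hB.mul_mul_mul] at h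
  rw [← sub_eq_zero, ← h]; abel

/-- Metabelianity leaves one term of the associators `(ab, x, y)` and `(x, y, ab)`, namely `(ab)xy`
and `-x(y(ab))`. These associators agree, being related by a cyclic permutation, and right
multiplications anticommute. -/
theorem IsAltMetabelian.left_left (hB : IsAltMetabelian B) (a b x y : B) :
    x * (y * (a * b)) = a * b * y * x := by
  have h₁ := hB.assoc_left (a * b) x y
  have h₂ := hB.assoc_right x (a * b) y
  have h₃ := hB.right_right a b x y
  simp only [hB.mul_mul_mul] at h₁ h₂
  rw [h₃] at h₁
  rw [← sub_eq_zero, ← sub_eq_zero.2 (h₁.trans h₂.symm)]; abel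

theorem IsAltMetabelian.right_left (hB : IsAltMetabelian B) (a b x y : B) :
    x * (a * b * y) = x * (a * b) * y + a * b * x * y := by
  have h₁ := hB.assoc_left (a * b) x y
  simp only [hB.mul_mul_mul] at h₁
  rw [← sub_eq_zero, ← neg_eq_zero, ← h₁]; abel

-- The middle Moufang identity `(x a)(b x) = x (a b) x` holds in alternative algebras, and its left
-- side vanishes by metabelianity. The linear combination derives it from the linearized alternative
-- laws, multiplied where needed by a letter.
include F in
theorem IsAltMetabelian.moufang_self (hB : IsAltMetabelian B) (a b x : B) :
    x * (a * b) * x = 0 := by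
  have hLr : ∀ p q r s : B, (p * q * r) * s - (p * (q * r)) * s + ((q * p * r) * s - (q * (p * r)) * s) = 0 :=
    fun p q r s => by simpa [add_mul, sub_mul] using congrArg (· * s) (hB.assoc_left p q r)
  have hRr : ∀ p q r s : B, (p * q * r) * s - (p * (q * r)) * s + ((p * r * q) * s - (p * (r * q)) * s) = 0 :=
    fun p q r s => by simpa [add_mul, sub_mul] using congrArg (· * s) (hB.assoc_right p q r)
  have hLl : ∀ p q r s : B, s * (p * q * r) - s * (p * (q * r)) + (s * (q * p * r) - s * (q * (p * r))) = 0 :=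
    fun p q r s => by simpa [mul_add, mul_sub] using congrArg (s * ·) (hB.assoc_left p q r)
  have hRl : ∀ p q r s : B, s * (p * q * r) - s * (p * (q * r)) + (s * (p * r * q) - s * (p * (r * q))) = 0 :=
    fun p q r s => by simpa [mul_add, mul_sub] using congrArg (s * ·) (hB.assoc_right p q r)
  linear_combination (norm := module) hB.assoc_left b (x * a) x - (1 / 2 : F) • hRl b x x a - hLr b a x x
    + (1 / 2 : F) • hB.assoc_right (a * b) x x - hRl a x x b + hB.assoc_left a b (x * x)
    - hB.assoc_left a (b * x) x + hB.mul_mul_mul x a b x - hRr x a b x - hB.assoc_right b x (a * x)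
    + hLl a x x b + (1 / 2 : F) • hB.assoc_right (b * a) x x + hLr b x a x

include F in
theorem IsAltMetabelian.left_right (hB : IsAltMetabelian B) (a b x y : B) :
    x * (a * b) * y = -(y * (a * b) * x) := by
  have h := hB.moufang_self (F := F) a b (x + y)
  simp only [add_mul, mul_add] at h
  rw [hB.moufang_self (F := F), hB.moufang_self (F := F)] at h
  rw [← sub_eq_zero, ← h]; abel

/-- The linearization of `6 x³`. -/
def symCube (x y z : B) : B :=
  x * y * z + y * x * z + x * z * y + z * x * y + y * z * x + z * y * x

-- For equal arguments: `x² x t = -(x² t) x = -(x (x t)) x = 0`, by anticommuting right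
-- multiplications, left alternativity and the Moufang identity. The proof polarizes this
-- computation.
include F in
theorem IsAltMetabelian.symCube_mul (hB : IsAltMetabelian B) (x y z t : B) :
    symCube x y z * t = 0 := by
  have hLr : ∀ p q r s : B, (p * q * r) * s - (p * (q * r)) * s + ((q * p * r) * s - (q * (p * r)) * s) = 0 :=
    fun p q r s => by simpa [add_mul, sub_mul] using congrArg (· * s) (hB.assoc_left p q r)
  simp only [symCube, add_mul]
  linear_combination (norm := module) hB.right_right x y z t + hB.right_right y x z t +
    hB.right_right x z y t + hB.right_right z x y t + hB.right_right y z x t +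
    hB.right_right z y x t - hLr x y t z - hLr x z t y - hLr y z t x
    - hB.left_right (F := F) x t y z - hB.left_right (F := F) y t x z
    - hB.left_right (F := F) z t x y

-- Two of the six terms are products of two products; the other four cancel because right
-- multiplications, and left with right ones, are skew on the square. Because of this the cube need
-- only be tested on generators.
include F in
theorem IsAltMetabelian.symCube_product (hB : IsAltMetabelian B) (a b x y : B) :
    symCube (a * b) x y = 0 := by
  simp only [symCube, hB.mul_mul_mul]
  linear_combination (norm := module) hB.right_right a b x y + hB.left_right (F := F) a b x y

/-- The left-normed product `u y₁ y₂ ⋯`. -/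
def rightFold (u : B) (l : List B) : B := l.foldl (· * ·) u

@[simp] theorem rightFold_nil (u : B) : rightFold u [] = u := rfl

@[simp] theorem rightFold_cons (u x : B) (l : List B) :
    rightFold u (x :: l) = rightFold (u * x) l := rfl

theorem rightFold_append (u : B) (l l' : List B) :
    rightFold u (l ++ l') = rightFold (rightFold u l) l' := List.foldl_append

theorem rightFold_add (u v : B) (l : List B) :
    rightFold (u + v) l = rightFold u l + rightFold v l := by
  induction l generalizing u v with
  | nil => rfl
  | cons x l ih => simp [add_mul, ih]

theorem rightFold_neg (u : B) (l : List B) : rightFold (-u) l = -rightFold u l := by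
  induction l generalizing u with
  | nil => rfl
  | cons x l ih => simp [ih]

theorem rightFold_zero (l : List B) : rightFold (0 : B) l = 0 := by
  induction l with
  | nil => rfl
  | cons x l ih => simp [ih]

theorem rightFold_sub (u v : B) (l : List B) :
    rightFold (u - v) l = rightFold u l - rightFold v l := by
  rw [sub_eq_add_neg, rightFold_add, rightFold_neg, sub_eq_add_neg]

omit [CharZero F] in
theorem rightFold_smul [IsScalarTower F B B] (c : F) (u : B) (l : List B) :
    rightFold (c • u) l = c • rightFold u l := by
  induction l generalizing u with
  | nil => rfl
  | cons x l ih => simp [ih, smul_mul_assoc]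

/-- The element `(x u) y₁ y₂ ⋯` for the list `x, y₁, y₂, …`. -/
def leftRightFold (u : B) : List B → B
  | [] => 0
  | x :: l => rightFold (x * u) l

/-- The action of `κ.1 + κ.2 φ` followed by a skew product of multiplication operators. -/
def skewWord (κ : F × F) (u : B) (l : List B) : B :=
  κ.1 • rightFold u l + κ.2 • leftRightFold u l

omit [CharZero F] in
-- The φ-component needs a letter to act through: on the empty list `leftRightFold` has the default
-- value 0, whence the hypothesis on `κ.2`.
theorem skewWord_mul [IsScalarTower F B B] (κ : F × F) (u : B) (l : List B) (x : B)
    (hl : l = [] → κ.2 = 0) : skewWord κ u l * x = skewWord κ u (l ++ [x]) := by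
  cases l with
  | nil => simp [skewWord, hl rfl, smul_mul_assoc]
  | cons y l => simp [skewWord, leftRightFold, rightFold_append, add_mul, smul_mul_assoc]

/-- Multiplication by `φ`, where `φ² + φ + 1 = 0`. -/
def mulPhi (κ : F × F) : F × F := (-κ.2, κ.1 - κ.2)

/-- Multiplication by `φ²`, where `φ² + φ + 1 = 0`. -/
def mulPhiSq (κ : F × F) : F × F := (κ.2 - κ.1, -κ.1)

/-- Formally φ² φ = 1: the multiplication by `y` contributes φ, and the next left multiplication, at
odd length, contributes φ². -/
theorem leftRightFold_left (hB : IsAltMetabelian B) (a b y : B) {l : List B} (hl : l ≠ []) :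
    leftRightFold (y * (a * b)) l = rightFold (a * b) (y :: l) := by
  cases l with
  | nil => exact absurd rfl hl
  | cons z l => simp only [leftRightFold, rightFold_cons, hB.left_left]

-- Here a left multiplication occurs at odd length, after the right multiplication by `y`; it
-- contributes φ² = -1 - φ.
include F in
theorem leftRightFold_right (hB : IsAltMetabelian B) (a b y : B) {l : List B} (hl : l ≠ []) :
    leftRightFold (a * b * y) l =
      -rightFold (a * b) (y :: l) - leftRightFold (a * b) (y :: l) := by
  cases l with
  | nil => exact absurd rfl hl
  | cons z l =>
    simp only [leftRightFold, rightFold_cons, ← rightFold_neg, ← rightFold_sub]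
    rw [hB.right_left, hB.left_right (F := F) a b z y, hB.right_right a b z y]
    congr 1; abel

-- Compared with a right multiplication, a left one carries the factor φ at even length and φ² = -1
-- - φ at odd length. In the induction the first letter is absorbed into the base, since `(a * b) *
-- y` is again a product; this flips the parity.
include F in
theorem IsAltMetabelian.mul_rightFold (hB : IsAltMetabelian B) (a b x : B) (l : List B) :
    x * rightFold (a * b) l =
      if Even l.length then leftRightFold (a * b) (l ++ [x])
      else -rightFold (a * b) (l ++ [x]) - leftRightFold (a * b) (l ++ [x]) := by
  induction l generalizing a b with
  | nil => simp [leftRightFold]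
  | cons y l ih =>
    rw [rightFold_cons, ih]
    have e := leftRightFold_right (F := F) hB a b y (l := l ++ [x]) (by simp)
    simp only [List.length_cons, Nat.even_add_one, List.cons_append]
    split_ifs with h
    · exact e
    · rw [e, rightFold_cons]; abel

include F in
theorem IsAltMetabelian.mul_leftRightFold (hB : IsAltMetabelian B) (a b x : B) (l : List B)
    (hl : l ≠ []) : x * leftRightFold (a * b) l =
      if Even l.length then -rightFold (a * b) (l ++ [x]) - leftRightFold (a * b) (l ++ [x])
      else rightFold (a * b) (l ++ [x]) := by
  cases l with
  | nil => exact absurd rfl hl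
  | cons y l =>
    have h := hB.mul_rightFold (F := F) y (a * b) x l
    have e := leftRightFold_left hB a b y (l := l ++ [x]) (by simp)
    have h2 : leftRightFold (a * b) (y :: l ++ [x]) = rightFold (y * (a * b)) (l ++ [x]) := rfl
    change x * rightFold (y * (a * b)) l = _
    rw [h, h2, e]
    simp only [List.length_cons, Nat.even_add_one, List.cons_append]
    split_ifs with h'
    · rfl
    · rw [rightFold_cons]; abel

theorem IsAltMetabelian.mul_skewWord [SMulCommClass F B B] (hB : IsAltMetabelian B) (κ : F × F)
    (a b x : B) (l : List B) (hl : l = [] → κ.2 = 0) :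
    x * skewWord κ (a * b) l =
      skewWord (if Even l.length then mulPhi κ else mulPhiSq κ) (a * b) (l ++ [x]) := by
  by_cases h0 : l = []
  · subst h0
    simp [skewWord, hl rfl, mulPhi, leftRightFold, mul_smul_comm]
  · simp only [skewWord, mul_add, mul_smul_comm, hB.mul_rightFold (F := F),
      hB.mul_leftRightFold (F := F) _ _ _ _ h0]
    split_ifs
    · simp only [mulPhi]; module
    · simp only [mulPhiSq]; module

/-- The component of `κ (p q) z` that is distinguished by `p`, made skew in `q` and `z`. -/
def skewCore (κ : F × F) (p q z : B) : B :=
  (1 / 3 : F) • ((2 * κ.1 - κ.2) • (p * q * z) + (κ.1 + κ.2) • (z * (p * q)) -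
    (2 * κ.2 - κ.1) • (q * p * z) - (κ.2 - 2 * κ.1) • (z * (q * p))) -
    ((2 * κ.1 - κ.2) / 6) • symCube p q z

/-- The multiple of `symCube` subtracted in `skewCore` is what makes this exact; without it skewness
would hold only modulo the cube. -/
theorem skewCore_swap (hB : IsAltMetabelian B) (κ : F × F) (p q z : B) :
    skewCore κ p q z = -skewCore κ p z q := by
  simp only [skewCore, symCube]
  linear_combination (norm := module)
    κ.1 • ((-1 / 3 : F) • hB.assoc_left p q z + (1 / 3 : F) • hB.assoc_right p q z
      - (1 / 3 : F) • hB.assoc_left p z q - (2 / 3 : F) • hB.assoc_left q z p) +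
    κ.2 • ((-1 / 3 : F) • hB.assoc_left p q z + (1 / 3 : F) • hB.assoc_right p q z
      - (1 / 3 : F) • hB.assoc_left p z q + (1 / 3 : F) • hB.assoc_left q z p)

/-- Source of the coefficients in `skewCore`: modulo the cube one wants κ·(pq)z = C(κ; p) + C(φ²κ;
q). Exchanging `p` and `q` gives a second equation, and the system has determinant 1 - φ⁴ = 1 - φ,
with inverse (1 - φ²)/3. Hence C(κ; p) is one third of (1 - φ²)κ acting on `p q` minus (φ² - φ)κ
acting on `q p`. -/
theorem skewWord_pair (κ : F × F) (p q z : B) :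
    κ.1 • (p * q * z) + κ.2 • (z * (p * q)) =
      skewCore κ p q z + skewCore (mulPhiSq κ) q p z + ((κ.1 + κ.2) / 6) • symCube p q z := by
  simp only [skewCore, symCube, mulPhiSq]
  module

/-- The cube is annihilated by `t`; what remains is skew in `z` and `t` by the operator identities
on the square. -/
theorem skewCore_mul_swap [IsScalarTower F B B] (hB : IsAltMetabelian B) (κ : F × F)
    (p q z t : B) : skewCore κ p q z * t = -(skewCore κ p q t * z) := by
  simp only [skewCore, sub_mul, smul_mul_assoc, add_mul, hB.symCube_mul (F := F)]
  rw [hB.right_right p q z t, hB.right_right q p z t, hB.left_right (F := F) p q z t,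
    hB.left_right (F := F) q p z t]
  module

theorem skewCore_mul_mul_swap [IsScalarTower F B B] (hB : IsAltMetabelian B) (κ : F × F)
    (p q z s t : B) : skewCore κ p q z * s * t = -(skewCore κ p q z * t * s) := by
  simp only [skewCore, sub_mul, smul_mul_assoc, add_mul, hB.symCube_mul (F := F), zero_mul]
  rw [hB.right_right (p * q) z s t, hB.right_right (q * p) z s t, hB.right_right z (p * q) s t,
    hB.right_right z (q * p) s t]
  module

/-- The skew function of lists obtained from `skewCore`. -/
def skewList (κ : F × F) (p : B) : List B → B
  | q :: z :: l => rightFold (skewCore κ p q z) l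
  | _ => 0

theorem rightFold_swap {u : B} (h : ∀ s t, u * s * t = -(u * t * s))
    (h' : ∀ a b s t : B, a * b * s * t = -(a * b * t * s)) : IsSkewOnLists (rightFold u) := by
  intro l
  induction l generalizing u with
  | nil => intro s t l; simp only [List.nil_append, rightFold_cons, h s t, rightFold_neg]
  | cons x l ih =>
    intro s t l'
    exact ih (fun s t => h' u x s t) s t l'

theorem isSkewOnLists_rightFold (hB : IsAltMetabelian B) (a b : B) :
    IsSkewOnLists (rightFold (a * b)) :=
  rightFold_swap (hB.right_right a b) hB.right_right

include F in
theorem isSkewOnLists_leftRightFold (hB : IsAltMetabelian B) (a b : B) :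
    IsSkewOnLists (leftRightFold (a * b)) := by
  intro l s t l'
  cases l with
  | nil =>
    simp only [List.nil_append, leftRightFold, rightFold_cons, ← rightFold_neg]
    rw [hB.left_right (F := F)]
  | cons x l => exact isSkewOnLists_rightFold hB x (a * b) l s t l'

/-- An adjacent exchange takes place inside the core, across its end, or among later right
multiplications; each case has its own identity. -/
theorem isSkewOnLists_skewList [IsScalarTower F B B] (hB : IsAltMetabelian B) (κ : F × F)
    (p : B) : IsSkewOnLists (skewList κ p) := by
  intro l s t l'
  match l with
  | [] => simp only [List.nil_append, skewList, ← rightFold_neg]; rw [skewCore_swap hB]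
  | [q] =>
    simp only [List.cons_append, List.nil_append, skewList, rightFold_cons, ← rightFold_neg]
    rw [skewCore_mul_swap hB]
  | q :: z :: l =>
    exact rightFold_swap (skewCore_mul_mul_swap hB κ p q z) hB.right_right l s t l'

theorem skewWord_cons [IsScalarTower F B B] (κ : F × F) (p q z : B) (l : List B) :
    skewWord κ (p * q) (z :: l) = skewList κ p (q :: z :: l) +
      skewList (mulPhiSq κ) q (p :: z :: l) +
      ((κ.1 + κ.2) / 6) • rightFold (symCube p q z) l := by
  simp only [skewWord, leftRightFold, skewList, rightFold_cons, ← rightFold_smul,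
    ← rightFold_add, skewWord_pair]

theorem skewList_add [IsScalarTower F B B] (κ κ' : F × F) (p : B) (l : List B) :
    skewList (κ + κ') p l = skewList κ p l + skewList κ' p l := by
  match l with
  | [] => simp [skewList]
  | [_] => simp [skewList]
  | q :: z :: l =>
    simp only [skewList, ← rightFold_add]
    congr 1
    simp only [skewCore, Prod.fst_add, Prod.snd_add]
    module

theorem skewList_smul [IsScalarTower F B B] (c : F) (κ : F × F) (p : B) (l : List B) :
    skewList (c • κ) p l = c • skewList κ p l := by
  match l with
  | [] => simp [skewList]
  | [_] => simp [skewList]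
  | q :: z :: l =>
    simp only [skewList, ← rightFold_smul]
    congr 1
    simp only [skewCore, Prod.smul_fst, Prod.smul_snd, smul_eq_mul]
    module

/-- `skewList` as a linear function of the coefficient. -/
def skewListHom [IsScalarTower F B B] (p : B) (l : List B) : F × F →ₗ[F] B where
  toFun κ := skewList κ p l
  map_add' κ κ' := skewList_add κ κ' p l
  map_smul' c κ := skewList_smul c κ p l

end AltMetabelian

/-! ### Normal form of nonassociative words. -/

section Words

variable {F : Type u} [Field F]

/-- The value of a nonassociative word. -/
def evalWord {X : Type} {B : Type u} [Mul B] (b : X → B) : FreeMagma X → B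
  | .of i => b i
  | .mul v w => evalWord b v * evalWord b w

theorem evalWord_eq_lift {X : Type} {B : Type u} [Mul B] (b : X → B) (w : FreeMagma X) :
    FreeMagma.lift b w = evalWord b w := by
  induction w using FreeMagma.rec with
  | of i => rfl
  | mul v w hv hw => exact congrArg₂ (· * ·) hv hw

theorem lift_eq_sum {X : Type} {B : Type u} [NonUnitalNonAssocRing B] [Module F B]
    [IsScalarTower F B B] [SMulCommClass F B B] (b : X → B)
    (f : FreeNonUnitalNonAssocAlgebra F X) :
    FreeNonUnitalNonAssocAlgebra.lift F b f =
      ∑ w ∈ f.coeff.support, f.coeff w • evalWord b w := by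
  simp only [← evalWord_eq_lift]
  rfl

theorem lift_single {X : Type} {B : Type u} [NonUnitalNonAssocRing B] [Module F B]
    [IsScalarTower F B B] [SMulCommClass F B B] (b : X → B) (w : FreeMagma X) (c : F) :
    FreeNonUnitalNonAssocAlgebra.lift F b (MonoidAlgebra.single w c) = c • evalWord b w := by
  rw [← evalWord_eq_lift]
  simp [FreeNonUnitalNonAssocAlgebra.lift, MonoidAlgebra.liftMagma]

theorem map_lift {X : Type} {B B' : Type u} [NonUnitalNonAssocRing B] [Module F B]
    [IsScalarTower F B B] [SMulCommClass F B B] [NonUnitalNonAssocRing B'] [Module F B']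
    [IsScalarTower F B' B'] [SMulCommClass F B' B'] (φ : B →ₙₐ[F] B') (b : X → B)
    (f : FreeNonUnitalNonAssocAlgebra F X) :
    φ (FreeNonUnitalNonAssocAlgebra.lift F b f) =
      FreeNonUnitalNonAssocAlgebra.lift F (fun i => φ (b i)) f := by
  have h : φ.comp (FreeNonUnitalNonAssocAlgebra.lift F b) =
      FreeNonUnitalNonAssocAlgebra.lift F (fun i => φ (b i)) := by
    apply FreeNonUnitalNonAssocAlgebra.hom_ext
    intro x
    simp
  exact DFunLike.congr_fun h f

/-- Multiplication of a word by a letter on the left (`true`) or on the right (`false`). -/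
def wordStep {X : Type} (w : FreeMagma X) (o : X × Bool) : FreeMagma X :=
  if o.2 then .mul (.of o.1) w else .mul w (.of o.1)

/-- The word obtained from the product of two letters by successive multiplications by letters. -/
def chainWord {X : Type} (i j : X) (ops : List (X × Bool)) : FreeMagma X :=
  ops.foldl wordStep (.mul (.of i) (.of j))

/-- A product of two words neither of which is a letter has the form `(x y)(z t)` and is killed by
metabelianity. Any other word of length at least two is built from a pair of letters by one-letter
multiplications. -/
theorem word_cases {X : Type} (w : FreeMagma X) :
    (∃ i, w = .of i) ∨ (∃ i j ops, w = chainWord i j ops) ∨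
      ∀ (B : Type u) [NonUnitalNonAssocRing B], (∀ x y z t : B, x * y * (z * t) = 0) →
        ∀ b : X → B, evalWord b w = 0 := by
  induction w using FreeMagma.rec with
  | of i => exact .inl ⟨i, rfl⟩
  | mul v w hv hw =>
    right
    rcases v with i | ⟨v₁, v₂⟩
    · rcases hw with ⟨j, rfl⟩ | ⟨j, k, ops, rfl⟩ | h
      · exact .inl ⟨i, j, [], rfl⟩
      · exact .inl ⟨j, k, ops ++ [(i, true)], by simp [chainWord, wordStep]⟩
      · right
        intro B _ hB b
        rw [evalWord, h B hB, mul_zero]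
    · rcases w with k | ⟨w₁, w₂⟩
      · rcases hv with ⟨j, hj⟩ | ⟨i, j, ops, h⟩ | h
        · cases hj
        · exact .inl ⟨i, j, ops ++ [(k, false)], by rw [h]; simp [chainWord, wordStep]⟩
        · right
          intro B _ hB b
          rw [evalWord, h B hB, zero_mul]
      · right
        intro B _ hB b
        simp only [evalWord, hB]

/-- The letters of a chain word. -/
def chainLetters {X : Type} (i j : X) (ops : List (X × Bool)) : List X :=
  i :: j :: ops.map Prod.fst

theorem occurrences_chainWord {X : Type} [DecidableEq X] (k i j : X) (ops : List (X × Bool)) :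
    occurrences k (chainWord i j ops) = (chainLetters i j ops).count k := by
  have h : ∀ (ops : List (X × Bool)) (w : FreeMagma X),
      occurrences k (ops.foldl wordStep w) = occurrences k w + (ops.map Prod.fst).count k := by
    intro ops
    induction ops with
    | nil => intro w; simp
    | cons o ops ih =>
      intro w
      rw [List.foldl_cons, ih]
      rcases o with ⟨x, _ | _⟩ <;>
        simp [wordStep, occurrences, List.count_cons] <;> ring
  rw [chainWord, h]
  simp only [occurrences, chainLetters, List.count_cons, beq_iff_eq]
  ring

theorem chainLetters_perm {n : ℕ} {i j : Fin n} {ops : List (Fin n × Bool)}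
    (h : ∀ k, occurrences k (chainWord i j ops) = 1) :
    (chainLetters i j ops).Perm (List.finRange n) := by
  rw [List.perm_iff_count]
  intro k
  rw [← occurrences_chainWord, h, List.count_eq_one_of_mem (List.nodup_finRange n)
    (List.mem_finRange k)]

/-- Multiplication of an element by a letter on the left (`true`) or on the right (`false`). -/
def evalStep {X : Type} {B : Type u} [Mul B] (b : X → B) (u : B) (o : X × Bool) : B :=
  if o.2 then b o.1 * u else u * b o.1

theorem evalWord_chainWord {X : Type} {B : Type u} [Mul B] (b : X → B) (i j : X)
    (ops : List (X × Bool)) :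
    evalWord b (chainWord i j ops) = ops.foldl (evalStep b) (b i * b j) := by
  have h : ∀ (ops : List (X × Bool)) (w : FreeMagma X),
      evalWord b (ops.foldl wordStep w) = ops.foldl (evalStep b) (evalWord b w) := by
    intro ops
    induction ops with
    | nil => intro w; rfl
    | cons o ops ih =>
      intro w
      rw [List.foldl_cons, ih, List.foldl_cons]
      congr 1
      rcases o with ⟨x, _ | _⟩ <;> simp [wordStep, evalStep, evalWord]
  exact h ops _

/-- The effect of a left (`true`) or right (`false`) multiplication on the coefficient of a skew
word; the second component is the parity of the length of the word. -/
def coeffStep (s : (F × F) × Bool) (o : Bool) : (F × F) × Bool :=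
  (if o then (if s.2 then mulPhiSq s.1 else mulPhi s.1) else s.1, !s.2)

/-- The coefficient of the skew word corresponding to a sequence of multiplications. -/
def chainCoeff (κ : F × F) (ops : List Bool) : F × F :=
  (ops.foldl coeffStep (κ, false)).1

theorem mulPhiSq_mulPhi (κ : F × F) : mulPhiSq (mulPhi κ) = κ := by
  ext <;> simp [mulPhi, mulPhiSq]

theorem mulPhi_mulPhiSq (κ : F × F) : mulPhi (mulPhiSq κ) = κ := by
  ext <;> simp [mulPhi, mulPhiSq]

/-- Each step multiplies by 1, φ or φ², and K is commutative. This covers words whose evaluation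
starts from `y * y²`, which contributes φ², instead of `y² * y`. -/
theorem chainCoeff_mulPhiSq (κ : F × F) (ops : List Bool) :
    chainCoeff (mulPhiSq κ) ops = mulPhiSq (chainCoeff κ ops) := by
  have h : ∀ (ops : List Bool) (κ : F × F) (s : Bool),
      (ops.foldl coeffStep (mulPhiSq κ, s)).1 = mulPhiSq (ops.foldl coeffStep (κ, s)).1 := by
    intro ops
    induction ops with
    | nil => intro κ s; rfl
    | cons o ops ih =>
      intro κ s
      simp only [List.foldl_cons, coeffStep]
      rw [← ih]
      cases o <;> cases s <;> simp [mulPhiSq_mulPhi, mulPhi_mulPhiSq]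
  exact h ops κ false

theorem foldl_evalStep_skewWord [CharZero F] {X : Type} {B : Type u} [NonUnitalNonAssocRing B]
    [Module F B] [IsScalarTower F B B] [SMulCommClass F B B] (hB : IsAltMetabelian B)
    (b : X → B) (p q : B) (ops : List (X × Bool)) (κ : F × F) (l : List B)
    (hl : l = [] → κ.2 = 0) :
    ops.foldl (evalStep b) (skewWord κ (p * q) l) =
      skewWord ((ops.map Prod.snd).foldl coeffStep (κ, decide (Odd l.length))).1 (p * q)
        (l ++ ops.map fun o => b o.1) := by
  induction ops generalizing κ l with
  | nil => simp
  | cons o ops ih =>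
    have e : evalStep b (skewWord κ (p * q) l) o =
        skewWord (coeffStep (κ, decide (Odd l.length)) o.2).1 (p * q) (l ++ [b o.1]) := by
      rcases o with ⟨x, _ | _⟩
      · simp [evalStep, coeffStep, skewWord_mul κ _ _ _ hl]
      · simp only [evalStep, coeffStep, if_true, hB.mul_skewWord κ p q _ l hl, decide_eq_true_eq]
        congr 1
        by_cases h : Even l.length
        · rw [if_pos h, if_neg (Nat.not_odd_iff_even.2 h)]
        · rw [if_neg h, if_pos (Nat.not_even_iff_odd.1 h)]
    rw [List.foldl_cons, e, ih _ _ (by simp)]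
    have e2 : decide (Odd (l ++ [b o.1]).length) = !decide (Odd l.length) := by
      simp [Nat.odd_add_one, -Nat.not_odd_iff_even]
    rw [e2, List.map_cons, List.foldl_cons]
    simp [coeffStep]

theorem evalWord_chainWord_skew [CharZero F] {X : Type} {B : Type u} [NonUnitalNonAssocRing B]
    [Module F B] [IsScalarTower F B B] [SMulCommClass F B B] (hB : IsAltMetabelian B)
    (b : X → B) (i j : X) (ops : List (X × Bool)) :
    evalWord b (chainWord i j ops) =
      skewWord (chainCoeff ((1, 0) : F × F) (ops.map Prod.snd)) (b i * b j)
        (ops.map fun o => b o.1) := by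
  rw [evalWord_chainWord]
  have h := foldl_evalStep_skewWord hB b (b i) (b j) ops ((1, 0) : F × F) [] (by simp)
  simpa [skewWord, leftRightFold, chainCoeff] using h

/-- The polarized cube in degree three, and zero in other degrees. -/
def cubeTerm {n : ℕ} {B : Type u} [NonUnitalNonAssocRing B] (b : Fin n → B) : B :=
  if h : n = 3 then symCube (b ⟨0, by omega⟩) (b ⟨1, by omega⟩) (b ⟨2, by omega⟩) else 0

theorem symCube_swap_left {B : Type u} [NonUnitalNonAssocRing B] (x y z : B) :
    symCube x y z = symCube y x z := by simp only [symCube]; abel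

theorem symCube_swap_right {B : Type u} [NonUnitalNonAssocRing B] (x y z : B) :
    symCube x y z = symCube x z y := by simp only [symCube]; abel

theorem cubeTerm_eq {n : ℕ} {B : Type u} [NonUnitalNonAssocRing B] (b : Fin n → B)
    {i j k : Fin n} (h : [i, j, k].Perm (List.finRange n)) :
    symCube (b i) (b j) (b k) = cubeTerm b := by
  have hn : n = 3 := by simpa using h.length_eq.symm
  subst hn
  have hnd : [i, j, k].Nodup := h.nodup_iff.2 (List.nodup_finRange 3)
  rw [cubeTerm, dif_pos rfl]
  have key : ∀ i j k : Fin 3, [i, j, k].Nodup →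
      (i = 0 ∧ j = 1 ∧ k = 2) ∨ (i = 0 ∧ j = 2 ∧ k = 1) ∨ (i = 1 ∧ j = 0 ∧ k = 2) ∨
      (i = 1 ∧ j = 2 ∧ k = 0) ∨ (i = 2 ∧ j = 0 ∧ k = 1) ∨ (i = 2 ∧ j = 1 ∧ k = 0) := by decide
  rcases key i j k hnd with ⟨rfl, rfl, rfl⟩ | ⟨rfl, rfl, rfl⟩ | ⟨rfl, rfl, rfl⟩ |
    ⟨rfl, rfl, rfl⟩ | ⟨rfl, rfl, rfl⟩ | ⟨rfl, rfl, rfl⟩ <;>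
  · simp only [symCube, Fin.reduceFinMk, Fin.zero_eta, Fin.mk_one, Fin.isValue]; try abel

/-- The value of a chain word in an alternative metabelian algebra, as a sum of two skew functions
of lists and a multiple of the polarized cube. -/
theorem evalWord_chainWord_skewList [CharZero F] {n : ℕ} {B : Type u} [NonUnitalNonAssocRing B]
    [Module F B] [IsScalarTower F B B] [SMulCommClass F B B] (hB : IsAltMetabelian B)
    (b : Fin n → B) (i j : Fin n) (ops : List (Fin n × Bool)) (hops : ops ≠ [])
    (h : (chainLetters i j ops).Perm (List.finRange n)) :
    evalWord b (chainWord i j ops) =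
      skewList (chainCoeff ((1, 0) : F × F) (ops.map Prod.snd)) (b i)
        ((j :: ops.map Prod.fst).map b) +
      skewList (mulPhiSq (chainCoeff ((1, 0) : F × F) (ops.map Prod.snd))) (b j)
        ((i :: ops.map Prod.fst).map b) +
      (((chainCoeff ((1, 0) : F × F) (ops.map Prod.snd)).1 +
        (chainCoeff ((1, 0) : F × F) (ops.map Prod.snd)).2) / 6) • cubeTerm b := by
  obtain ⟨o, ops, rfl⟩ := List.exists_cons_of_ne_nil hops
  have e0 : (o :: ops).map (fun o => b o.1) = b o.1 :: ops.map (fun o => b o.1) := rfl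
  rw [evalWord_chainWord_skew (F := F) hB, e0, skewWord_cons]
  have e : ops.map (fun o => b o.1) = (ops.map Prod.fst).map b := by simp
  have hc : rightFold (symCube (b i) (b j) (b o.1)) (ops.map fun o => b o.1) = cubeTerm b := by
    cases ops with
    | nil => exact cubeTerm_eq b h
    | cons o' ops =>
      -- A letter beyond the first three forces n ≥ 4, where `cubeTerm` is 0 by definition; this
      -- agrees with the cube being annihilated by that letter.
      have hn : n ≠ 3 := by
        have := h.length_eq
        simp [chainLetters] at this
        omega
      rw [List.map_cons, rightFold_cons, hB.symCube_mul (F := F), rightFold_zero, cubeTerm,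
        dif_neg hn]
  rw [hc, e]
  rfl

end Words

/-! ### Grassmann monomials, supercommutativity and fresh generators. -/

section GrassmannAlgebra

variable (F : Type u) [Field F]

/-- The `k`-th generator of the Grassmann algebra. -/
noncomputable def grGen (k : ℕ) : Grassmann F := ExteriorAlgebra.ι F (Finsupp.single k 1)

variable {F}

theorem grGen_mem (k : ℕ) : grGen F k ∈ grassmannPart F 1 :=
  CliffordAlgebra.ι_mem_evenOdd_one _ _

theorem one_mem_grassmannPart : (1 : Grassmann F) ∈ grassmannPart F 0 :=
  SetLike.one_mem_graded _

theorem grassmannPart_mul_mem {i j : ZMod 2} {g h : Grassmann F} (hg : g ∈ grassmannPart F i)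
    (hh : h ∈ grassmannPart F j) : g * h ∈ grassmannPart F (i + j) :=
  CliffordAlgebra.evenOdd_mul_le _ i j (Submodule.mul_mem_mul hg hh)

theorem ι_mul_ι_swap (v w : ℕ →₀ F) :
    ExteriorAlgebra.ι F v * ExteriorAlgebra.ι F w =
      -(ExteriorAlgebra.ι F w * ExteriorAlgebra.ι F v) :=
  eq_neg_of_add_eq_zero_left (ExteriorAlgebra.ι_add_mul_swap v w)

theorem grassmann_even_comm {g : Grassmann F} (hg : g ∈ grassmannPart F 0) (h : Grassmann F) :
    g * h = h * g := by
  have key : ∀ (v : ℕ →₀ F), g * ExteriorAlgebra.ι F v = ExteriorAlgebra.ι F v * g := by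
    intro v
    induction g, hg using CliffordAlgebra.even_induction with
    | algebraMap r => exact Algebra.commutes _ _
    | add x y _ _ hx hy => rw [add_mul, hx, hy, mul_add]
    | ι_mul_ι_mul m₁ m₂ x _ ih =>
      change ExteriorAlgebra.ι F m₁ * ExteriorAlgebra.ι F m₂ * x * ExteriorAlgebra.ι F v =
        ExteriorAlgebra.ι F v * (ExteriorAlgebra.ι F m₁ * ExteriorAlgebra.ι F m₂ * x)
      rw [mul_assoc, ih, ← mul_assoc, mul_assoc (ExteriorAlgebra.ι F m₁), ι_mul_ι_swap m₂ v,
        mul_neg, ← mul_assoc, ι_mul_ι_swap m₁ v]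
      simp only [neg_mul, neg_neg, mul_assoc]
  induction h using CliffordAlgebra.left_induction with
  | algebraMap r => exact (Algebra.commutes _ _).symm
  | add x y hx hy => rw [mul_add, hx, hy, add_mul]
  | ι_mul x m hx =>
    change g * (ExteriorAlgebra.ι F m * x) = ExteriorAlgebra.ι F m * x * g
    rw [← mul_assoc, key, mul_assoc, hx, mul_assoc]

theorem grassmann_odd_anticomm {g h : Grassmann F} (hg : g ∈ grassmannPart F 1)
    (hh : h ∈ grassmannPart F 1) : g * h = -(h * g) := by
  have key : ∀ (v : ℕ →₀ F), g * ExteriorAlgebra.ι F v = -(ExteriorAlgebra.ι F v * g) := by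
    intro v
    induction g, hg using CliffordAlgebra.odd_induction with
    | ι w => exact ι_mul_ι_swap w v
    | add x y _ _ hx hy => rw [add_mul, hx, hy, mul_add, neg_add]
    | ι_mul_ι_mul m₁ m₂ x _ ih =>
      change ExteriorAlgebra.ι F m₁ * ExteriorAlgebra.ι F m₂ * x * ExteriorAlgebra.ι F v =
        -(ExteriorAlgebra.ι F v * (ExteriorAlgebra.ι F m₁ * ExteriorAlgebra.ι F m₂ * x))
      rw [mul_assoc, ih, mul_neg, ← mul_assoc, mul_assoc (ExteriorAlgebra.ι F m₁),
        ι_mul_ι_swap m₂ v, mul_neg, ← mul_assoc, ι_mul_ι_swap m₁ v]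
      simp only [neg_mul, neg_neg, mul_assoc]
  induction h, hh using CliffordAlgebra.odd_induction with
  | ι w => exact key w
  | add x y _ _ hx hy => rw [mul_add, hx, hy, add_mul, neg_add]
  | ι_mul_ι_mul m₁ m₂ x _ ih =>
    change g * (ExteriorAlgebra.ι F m₁ * ExteriorAlgebra.ι F m₂ * x) =
        -(ExteriorAlgebra.ι F m₁ * ExteriorAlgebra.ι F m₂ * x * g)
    rw [mul_assoc, ← mul_assoc g, key, neg_mul, mul_assoc _ g, ← mul_assoc g, key, neg_mul, mul_neg,
      neg_neg, mul_assoc _ g, ih, mul_neg, mul_neg]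
    simp only [mul_assoc]

/-- The sign `(-1)^{ij}`. -/
def superSign (F : Type u) [Field F] (i j : ZMod 2) : F := if i = 1 ∧ j = 1 then -1 else 1

theorem grassmann_supercomm {i j : ZMod 2} {g h : Grassmann F} (hg : g ∈ grassmannPart F i)
    (hh : h ∈ grassmannPart F j) : g * h = superSign F i j • (h * g) := by
  have h2 : ∀ i : ZMod 2, i = 0 ∨ i = 1 := by decide
  rcases h2 i with rfl | rfl
  · simp [superSign, grassmann_even_comm hg h]
  · rcases h2 j with rfl | rfl
    · simp [superSign, (grassmann_even_comm hh g).symm]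
    · simp [superSign, grassmann_odd_anticomm hg hh]

/-- The product of the generators with indices in a list. -/
noncomputable def grProd (l : List ℕ) : Grassmann F := (l.map (grGen F)).prod

theorem grProd_append (l l' : List ℕ) :
    (grProd (l ++ l') : Grassmann F) = grProd l * grProd l' := by
  simp [grProd]

theorem grProd_singleton (k : ℕ) : (grProd [k] : Grassmann F) = grGen F k := by
  simp [grProd]

theorem grProd_mem (l : List ℕ) : grProd l ∈ grassmannPart F (l.length : ZMod 2) := by
  induction l with
  | nil => simpa [grProd] using one_mem_grassmannPart
  | cons k l ih =>
    have h := grassmannPart_mul_mem (grGen_mem (F := F) k) ih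
    rw [add_comm] at h
    simpa [grProd] using h

theorem isSkewOnLists_grProd : IsSkewOnLists (grProd : List ℕ → Grassmann F) := by
  intro l a b l'
  have h : ∀ x y, (grProd (l ++ x :: y :: l') : Grassmann F) =
      grProd l * (grGen F x * grGen F y) * grProd l' := by
    intro x y; simp [grProd, mul_assoc]
  rw [h, h, grassmann_odd_anticomm (grGen_mem a) (grGen_mem b)]
  simp

theorem contractLeft_grProd_of_notMem {a : ℕ} {l : List ℕ} (h : a ∉ l) :
    CliffordAlgebra.contractLeft (Q := (0 : QuadraticForm F (ℕ →₀ F))) (Finsupp.lapply a)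
      (grProd l : Grassmann F) = 0 := by
  induction l with
  | nil => simp [grProd]
  | cons b l ih =>
    simp only [List.mem_cons, not_or] at h
    have e : (grProd (b :: l) : Grassmann F) =
      CliffordAlgebra.ι (0 : QuadraticForm F (ℕ →₀ F)) (Finsupp.single b 1) * grProd l := by
      simp [grProd, grGen]
    rw [e, CliffordAlgebra.contractLeft_ι_mul, ih h.2]
    simp [Ne.symm h.1]

/-- Contraction with the coordinate of the first generator strips it off, so a vanishing product
would descend to the empty product 1. -/
theorem grProd_ne_zero {l : List ℕ} (h : l.Nodup) : (grProd l : Grassmann F) ≠ 0 := by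
  induction l with
  | nil => simp [grProd]
  | cons b l ih =>
    rw [List.nodup_cons] at h
    intro h0
    have e : (grProd (b :: l) : Grassmann F) =
      CliffordAlgebra.ι (0 : QuadraticForm F (ℕ →₀ F)) (Finsupp.single b 1) * grProd l := by
      simp [grProd, grGen]
    have h1 := congrArg (CliffordAlgebra.contractLeft (Q := (0 : QuadraticForm F (ℕ →₀ F)))
      (Finsupp.lapply b)) h0
    rw [e, CliffordAlgebra.contractLeft_ι_mul, contractLeft_grProd_of_notMem h.1] at h1
    simp at h1
    exact ih h.2 h1

variable (F) in
/-- The endomorphism of the Grassmann algebra that shifts the generators by two. -/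
noncomputable def grShift : Grassmann F →ₐ[F] Grassmann F :=
  ExteriorAlgebra.map (Finsupp.lmapDomain F F (· + 2))

theorem contractLeft_grShift {a : ℕ} (ha : a < 2) (g : Grassmann F) :
    CliffordAlgebra.contractLeft (Q := (0 : QuadraticForm F (ℕ →₀ F))) (Finsupp.lapply a)
      (grShift F g) = 0 := by
  induction g using CliffordAlgebra.left_induction with
  | algebraMap r =>
    rw [AlgHom.commutes]; exact CliffordAlgebra.contractLeft_algebraMap _ _ _
  | add x y hx hy => rw [map_add, map_add, hx, hy, add_zero]
  | ι_mul x m hx =>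
    have e : grShift F (CliffordAlgebra.ι (0 : QuadraticForm F (ℕ →₀ F)) m * x) =
      CliffordAlgebra.ι (0 : QuadraticForm F (ℕ →₀ F)) (Finsupp.lmapDomain F F (· + 2) m) *
        grShift F x := by
      rw [map_mul]
      congr 1
      exact ExteriorAlgebra.map_apply_ι _ _
    rw [e, CliffordAlgebra.contractLeft_ι_mul, hx]
    have : (Finsupp.mapDomain (· + 2) m) a = 0 := by
      apply Finsupp.mapDomain_of_notMem_range
      rintro ⟨b, hb⟩
      simp only at hb
      omega
    simp [this]

theorem grShift_mem {i : ZMod 2} {g : Grassmann F} (hg : g ∈ grassmannPart F i) :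
    grShift F g ∈ grassmannPart F i := by
  have h2 : ∀ i : ZMod 2, i = 0 ∨ i = 1 := by decide
  have hι : ∀ v, grShift F (ExteriorAlgebra.ι F v) ∈ grassmannPart F 1 := by
    intro v
    rw [grShift, ExteriorAlgebra.map_apply_ι]
    exact CliffordAlgebra.ι_mem_evenOdd_one _ _
  rcases h2 i with rfl | rfl
  · induction g, hg using CliffordAlgebra.even_induction with
    | algebraMap r => rw [AlgHom.commutes]; exact SetLike.algebraMap_mem_graded _ _
    | add x y _ _ hx hy => rw [map_add]; exact Submodule.add_mem _ hx hy
    | ι_mul_ι_mul m₁ m₂ x _ ih =>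
      rw [map_mul, map_mul]
      exact grassmannPart_mul_mem (i := 0) (j := 0)
        (grassmannPart_mul_mem (i := 1) (j := 1) (hι m₁) (hι m₂)) ih
  · induction g, hg using CliffordAlgebra.odd_induction with
    | ι v => exact hι v
    | add x y _ _ hx hy => rw [map_add]; exact Submodule.add_mem _ hx hy
    | ι_mul_ι_mul m₁ m₂ x _ ih =>
      rw [map_mul, map_mul]
      exact grassmannPart_mul_mem (i := 0) (j := 1)
        (grassmannPart_mul_mem (i := 1) (j := 1) (hι m₁) (hι m₂)) ih

variable (F) in
/-- Shifting the generators and multiplying by the product of the two that became free. -/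
noncomputable def grFresh : Grassmann F →ₗ[F] Grassmann F :=
  LinearMap.mulLeft F (grGen F 0 * grGen F 1) ∘ₗ (grShift F).toLinearMap

/-- Two contractions remove the fresh generators, and the shift is undone by the algebra map induced
by a linear left inverse. A linear left inverse survives tensoring, which keeps `grFresh` injective
on `G ⊗ A`. -/
theorem grFresh_hasLeftInverse :
    ∃ L : Grassmann F →ₗ[F] Grassmann F, L ∘ₗ grFresh F = LinearMap.id := by
  have hinj : Function.Injective (fun k : ℕ => k + 2) := fun a b h => by simpa using h
  obtain ⟨g, hg⟩ := LinearMap.exists_leftInverse_of_injective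
    (Finsupp.lmapDomain F F (· + 2 : ℕ → ℕ))
    (LinearMap.ker_eq_bot.2 (Finsupp.mapDomain_injective hinj))
  refine ⟨(ExteriorAlgebra.map g).toLinearMap ∘ₗ
    CliffordAlgebra.contractLeft (Q := (0 : QuadraticForm F (ℕ →₀ F))) (Finsupp.lapply 1) ∘ₗ
    CliffordAlgebra.contractLeft (Q := (0 : QuadraticForm F (ℕ →₀ F))) (Finsupp.lapply 0),
    LinearMap.ext fun x => ?_⟩
  have e : grFresh F x = CliffordAlgebra.ι (0 : QuadraticForm F (ℕ →₀ F)) (Finsupp.single 0 1) *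
      (CliffordAlgebra.ι (0 : QuadraticForm F (ℕ →₀ F)) (Finsupp.single 1 1) * grShift F x) := by
    rw [← mul_assoc]; rfl
  have e0 : CliffordAlgebra.contractLeft (Q := (0 : QuadraticForm F (ℕ →₀ F))) (Finsupp.lapply 0)
      (grFresh F x) =
      CliffordAlgebra.ι (0 : QuadraticForm F (ℕ →₀ F)) (Finsupp.single 1 1) * grShift F x := by
    rw [e, CliffordAlgebra.contractLeft_ι_mul, CliffordAlgebra.contractLeft_ι_mul,
      contractLeft_grShift (show 0 < 2 by norm_num)]
    simp
  have e1 : CliffordAlgebra.contractLeft (Q := (0 : QuadraticForm F (ℕ →₀ F))) (Finsupp.lapply 1)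
      (CliffordAlgebra.ι (0 : QuadraticForm F (ℕ →₀ F)) (Finsupp.single 1 1) * grShift F x) =
      grShift F x := by
    rw [CliffordAlgebra.contractLeft_ι_mul, contractLeft_grShift (show 1 < 2 by norm_num)]
    simp
  have h := DFunLike.congr_fun
    (ExteriorAlgebra.map_comp_map (Finsupp.lmapDomain F F (· + 2 : ℕ → ℕ)) g) x
  rw [hg, ExteriorAlgebra.map_id] at h
  rw [LinearMap.comp_apply, LinearMap.comp_apply, LinearMap.comp_apply, e0, e1]
  exact h

end GrassmannAlgebra

/-! ### Identities of Grassmann envelopes in terms of homogeneous elements. -/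

section TensorTools

variable {F : Type u} [Field F]

section

variable {M N : Type u} [NonUnitalNonAssocRing M] [Module F M] [IsScalarTower F M M]
  [SMulCommClass F M M] [NonUnitalNonAssocRing N] [Module F N] [IsScalarTower F N N]
  [SMulCommClass F N N]

/-- The tensor product of an endomorphism of the Grassmann algebra and a homomorphism of
nonassociative algebras. -/
noncomputable def grTensorMap (σ : Grassmann F →ₐ[F] Grassmann F) (φ : M →ₙₐ[F] N) :
    Grassmann F ⊗[F] M →ₙₐ[F] Grassmann F ⊗[F] N where
  toFun := TensorProduct.map σ.toLinearMap (φ : M →ₗ[F] N)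
  map_smul' c x := map_smul _ c x
  map_zero' := map_zero _
  map_add' := map_add _
  map_mul' x y := by
    induction x with
    | zero => simp
    | add a b ha hb => rw [add_mul, map_add, ha, hb, map_add, add_mul]
    | tmul g a =>
      induction y with
      | zero => simp
      | add a b ha hb => rw [mul_add, map_add, ha, hb, map_add, mul_add]
      | tmul h b => simp

@[simp] theorem grTensorMap_tmul (σ : Grassmann F →ₐ[F] Grassmann F) (φ : M →ₙₐ[F] N)
    (g : Grassmann F) (a : M) : grTensorMap σ φ (g ⊗ₜ a) = σ g ⊗ₜ φ a := rfl

theorem grTensorMap_injective {φ : M →ₙₐ[F] N} (hφ : Function.Injective φ) :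
    Function.Injective (grTensorMap (AlgHom.id F (Grassmann F)) φ) :=
  Module.Flat.lTensor_preserves_injective_linearMap (M := Grassmann F) (φ : M →ₗ[F] N) hφ

/-- The coordinate functionals of a basis of the Grassmann algebra suffice. Consequently maps that
jointly separate points of `M`, even infinitely many, still do so after tensoring. -/
theorem tensor_eq_zero_of_functionals {M : Type u} [AddCommGroup M] [Module F M]
    (t : Grassmann F ⊗[F] M)
    (h : ∀ ξ : Grassmann F →ₗ[F] F, TensorProduct.lid F M (LinearMap.rTensor M ξ t) = 0) :
    t = 0 := by
  classical
  let ℬ := Module.Basis.ofVectorSpace F (Grassmann F)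
  apply (TensorProduct.equivFinsuppOfBasisLeft ℬ).injective
  ext i
  rw [TensorProduct.equivFinsuppOfBasisLeft_apply, map_zero, Finsupp.zero_apply]
  exact h _

end

/-- A homomorphism of nonassociative algebras that respects the gradings. -/
def IsGraded {A C : Superalgebra F} (φ : A.carrier →ₙₐ[F] C.carrier) : Prop :=
  ∀ i, ∀ a ∈ A.part i, φ a ∈ C.part i

variable {A C : Superalgebra F}

theorem tmul_mem_grassmannEnvelope {i : ZMod 2} {g : Grassmann F} {a : A.carrier}
    (hg : g ∈ grassmannPart F i) (ha : a ∈ A.part i) : g ⊗ₜ[F] a ∈ grassmannEnvelope A := by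
  have h2 : ∀ i : ZMod 2, i = 0 ∨ i = 1 := by decide
  have h := Submodule.apply_mem_map₂ (TensorProduct.mk F (Grassmann F) A.carrier) hg ha
  rcases h2 i with rfl | rfl
  · exact Submodule.mem_sup_left h
  · exact Submodule.mem_sup_right h

theorem grassmannEnvelope_induction {p : ∀ x, x ∈ grassmannEnvelope A → Prop}
    (zero : p 0 (zero_mem _)) (add : ∀ x y hx hy, p x hx → p y hy → p (x + y) (add_mem hx hy))
    (tmul : ∀ (i : ZMod 2) (g : Grassmann F) (a : A.carrier) (hg : g ∈ grassmannPart F i)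
      (ha : a ∈ A.part i), p (g ⊗ₜ a) (tmul_mem_grassmannEnvelope hg ha))
    {x : Grassmann F ⊗[F] A.carrier} (hx : x ∈ grassmannEnvelope A) : p x hx := by
  have key : ∀ i, ∀ x ∈ envelopePart A i, ∃ h : x ∈ grassmannEnvelope A, p x h := by
    intro i x hx
    rw [envelopePart, Submodule.map₂_eq_span_image2] at hx
    induction hx using Submodule.closure_induction with
    | zero => exact ⟨_, zero⟩
    | add x y _ _ hx hy => exact ⟨_, add x y _ _ hx.2 hy.2⟩
    | smul_mem r x hx =>
      obtain ⟨g, hg, a, ha, rfl⟩ := hx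
      exact ⟨_, tmul i (r • g) a (Submodule.smul_mem _ r hg) ha⟩
  obtain ⟨x₀, hx₀, x₁, hx₁, rfl⟩ := Submodule.mem_sup.1 hx
  exact add _ _ _ _ (key 0 _ hx₀).2 (key 1 _ hx₁).2

theorem grTensorMap_mem {σ : Grassmann F →ₐ[F] Grassmann F}
    (hσ : ∀ i, ∀ g ∈ grassmannPart F i, σ g ∈ grassmannPart F i) {φ : A.carrier →ₙₐ[F] C.carrier}
    (hφ : IsGraded φ) {x : Grassmann F ⊗[F] A.carrier} (hx : x ∈ grassmannEnvelope A) :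
    grTensorMap σ φ x ∈ grassmannEnvelope C := by
  induction hx using grassmannEnvelope_induction with
  | zero => rw [map_zero]; exact zero_mem _
  | add x y _ _ hx hy => rw [map_add]; exact add_mem hx hy
  | tmul i g a hg ha => exact tmul_mem_grassmannEnvelope (hσ i g hg) (hφ i a ha)

theorem satisfiesIdentity_subalgebra_iff {B : Type u} [NonUnitalNonAssocRing B] [Module F B]
    [IsScalarTower F B B] [SMulCommClass F B B] (S : NonUnitalSubalgebra F B) {n : ℕ}
    {f : FreeNonUnitalNonAssocAlgebra F (Fin n)} :
    SatisfiesIdentity F f S ↔ ∀ b : Fin n → B, (∀ i, b i ∈ S) →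
      FreeNonUnitalNonAssocAlgebra.lift F b f = 0 := by
  have key : ∀ b : Fin n → S, ((∑ w ∈ f.coeff.support, f.coeff w • evalWord b w : S) : B) =
      FreeNonUnitalNonAssocAlgebra.lift F (fun i => (b i : B)) f := by
    intro b
    have h : ∀ w, ((evalWord b w : S) : B) = evalWord (fun i => (b i : B)) w := by
      intro w
      induction w using FreeMagma.rec with
      | of i => rfl
      | mul v w hv hw => simp only [evalWord, ← hv, ← hw]; rfl
    rw [lift_eq_sum]
    simp [h]
  constructor
  · intro h b hb
    have h1 := h fun i => ⟨b i, hb i⟩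
    rw [lift_eq_sum] at h1
    rw [← key fun i => ⟨b i, hb i⟩, h1]
    rfl
  · intro h b
    rw [lift_eq_sum]
    apply Subtype.val_injective
    rw [key, h _ fun i => (b i).2]
    rfl

theorem satisfiesSuperidentity_iff {n : ℕ} {f : FreeNonUnitalNonAssocAlgebra F (Fin n)} :
    SatisfiesSuperidentity f A ↔ ∀ b : Fin n → Grassmann F ⊗[F] A.carrier,
      (∀ i, b i ∈ grassmannEnvelope A) → FreeNonUnitalNonAssocAlgebra.lift F b f = 0 :=
  satisfiesIdentity_subalgebra_iff (grassmannEnvelope A)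

theorem mem_altMetabelianSupervariety_iff :
    A ∈ altMetabelianSupervariety F ↔
      (∀ x ∈ grassmannEnvelope A, ∀ y ∈ grassmannEnvelope A, x * x * y - x * (x * y) = 0) ∧
      (∀ x ∈ grassmannEnvelope A, ∀ y ∈ grassmannEnvelope A, x * y * y - x * (y * y) = 0) ∧
      (∀ x ∈ grassmannEnvelope A, ∀ y ∈ grassmannEnvelope A, ∀ z ∈ grassmannEnvelope A,
        ∀ t ∈ grassmannEnvelope A, (x * y) * (z * t) = 0) := by
  constructor
  · rintro ⟨h1, h2, h3⟩
    refine ⟨fun x hx y hy => ?_, fun x hx y hy => ?_, fun x hx y hy z hz t ht => ?_⟩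
    · exact congrArg Subtype.val (h1 ⟨x, hx⟩ ⟨y, hy⟩)
    · exact congrArg Subtype.val (h2 ⟨x, hx⟩ ⟨y, hy⟩)
    · exact congrArg Subtype.val (h3 ⟨x, hx⟩ ⟨y, hy⟩ ⟨z, hz⟩ ⟨t, ht⟩)
  · rintro ⟨h1, h2, h3⟩
    refine ⟨fun x y => ?_, fun x y => ?_, fun x y z t => ?_⟩
    · exact Subtype.val_injective (h1 x x.2 y y.2)
    · exact Subtype.val_injective (h2 x x.2 y y.2)
    · exact Subtype.val_injective (h3 x x.2 y y.2 z z.2 t t.2)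

theorem mem_altMetabelianSupervariety_of_injective (hC : C ∈ altMetabelianSupervariety F)
    {φ : A.carrier →ₙₐ[F] C.carrier} (hφ : IsGraded φ) (hinj : Function.Injective φ) :
    A ∈ altMetabelianSupervariety F := by
  have hm := fun x hx => grTensorMap_mem (σ := AlgHom.id F (Grassmann F)) (fun _ _ h => h) hφ
    (x := x) hx
  have hi := grTensorMap_injective hinj
  rw [mem_altMetabelianSupervariety_iff] at hC ⊢
  refine ⟨fun x hx y hy => ?_, fun x hx y hy => ?_, fun x hx y hy z hz t ht => ?_⟩ <;>
  · apply hi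
    simp only [map_sub, map_mul, map_zero]
    first
    | exact hC.1 _ (hm x hx) _ (hm y hy)
    | exact hC.2.1 _ (hm x hx) _ (hm y hy)
    | exact hC.2.2 _ (hm x hx) _ (hm y hy) _ (hm z hz) _ (hm t ht)

theorem SatisfiesSuperidentity.of_injective {n : ℕ} {f : FreeNonUnitalNonAssocAlgebra F (Fin n)}
    (hC : SatisfiesSuperidentity f C) {φ : A.carrier →ₙₐ[F] C.carrier} (hφ : IsGraded φ)
    (hinj : Function.Injective φ) : SatisfiesSuperidentity f A := by
  rw [satisfiesSuperidentity_iff] at hC ⊢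
  intro b hb
  apply grTensorMap_injective hinj
  rw [map_lift, map_zero]
  exact hC _ fun i => grTensorMap_mem (fun _ _ h => h) hφ (hb i)

theorem superSign_comm (i j : ZMod 2) : superSign F i j = superSign F j i := by
  simp only [superSign, and_comm]

theorem tensor_metabelian (hZ : ∀ a b c d : A.carrier, (a * b) * (c * d) = 0)
    (x y z t : Grassmann F ⊗[F] A.carrier) : (x * y) * (z * t) = 0 := by
  induction x with
  | zero => simp
  | add u v hu hv => simp only [add_mul, hu, hv, add_zero]
  | tmul g a =>
  induction y with
  | zero => simp
  | add u v hu hv => simp only [add_mul, mul_add, hu, hv, add_zero]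
  | tmul g a =>
  induction z with
  | zero => simp
  | add u v hu hv => simp only [add_mul, mul_add, hu, hv, add_zero]
  | tmul g a =>
  induction t with
  | zero => simp
  | add u v hu hv => simp only [mul_add, hu, hv, add_zero]
  | tmul g a => simp [hZ]

/-- Alternativity and metabelianity of the Grassmann envelope in terms of homogeneous elements. -/
theorem mem_altMetabelianSupervariety_of_homogeneous [CharZero F]
    (hL : ∀ (i j k : ZMod 2), ∀ a ∈ A.part i, ∀ b ∈ A.part j, ∀ c ∈ A.part k,
      (a * b * c - a * (b * c)) + superSign F i j • (b * a * c - b * (a * c)) = 0)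
    (hR : ∀ (i j k : ZMod 2), ∀ a ∈ A.part i, ∀ b ∈ A.part j, ∀ c ∈ A.part k,
      (a * b * c - a * (b * c)) + superSign F j k • (a * c * b - a * (c * b)) = 0)
    (hZ : ∀ a b c d : A.carrier, (a * b) * (c * d) = 0) : A ∈ altMetabelianSupervariety F := by
  have half : ∀ t : Grassmann F ⊗[F] A.carrier, t + t = 0 → t = 0 := by
    intro t ht
    rw [← two_smul F] at ht
    exact (smul_eq_zero.1 ht).resolve_left two_ne_zero
  rw [mem_altMetabelianSupervariety_iff]
  refine ⟨fun x hx y hy => ?_, fun x hx y hy => ?_, fun x hx y hy z hz t ht => ?_⟩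
  -- The law is proved in its polarized form, which is additive in each argument and so reduces to
  -- pure tensors; `x' = x` then gives twice the original law.
  · suffices h : ∀ x' ∈ grassmannEnvelope A,
        (x * x' * y - x * (x' * y)) + (x' * x * y - x' * (x * y)) = 0 from half _ (h x hx)
    intro x' hx'
    induction hx using grassmannEnvelope_induction with
    | zero => simp
    | add u v _ _ hu hv =>
      simp only [add_mul, mul_add]
      linear_combination (norm := abel) hu + hv
    | tmul i g a hg ha =>
    induction hx' using grassmannEnvelope_induction with
    | zero => simp
    | add u v _ _ hu hv =>
      simp only [add_mul, mul_add]
      linear_combination (norm := abel) hu + hv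
    | tmul j h b hh hb =>
    induction hy using grassmannEnvelope_induction with
    | zero => simp
    | add u v _ _ hu hv =>
      simp only [mul_add]
      linear_combination (norm := abel) hu + hv
    | tmul k e c he hc =>
      have key := congrArg (fun s => (g * h * e) ⊗ₜ[F] s) (hL i j k a ha b hb c hc)
      simp only [TensorProduct.tmul_add, TensorProduct.tmul_sub, TensorProduct.tmul_smul,
        TensorProduct.tmul_zero, smul_sub] at key
      simp only [Algebra.TensorProduct.tmul_mul_tmul]
      -- Exchanging the Grassmann factors produces exactly the sign that appears in `hL`.
      rw [← mul_assoc, ← mul_assoc, grassmann_supercomm hh hg, superSign_comm]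
      simp only [smul_mul_assoc, ← TensorProduct.smul_tmul']
      exact key
  · suffices h : ∀ y' ∈ grassmannEnvelope A,
        (x * y * y' - x * (y * y')) + (x * y' * y - x * (y' * y)) = 0 from half _ (h y hy)
    intro y' hy'
    induction hx using grassmannEnvelope_induction with
    | zero => simp
    | add u v _ _ hu hv =>
      simp only [add_mul]
      linear_combination (norm := abel) hu + hv
    | tmul i g a hg ha =>
    induction hy using grassmannEnvelope_induction with
    | zero => simp
    | add u v _ _ hu hv =>
      simp only [add_mul, mul_add]
      linear_combination (norm := abel) hu + hv
    | tmul j h b hh hb =>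
    induction hy' using grassmannEnvelope_induction with
    | zero => simp
    | add u v _ _ hu hv =>
      simp only [add_mul, mul_add]
      linear_combination (norm := abel) hu + hv
    | tmul k e c he hc =>
      have key := congrArg (fun s => (g * (h * e)) ⊗ₜ[F] s) (hR i j k a ha b hb c hc)
      simp only [TensorProduct.tmul_add, TensorProduct.tmul_sub, TensorProduct.tmul_smul,
        TensorProduct.tmul_zero, smul_sub] at key
      simp only [Algebra.TensorProduct.tmul_mul_tmul]
      rw [mul_assoc, mul_assoc, grassmann_supercomm he hh, superSign_comm]
      simp only [mul_smul_comm, ← TensorProduct.smul_tmul']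
      exact key
  · exact tensor_metabelian hZ x y z t

end TensorTools

/-! ### Free superalgebras of the variety and their universal property. -/

section FreeSuperalgebra

variable {F : Type u} [Field F]

/-- The projection onto a quotient superalgebra as a homomorphism. -/
def GradedIdeal.projHom {A : Superalgebra F} (J : GradedIdeal A) :
    A.carrier →ₙₐ[F] J.quotient.carrier where
  toFun := J.proj
  map_smul' c x := map_smul J.proj c x
  map_zero' := map_zero J.proj
  map_add' := map_add J.proj
  map_mul' := J.proj_mul

theorem GradedIdeal.projHom_surjective {A : Superalgebra F} (J : GradedIdeal A) :
    Function.Surjective J.projHom := J.proj_surjective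

theorem GradedIdeal.projHom_eq_zero_iff {A : Superalgebra F} (J : GradedIdeal A) (a : A.carrier) :
    J.projHom a = 0 ↔ a ∈ J.toSubmodule := J.proj_eq_zero_iff a

theorem GradedIdeal.isGraded_projHom {A : Superalgebra F} (J : GradedIdeal A) :
    IsGraded J.projHom := fun _ a ha => ⟨a, ha, rfl⟩

/-- A homomorphism that vanishes on an ideal factors through the quotient. -/
def GradedIdeal.liftHom {A C : Superalgebra F} (J : GradedIdeal A) (φ : A.carrier →ₙₐ[F] C.carrier)
    (h : ∀ a ∈ J.toSubmodule, φ a = 0) : J.quotient.carrier →ₙₐ[F] C.carrier where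
  toFun := J.toSubmodule.liftQ (φ : A.carrier →ₗ[F] C.carrier) h
  map_smul' c x := map_smul (J.toSubmodule.liftQ (φ : A.carrier →ₗ[F] C.carrier) h) c x
  map_zero' := map_zero (J.toSubmodule.liftQ (φ : A.carrier →ₗ[F] C.carrier) h)
  map_add' := map_add (J.toSubmodule.liftQ (φ : A.carrier →ₗ[F] C.carrier) h)
  map_mul' x y := by
    obtain ⟨a, rfl⟩ := J.proj_surjective x
    obtain ⟨b, rfl⟩ := J.proj_surjective y
    exact map_mul φ a b

theorem GradedIdeal.liftHom_projHom {A C : Superalgebra F} (J : GradedIdeal A)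
    (φ : A.carrier →ₙₐ[F] C.carrier) (h : ∀ a ∈ J.toSubmodule, φ a = 0) (a : A.carrier) :
    J.liftHom φ h (J.projHom a) = φ a := rfl

theorem GradedIdeal.isGraded_liftHom {A C : Superalgebra F} (J : GradedIdeal A)
    {φ : A.carrier →ₙₐ[F] C.carrier} (hφ : IsGraded φ) (h : ∀ a ∈ J.toSubmodule, φ a = 0) :
    IsGraded (J.liftHom φ h) := by
  rintro i _ ⟨a, ha, rfl⟩
  exact hφ i a ha

/-- The kernel of a graded homomorphism. -/
def gradedKer {A C : Superalgebra F} (φ : A.carrier →ₙₐ[F] C.carrier) (hφ : IsGraded φ) :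
    GradedIdeal A where
  toSubmodule := LinearMap.ker (φ : A.carrier →ₗ[F] C.carrier)
  mul_mem_left a x hx := by
    have hx : φ x = 0 := hx
    change φ (a * x) = 0
    rw [map_mul, hx, mul_zero]
  mul_mem_right a x hx := by
    have hx : φ x = 0 := hx
    change φ (x * a) = 0
    rw [map_mul, hx, zero_mul]
  homogeneous a₀ h₀ a₁ h₁ h := by
    have h : φ (a₀ + a₁) = 0 := h
    rw [map_add] at h
    have e : φ a₀ = 0 := by
      refine Submodule.disjoint_def.1 C.isCompl.disjoint _ (hφ 0 a₀ h₀) ?_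
      rw [eq_neg_of_add_eq_zero_left h]
      exact Submodule.neg_mem _ (hφ 1 a₁ h₁)
    refine ⟨e, ?_⟩
    rw [e, zero_add] at h
    exact h

/-- The quotient by the kernel embeds into `C`, and the laws pass to subalgebras. -/
theorem gradedKer_quotient_mem {A C : Superalgebra F} (φ : A.carrier →ₙₐ[F] C.carrier)
    (hφ : IsGraded φ) (hC : C ∈ altMetabelianSupervariety F) :
    (gradedKer φ hφ).quotient ∈ altMetabelianSupervariety F := by
  have hk : ∀ a ∈ (gradedKer φ hφ).toSubmodule, φ a = 0 := fun a ha => ha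
  refine mem_altMetabelianSupervariety_of_injective hC
    ((gradedKer φ hφ).isGraded_liftHom hφ hk) ?_
  rw [injective_iff_map_eq_zero]
  intro x hx
  obtain ⟨a, rfl⟩ := (gradedKer φ hφ).projHom_surjective x
  rw [GradedIdeal.liftHom_projHom] at hx
  exact ((gradedKer φ hφ).projHom_eq_zero_iff a).2 hx

/-- The quotient by the intersection maps to every `A / J`, and these maps jointly separate points,
also after tensoring with the Grassmann algebra. A law valid in every `A / J` therefore holds in it.
-/
theorem inter_quotient_mem {A : Superalgebra F} {S : Set (GradedIdeal A)}
    (hS : ∀ J ∈ S, J.quotient ∈ altMetabelianSupervariety F) :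
    (GradedIdeal.inter S).quotient ∈ altMetabelianSupervariety F := by
  set I := GradedIdeal.inter S with hI
  have hle : ∀ J ∈ S, ∀ a ∈ I.toSubmodule, J.projHom a = 0 := by
    intro J hJ a ha
    have ha' : a ∈ ⨅ J ∈ S, J.toSubmodule := ha
    simp only [Submodule.mem_iInf] at ha'
    exact (J.projHom_eq_zero_iff a).2 (ha' J hJ)
  let π : ∀ J ∈ S, I.quotient.carrier →ₙₐ[F] J.quotient.carrier :=
    fun J hJ => I.liftHom J.projHom (hle J hJ)
  have hπ : ∀ J hJ, IsGraded (π J hJ) := fun J hJ =>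
    I.isGraded_liftHom J.isGraded_projHom (hle J hJ)
  have hsep : ∀ q : I.quotient.carrier, (∀ J hJ, π J hJ q = 0) → q = 0 := by
    intro q hq
    obtain ⟨a, rfl⟩ := I.projHom_surjective q
    rw [I.projHom_eq_zero_iff]
    change a ∈ ⨅ J ∈ S, J.toSubmodule
    simp only [Submodule.mem_iInf]
    exact fun J hJ => (J.projHom_eq_zero_iff a).1 (hq J hJ)
  have hsep' : ∀ t : Grassmann F ⊗[F] I.quotient.carrier,
      (∀ J hJ, grTensorMap (AlgHom.id F _) (π J hJ) t = 0) → t = 0 := by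
    intro t ht
    apply tensor_eq_zero_of_functionals
    intro ξ
    apply hsep
    intro J hJ
    have h1 : π J hJ (TensorProduct.lid F _ (LinearMap.rTensor _ ξ t)) =
        TensorProduct.lid F _ (LinearMap.rTensor _ ξ (grTensorMap (AlgHom.id F _) (π J hJ) t)) := by
      clear ht
      induction t with
      | zero => simp
      | add x y hx hy => simp only [map_add, hx, hy]
      | tmul g a => simp
    rw [h1, ht J hJ, map_zero, map_zero]
  have hm := fun J hJ x hx => grTensorMap_mem (σ := AlgHom.id F (Grassmann F)) (fun _ _ h => h)
    (hπ J hJ) (x := x) hx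
  rw [mem_altMetabelianSupervariety_iff]
  refine ⟨fun x hx y hy => ?_, fun x hx y hy => ?_, fun x hx y hy z hz t ht => ?_⟩ <;>
  · apply hsep'
    intro J hJ
    have hJ' := mem_altMetabelianSupervariety_iff.1 (hS J hJ)
    simp only [map_sub, map_mul]
    first
    | exact hJ'.1 _ (hm J hJ x hx) _ (hm J hJ y hy)
    | exact hJ'.2.1 _ (hm J hJ x hx) _ (hm J hJ y hy)
    | exact hJ'.2.2 _ (hm J hJ x hx) _ (hm J hJ y hy) _ (hm J hJ z hz) _ (hm J hJ t ht)

theorem freeAltMetabelian_mem (r s : ℕ) :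
    freeAltMetabelian F r s ∈ altMetabelianSupervariety F :=
  inter_quotient_mem fun _ h => h

variable (F) in
/-- The canonical projection of the free nonassociative superalgebra. -/
noncomputable def freeProj (r s : ℕ) :
    (freeSuperalgebra F r s).carrier →ₙₐ[F] (freeAltMetabelian F r s).carrier :=
  GradedIdeal.projHom _

theorem freeProj_surjective (r s : ℕ) : Function.Surjective (freeProj F r s) :=
  GradedIdeal.projHom_surjective _

variable (F) in
/-- A nonassociative word as an element of the free nonassociative superalgebra. -/
noncomputable def freeMonomial (r s : ℕ) (w : FreeMagma (Fin r ⊕ Fin s)) :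
    (freeSuperalgebra F r s).carrier :=
  (MonoidAlgebra.single w (1 : F) : FreeNonUnitalNonAssocAlgebra F _)

theorem freeMonomial_mul (r s : ℕ) (v w : FreeMagma (Fin r ⊕ Fin s)) :
    freeMonomial F r s (.mul v w) = freeMonomial F r s v * freeMonomial F r s w := by
  have h : (MonoidAlgebra.single (v * w) (1 : F) : FreeNonUnitalNonAssocAlgebra F _) =
      MonoidAlgebra.single v (1 : F) * MonoidAlgebra.single w (1 : F) := by
    rw [MonoidAlgebra.single_mul_single, mul_one]
  exact h

theorem freeSuperalgebra_part (r s : ℕ) (i : ZMod 2) : (freeSuperalgebra F r s).part i =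
    Submodule.span F {a | ∃ w, parity w = i ∧ a = freeMonomial F r s w} := rfl

variable (F) in
/-- The class of a nonassociative word in the free `Alt⁽²⁾`-superalgebra. -/
noncomputable def freeWord (r s : ℕ) (w : FreeMagma (Fin r ⊕ Fin s)) :
    (freeAltMetabelian F r s).carrier :=
  freeProj F r s (freeMonomial F r s w)

theorem freeWord_mul (r s : ℕ) (v w : FreeMagma (Fin r ⊕ Fin s)) :
    freeWord F r s (.mul v w) = freeWord F r s v * freeWord F r s w := by
  rw [freeWord, freeWord, freeWord, ← map_mul, freeMonomial_mul]

theorem freeAltMetabelian_part (r s : ℕ) (i : ZMod 2) :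
    (freeAltMetabelian F r s).part i =
      Submodule.span F {a | ∃ w, parity w = i ∧ a = freeWord F r s w} := by
  change Submodule.map (freeProj F r s : (freeSuperalgebra F r s).carrier →ₗ[F]
    (freeAltMetabelian F r s).carrier) ((freeSuperalgebra F r s).part i) = _
  rw [freeSuperalgebra_part, Submodule.map_span]
  congr 1
  ext a
  constructor
  · rintro ⟨_, ⟨w, hw, rfl⟩, rfl⟩
    exact ⟨w, hw, rfl⟩
  · rintro ⟨w, hw, rfl⟩
    exact ⟨_, ⟨w, hw, rfl⟩, rfl⟩

theorem freeWord_mem (r s : ℕ) (w : FreeMagma (Fin r ⊕ Fin s)) :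
    freeWord F r s w ∈ (freeAltMetabelian F r s).part (parity w) := by
  rw [freeAltMetabelian_part]
  exact Submodule.subset_span ⟨w, rfl, rfl⟩

variable (F) in
/-- A generator of the free `Alt⁽²⁾`-superalgebra. -/
noncomputable def freeGen (r s : ℕ) (x : Fin r ⊕ Fin s) : (freeAltMetabelian F r s).carrier :=
  freeWord F r s (.of x)

theorem freeAltMetabelian_hom_ext {r s : ℕ} {C : Superalgebra F}
    {φ ψ : (freeAltMetabelian F r s).carrier →ₙₐ[F] C.carrier}
    (h : ∀ x, φ (freeGen F r s x) = ψ (freeGen F r s x)) (a) : φ a = ψ a := by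
  obtain ⟨f, rfl⟩ := freeProj_surjective r s a
  have h2 : φ.comp (freeProj F r s) = ψ.comp (freeProj F r s) :=
    FreeNonUnitalNonAssocAlgebra.hom_ext (R := F) (X := Fin r ⊕ Fin s) h
  exact DFunLike.congr_fun h2 f

/-- The parity of a generator. -/
def genParity {r s : ℕ} (x : Fin r ⊕ Fin s) : ZMod 2 := parity (.of x)

/-- The kernel of the map from the free nonassociative superalgebra is one of the ideals being
intersected, so the map factors through the quotient. -/
theorem exists_hom_freeAltMetabelian {r s : ℕ} {C : Superalgebra F}
    (hC : C ∈ altMetabelianSupervariety F) (c : Fin r ⊕ Fin s → C.carrier)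
    (hc : ∀ x, c x ∈ C.part (genParity x)) :
    ∃ φ : (freeAltMetabelian F r s).carrier →ₙₐ[F] C.carrier,
      IsGraded φ ∧ ∀ x, φ (freeGen F r s x) = c x := by
  let Φ : (freeSuperalgebra F r s).carrier →ₙₐ[F] C.carrier :=
    FreeNonUnitalNonAssocAlgebra.lift F c
  have hw : ∀ w : FreeMagma (Fin r ⊕ Fin s), evalWord c w ∈ C.part (parity w) := by
    intro w
    induction w using FreeMagma.rec with
    | of x => exact hc x
    | mul v w hv hw => exact C.mul_mem _ _ _ _ hv hw
  have hΦ1 : ∀ w, Φ (freeMonomial F r s w) = evalWord c w :=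
    fun w => (lift_single c w 1).trans (one_smul _ _)
  have hΦ : IsGraded Φ := by
    intro i a ha
    have hle : (freeSuperalgebra F r s).part i ≤
        (C.part i).comap (Φ : (freeSuperalgebra F r s).carrier →ₗ[F] C.carrier) := by
      rw [freeSuperalgebra_part, Submodule.span_le]
      rintro _ ⟨w, rfl, rfl⟩
      change Φ _ ∈ C.part _
      rw [hΦ1]
      exact hw w
    exact hle ha
  have hker : ∀ a ∈ (GradedIdeal.inter {J : GradedIdeal (freeSuperalgebra F r s) |
      J.quotient ∈ altMetabelianSupervariety F}).toSubmodule, Φ a = 0 := by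
    intro a ha
    have ha' : a ∈ ⨅ J ∈ {J : GradedIdeal (freeSuperalgebra F r s) |
      J.quotient ∈ altMetabelianSupervariety F}, J.toSubmodule := ha
    simp only [Submodule.mem_iInf] at ha'
    exact ha' (gradedKer Φ hΦ) (gradedKer_quotient_mem Φ hΦ hC)
  refine ⟨GradedIdeal.liftHom _ Φ hker, GradedIdeal.isGraded_liftHom _ hΦ hker, fun x => ?_⟩
  exact hΦ1 (.of x)

/-- Superidentities pass to free superalgebras with fewer generators. -/
theorem SatisfiesSuperidentity.of_le {n : ℕ} {f : FreeNonUnitalNonAssocAlgebra F (Fin n)}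
    {r s r' s' : ℕ} (hr : r ≤ r') (hs : s ≤ s')
    (h : SatisfiesSuperidentity f (freeAltMetabelian F r' s')) :
    SatisfiesSuperidentity f (freeAltMetabelian F r s) := by
  let emb : Fin r ⊕ Fin s → Fin r' ⊕ Fin s' := Sum.map (Fin.castLE hr) (Fin.castLE hs)
  have hemb : ∀ x, genParity (emb x) = genParity x := by rintro (x | x) <;> rfl
  have hinj : Function.Injective emb := Sum.map_injective.2
    ⟨Fin.castLE_injective hr, Fin.castLE_injective hs⟩
  obtain ⟨φ, hφ, hφx⟩ := exists_hom_freeAltMetabelian (freeAltMetabelian_mem (F := F) r' s')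
    (fun x : Fin r ⊕ Fin s => freeGen F r' s' (emb x)) (fun x => by
      rw [← hemb]; exact freeWord_mem _ _ _)
  classical
  -- The superfluous generators go to 0, so the smaller free superalgebra is a retract of the larger
  -- one.
  obtain ⟨ψ, hψ, hψx⟩ := exists_hom_freeAltMetabelian (freeAltMetabelian_mem (F := F) r s)
    (fun x : Fin r' ⊕ Fin s' => if hx : ∃ y, emb y = x then freeGen F r s hx.choose else 0)
    (fun x => by
      by_cases hx : ∃ y, emb y = x
      · rw [dif_pos hx]
        have h1 := hemb hx.choose
        rw [hx.choose_spec] at h1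
        rw [h1]
        exact freeWord_mem _ _ _
      · rw [dif_neg hx]; exact Submodule.zero_mem _)
  have hinv : ∀ a, ψ (φ a) = a := by
    intro a
    refine freeAltMetabelian_hom_ext (φ := ψ.comp φ) (ψ := NonUnitalAlgHom.id F _) ?_ a
    intro x
    have hx : ∃ y, emb y = emb x := ⟨x, rfl⟩
    simp only [NonUnitalAlgHom.comp_apply, hφx, hψx, dif_pos hx]
    rw [hinj hx.choose_spec]
    rfl
  exact h.of_injective hφ (Function.LeftInverse.injective hinv)

theorem altSV_mono {r s r' s' : ℕ} (hr : r ≤ r') (hs : s ≤ s') :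
    altSV F r s ⊆ altSV F r' s' :=
  fun _ hB n f hf h => hB n f hf (h.of_le hr hs)

theorem freeAltMetabelian_mem_altSV (r s : ℕ) : freeAltMetabelian F r s ∈ altSV F r s :=
  fun _ _ _ h => h

/-- Induction on the Grassmann envelope of the free `Alt⁽²⁾`-superalgebra. -/
theorem freeEnvelope_induction {r s : ℕ}
    {p : Grassmann F ⊗[F] (freeAltMetabelian F r s).carrier → Prop}
    (zero : p 0) (add : ∀ x y, p x → p y → p (x + y))
    (gen : ∀ (x : Fin r ⊕ Fin s) (g : Grassmann F), g ∈ grassmannPart F (genParity x) →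
      p (g ⊗ₜ freeGen F r s x))
    (mul : ∀ (i j : ZMod 2) (g : Grassmann F) (a b : (freeAltMetabelian F r s).carrier),
      g ∈ grassmannPart F (i + j) → a ∈ (freeAltMetabelian F r s).part i →
      b ∈ (freeAltMetabelian F r s).part j → p (g ⊗ₜ (a * b)))
    {x : Grassmann F ⊗[F] (freeAltMetabelian F r s).carrier}
    (hx : x ∈ grassmannEnvelope (freeAltMetabelian F r s)) : p x := by
  induction hx using grassmannEnvelope_induction with
  | zero => exact zero
  | add x y _ _ hx hy => exact add x y hx hy
  | tmul i g a hg ha =>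
    rw [freeAltMetabelian_part] at ha
    induction ha using Submodule.closure_induction with
    | zero => rw [TensorProduct.tmul_zero]; exact zero
    | add x y _ _ hx hy => rw [TensorProduct.tmul_add]; exact add _ _ hx hy
    | smul_mem c x hx =>
      obtain ⟨w, rfl, rfl⟩ := hx
      rw [TensorProduct.tmul_smul, TensorProduct.smul_tmul']
      have hg' := Submodule.smul_mem _ c hg
      rcases w with x | ⟨v, w⟩
      · exact gen x _ hg'
      · rw [freeWord_mul]
        exact mul _ _ _ _ _ hg' (freeWord_mem _ _ _) (freeWord_mem _ _ _)

end FreeSuperalgebra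

/-! ### The model with one odd generator over K = F[φ]. -/

section Models

variable {F : Type u} [Field F]

/-- The nonassociative algebra with a given bilinear multiplication. -/
def BilinAlgebra {M : Type u} [AddCommGroup M] [Module F M] (_β : M →ₗ[F] M →ₗ[F] M) : Type u := M

section

variable {M : Type u} [AddCommGroup M] [Module F M] (β : M →ₗ[F] M →ₗ[F] M)

instance : AddCommGroup (BilinAlgebra β) := inferInstanceAs (AddCommGroup M)

instance : Module F (BilinAlgebra β) := inferInstanceAs (Module F M)

instance : NonUnitalNonAssocRing (BilinAlgebra β) where
  mul x y := β x y
  left_distrib x y z := map_add (β x) y z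
  right_distrib x y z := LinearMap.map_add₂ β x y z
  zero_mul x := LinearMap.map_zero₂ β x
  mul_zero x := map_zero (β x)

/-- The superalgebra with a given even bilinear multiplication on a `ℤ/2`-graded space. -/
def bilinSuperalgebra (P₀ P₁ : Submodule F M) (hP : IsCompl P₀ P₁)
    (h00 : ∀ a ∈ P₀, ∀ b ∈ P₀, β a b ∈ P₀) (h01 : ∀ a ∈ P₀, ∀ b ∈ P₁, β a b ∈ P₁)
    (h10 : ∀ a ∈ P₁, ∀ b ∈ P₀, β a b ∈ P₁) (h11 : ∀ a ∈ P₁, ∀ b ∈ P₁, β a b ∈ P₀) :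
    Superalgebra F where
  carrier := BilinAlgebra β
  ring := inferInstance
  module := inferInstance
  isScalarTower := ⟨fun c x y => LinearMap.map_smul₂ β c x y⟩
  smulCommClass := ⟨fun c x y => (map_smul (β x) c y).symm⟩
  part i := if i = 0 then P₀ else P₁
  isCompl := hP
  mul_mem := by
    have h2 : ∀ i : ZMod 2, i = 0 ∨ i = 1 := by decide
    intro i j a b ha hb
    rcases h2 i with rfl | rfl <;> rcases h2 j with rfl | rfl
    · exact h00 a ha b hb
    · exact h01 a ha b hb
    · exact h10 a ha b hb
    · exact h11 a ha b hb

end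

theorem zmod_two_forall {p : ZMod 2 → Prop} (h0 : p 0) (h1 : p 1) (i : ZMod 2) : p i := by
  have h2 : ∀ i : ZMod 2, i = 0 ∨ i = 1 := by decide
  rcases h2 i with rfl | rfl <;> assumption

/-! ### The model with one odd generator and skew multiplications -/

variable (F) in
/-- The multiplication of the model `F y ⊕ K₀ ⊕ K₁`, where `K = F[φ]`. -/
def skewModelMul : (F × (F × F) × (F × F)) →ₗ[F] (F × (F × F) × (F × F)) →ₗ[F]
    (F × (F × F) × (F × F)) :=
  LinearMap.mk₂ F
    -- Here `y * y` is 1 in K₀; right multiplication by `y` is the identity between K₀ and K₁; left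
    -- multiplication by `y` is φ² from K₀ to K₁ and -φ from K₁ to K₀.
    (fun x y => (0, (x.1 * y.1 + x.1 * y.2.2.2 + y.1 * x.2.2.1,
        -(x.1 * (y.2.2.1 - y.2.2.2)) + y.1 * x.2.2.2),
      (x.1 * (y.2.1.2 - y.2.1.1) + y.1 * x.2.1.1, -(x.1 * y.2.1.1) + y.1 * x.2.1.2)))
    (by intro x x' y; ext <;> simp <;> ring)
    (by intro c x y; ext <;> simp <;> ring)
    (by intro x y y'; ext <;> simp <;> ring)
    (by intro c x y; ext <;> simp <;> ring)

variable (F) in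
/-- The `Alt⁽²⁾`-superalgebra `F y ⊕ K₀ ⊕ K₁`. -/
def skewModel : Superalgebra F :=
  bilinSuperalgebra (skewModelMul F)
    (LinearMap.ker ((LinearMap.fst F F ((F × F) × (F × F))).prod
      (LinearMap.snd F (F × F) (F × F) ∘ₗ LinearMap.snd F F ((F × F) × (F × F)))))
    (LinearMap.ker (LinearMap.fst F (F × F) (F × F) ∘ₗ LinearMap.snd F F ((F × F) × (F × F))))
    (by
      constructor
      · rw [Submodule.disjoint_def]
        rintro ⟨a, b, c⟩ h h'
        simp at h h'
        simp [h, h']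
      · rw [codisjoint_iff, eq_top_iff]
        rintro ⟨a, b, c⟩ -
        exact Submodule.mem_sup.2 ⟨(0, b, 0), by simp, (a, 0, c), by simp, by simp⟩)
    (by
      rintro ⟨a, ⟨b1, b2⟩, ⟨c1, c2⟩⟩ h ⟨a', ⟨b1', b2'⟩, ⟨c1', c2'⟩⟩ h'
      simp at h h'
      simp [skewModelMul, h, h'])
    (by
      rintro ⟨a, ⟨b1, b2⟩, ⟨c1, c2⟩⟩ h ⟨a', ⟨b1', b2'⟩, ⟨c1', c2'⟩⟩ h'
      simp at h h'
      simp [skewModelMul, h, h'])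
    (by
      rintro ⟨a, ⟨b1, b2⟩, ⟨c1, c2⟩⟩ h ⟨a', ⟨b1', b2'⟩, ⟨c1', c2'⟩⟩ h'
      simp at h h'
      simp [skewModelMul, h, h'])
    (by
      rintro ⟨a, ⟨b1, b2⟩, ⟨c1, c2⟩⟩ h ⟨a', ⟨b1', b2'⟩, ⟨c1', c2'⟩⟩ h'
      simp at h h'
      simp [skewModelMul, h, h'])

/-- An element of the model. -/
def skewModel.mk (a : F) (k₀ k₁ : F × F) : (skewModel F).carrier :=
  ((a, k₀, k₁) : F × (F × F) × (F × F))

theorem skewModel.exists_mk (x : (skewModel F).carrier) :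
    ∃ a b₁ b₂ c₁ c₂, x = skewModel.mk a (b₁, b₂) (c₁, c₂) :=
  ⟨_, _, _, _, _, rfl⟩

theorem skewModel.mk_mul_mk (a b₁ b₂ c₁ c₂ a' b₁' b₂' c₁' c₂' : F) :
    skewModel.mk a (b₁, b₂) (c₁, c₂) * skewModel.mk a' (b₁', b₂') (c₁', c₂') =
      skewModel.mk 0 (a * a' + a * c₂' + a' * c₁, -(a * (c₁' - c₂')) + a' * c₂)
        (a * (b₂' - b₁') + a' * b₁, -(a * b₁') + a' * b₂) := rfl

theorem skewModel.mk_add_mk (a b₁ b₂ c₁ c₂ a' b₁' b₂' c₁' c₂' : F) :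
    skewModel.mk a (b₁, b₂) (c₁, c₂) + skewModel.mk a' (b₁', b₂') (c₁', c₂') =
      skewModel.mk (a + a') (b₁ + b₁', b₂ + b₂') (c₁ + c₁', c₂ + c₂') := rfl

theorem skewModel.mk_sub_mk (a b₁ b₂ c₁ c₂ a' b₁' b₂' c₁' c₂' : F) :
    skewModel.mk a (b₁, b₂) (c₁, c₂) - skewModel.mk a' (b₁', b₂') (c₁', c₂') =
      skewModel.mk (a - a') (b₁ - b₁', b₂ - b₂') (c₁ - c₁', c₂ - c₂') := rfl

theorem skewModel.smul_mk (c a b₁ b₂ c₁ c₂ : F) :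
    c • skewModel.mk a (b₁, b₂) (c₁, c₂) =
      skewModel.mk (c * a) (c * b₁, c * b₂) (c * c₁, c * c₂) := rfl

theorem skewModel.zero_eq : (0 : (skewModel F).carrier) = skewModel.mk 0 (0, 0) (0, 0) := rfl

theorem skewModel.mk_mem_one (a : F) (k : F × F) :
    skewModel.mk a 0 k ∈ (skewModel F).part 1 := by
  change ((a, 0, k) : F × (F × F) × (F × F)) ∈ LinearMap.ker _
  simp

theorem skewModel.exists_of_mem {i : ZMod 2} {x : (skewModel F).carrier}
    (h : x ∈ (skewModel F).part i) :
    ∃ a b₁ b₂ c₁ c₂, x = skewModel.mk (if i = 1 then a else 0)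
      (if i = 1 then 0 else b₁, if i = 1 then 0 else b₂)
      (if i = 1 then c₁ else 0, if i = 1 then c₂ else 0) := by
  obtain ⟨a, ⟨b₁, b₂⟩, ⟨c₁, c₂⟩⟩ := x
  refine ⟨a, b₁, b₂, c₁, c₂, ?_⟩
  have h2 : ∀ i : ZMod 2, i = 0 ∨ i = 1 := by decide
  rcases h2 i with rfl | rfl
  · change ((a, (b₁, b₂), (c₁, c₂)) : F × (F × F) × (F × F)) ∈ LinearMap.ker _ at h
    simp at h
    obtain ⟨rfl, rfl, rfl⟩ := h
    rfl
  · change ((a, (b₁, b₂), (c₁, c₂)) : F × (F × F) × (F × F)) ∈ LinearMap.ker _ at h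
    simp at h
    obtain ⟨rfl, rfl⟩ := h
    rfl

theorem skewModel.mk_ext {a b₁ b₂ c₁ c₂ a' b₁' b₂' c₁' c₂' : F} (ha : a = a') (hb₁ : b₁ = b₁')
    (hb₂ : b₂ = b₂') (hc₁ : c₁ = c₁') (hc₂ : c₂ = c₂') :
    skewModel.mk a (b₁, b₂) (c₁, c₂) = skewModel.mk a' (b₁', b₂') (c₁', c₂') := by
  subst ha hb₁ hb₂ hc₁ hc₂; rfl

theorem skewModel_alternating (i j k : ZMod 2) {a b c : (skewModel F).carrier}
    (ha : a ∈ (skewModel F).part i) (hb : b ∈ (skewModel F).part j)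
    (hc : c ∈ (skewModel F).part k) :
    (a * b * c - a * (b * c)) + superSign F i j • (b * a * c - b * (a * c)) = 0 ∧
    (a * b * c - a * (b * c)) + superSign F j k • (a * c * b - a * (c * b)) = 0 := by
  obtain ⟨_, _, _, _, _, rfl⟩ := skewModel.exists_of_mem ha
  obtain ⟨_, _, _, _, _, rfl⟩ := skewModel.exists_of_mem hb
  obtain ⟨_, _, _, _, _, rfl⟩ := skewModel.exists_of_mem hc
  clear ha hb hc
  revert i j k
  simp only [skewModel.mk_mul_mk, skewModel.mk_add_mk, skewModel.mk_sub_mk, skewModel.smul_mk,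
    skewModel.zero_eq, superSign]
  refine zmod_two_forall (zmod_two_forall (zmod_two_forall ?_ ?_) (zmod_two_forall ?_ ?_))
    (zmod_two_forall (zmod_two_forall ?_ ?_) (zmod_two_forall ?_ ?_)) <;>
  · simp only [zero_ne_one, and_true, and_false, and_self, if_true, if_false]
    constructor <;> refine skewModel.mk_ext ?_ ?_ ?_ ?_ ?_ <;> ring

theorem skewModel_mem [CharZero F] : skewModel F ∈ altMetabelianSupervariety F := by
  apply mem_altMetabelianSupervariety_of_homogeneous
  · exact fun i j k a ha b hb c hc => (skewModel_alternating i j k ha hb hc).1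
  · exact fun i j k a ha b hb c hc => (skewModel_alternating i j k ha hb hc).2
  · intro a b c d
    obtain ⟨_, _, _, _, _, rfl⟩ := skewModel.exists_mk a
    obtain ⟨_, _, _, _, _, rfl⟩ := skewModel.exists_mk b
    obtain ⟨_, _, _, _, _, rfl⟩ := skewModel.exists_mk c
    obtain ⟨_, _, _, _, _, rfl⟩ := skewModel.exists_mk d
    simp only [skewModel.mk_mul_mk, skewModel.zero_eq]
    refine skewModel.mk_ext ?_ ?_ ?_ ?_ ?_ <;> ring

end Models

/-! ### Coordinates of multilinear words and their values in the model. -/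

section Coordinates

variable {F : Type u} [Field F]

theorem exists_scalar_of_perm (F : Type u) [Field F] {X : Type*} {l l' : List X}
    (h : l.Perm l') : ∃ ε : F, ∀ {N : Type u} [AddCommGroup N] [Module F N] (S : List X → N),
      IsSkewOnLists S → S l = ε • S l' := by
  obtain ⟨ε, hε⟩ := exists_sign_of_perm.{u} h
  exact ⟨((ε : ℤ) : F), fun S hS => by rw [hε S hS, Int.cast_smul_eq_zsmul]⟩

variable (F) in
/-- The embedding of `K` as the even (`true`) or odd (`false`) part of the square of the model. -/
def skewModel.incl (s : Bool) : F × F →ₗ[F] (skewModel F).carrier where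
  toFun κ := skewModel.mk 0 (if s then κ else 0) (if s then 0 else κ)
  map_add' κ κ' := by
    obtain ⟨a, b⟩ := κ
    obtain ⟨a', b'⟩ := κ'
    cases s
    · change skewModel.mk 0 (0, 0) (a + a', b + b') =
        skewModel.mk 0 (0, 0) (a, b) + skewModel.mk 0 (0, 0) (a', b')
      rw [skewModel.mk_add_mk, add_zero]
    · change skewModel.mk 0 (a + a', b + b') (0, 0) =
        skewModel.mk 0 (a, b) (0, 0) + skewModel.mk 0 (a', b') (0, 0)
      rw [skewModel.mk_add_mk, add_zero]
  map_smul' c κ := by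
    obtain ⟨a, b⟩ := κ
    cases s
    · change skewModel.mk 0 (0, 0) (c * a, c * b) = c • skewModel.mk 0 (0, 0) (a, b)
      rw [skewModel.smul_mk, mul_zero]
    · change skewModel.mk 0 (c * a, c * b) (0, 0) = c • skewModel.mk 0 (a, b) (0, 0)
      rw [skewModel.smul_mk, mul_zero]

theorem skewModel.incl_false (a b : F) :
    skewModel.incl F false (a, b) = skewModel.mk 0 (0, 0) (a, b) := rfl

theorem skewModel.incl_true (a b : F) :
    skewModel.incl F true (a, b) = skewModel.mk 0 (a, b) (0, 0) := rfl

theorem skewModel.incl_injective (s : Bool) : Function.Injective (skewModel.incl F s) := by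
  intro κ κ' h
  cases s
  · have h' : ((0, 0, κ) : F × (F × F) × (F × F)) = (0, 0, κ') := h
    simpa using h'
  · have h' : ((0, κ, 0) : F × (F × F) × (F × F)) = (0, κ', 0) := h
    simpa using h'

variable (F) in
/-- The odd generator of the model. -/
def skewModel.gen : (skewModel F).carrier := skewModel.mk 1 (0, 0) (0, 0)

theorem skewModel.gen_mul_gen :
    skewModel.gen F * skewModel.gen F = skewModel.incl F true (1, 0) := by
  rw [skewModel.gen, skewModel.incl_true, skewModel.mk_mul_mk]
  exact skewModel.mk_ext rfl (by ring) (by ring) (by ring) (by ring)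

theorem skewModel.incl_mul_gen (s : Bool) (κ : F × F) :
    skewModel.incl F s κ * skewModel.gen F = skewModel.incl F (!s) κ := by
  obtain ⟨a, b⟩ := κ
  cases s
  · rw [Bool.not_false, skewModel.gen, skewModel.incl_true, skewModel.incl_false,
      skewModel.mk_mul_mk]
    exact skewModel.mk_ext rfl (by ring) (by ring) (by ring) (by ring)
  · rw [Bool.not_true, skewModel.gen, skewModel.incl_true, skewModel.incl_false,
      skewModel.mk_mul_mk]
    exact skewModel.mk_ext rfl (by ring) (by ring) (by ring) (by ring)

theorem skewModel.gen_mul_incl_false (κ : F × F) :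
    skewModel.gen F * skewModel.incl F false κ = -skewModel.incl F true (mulPhi κ) := by
  obtain ⟨a, b⟩ := κ
  rw [← map_neg, skewModel.gen, mulPhi, Prod.neg_mk, skewModel.incl_true, skewModel.incl_false,
    skewModel.mk_mul_mk]
  exact skewModel.mk_ext rfl (by ring) (by ring) (by ring) (by ring)

theorem skewModel.gen_mul_incl_true (κ : F × F) :
    skewModel.gen F * skewModel.incl F true κ = skewModel.incl F false (mulPhiSq κ) := by
  obtain ⟨a, b⟩ := κ
  rw [skewModel.gen, mulPhiSq, skewModel.incl_true, skewModel.incl_false, skewModel.mk_mul_mk]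
  exact skewModel.mk_ext rfl (by ring) (by ring) (by ring) (by ring)

theorem grProd_append_singleton (l : List ℕ) (k : ℕ) :
    (grProd (l ++ [k]) : Grassmann F) = grProd l * grGen F k := by
  rw [grProd_append, grProd_singleton]

theorem grGen_mul_grProd (l : List ℕ) (k : ℕ) :
    grGen F k * grProd l =
      if Even l.length then grProd (l ++ [k]) else -(grProd (l ++ [k]) : Grassmann F) := by
  have h := grProd_mem (F := F) l
  rw [grProd_append_singleton]
  split_ifs with hl
  · rw [(ZMod.natCast_eq_zero_iff_even).2 hl] at h
    rw [grassmann_even_comm h]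
  · rw [(ZMod.natCast_eq_one_iff_odd).2 (Nat.not_even_iff_odd.1 hl)] at h
    exact grassmann_odd_anticomm (grGen_mem k) h

/-- The values of words on one distinguished even element and odd elements `eⱼ ⊗ y`. -/
theorem foldl_evalStep_skewModel {X : Type} (b : X → Grassmann F ⊗[F] (skewModel F).carrier)
    (ν : X → ℕ) (ops : List (X × Bool))
    (hb : ∀ o ∈ ops, b o.1 = grGen F (ν o.1) ⊗ₜ skewModel.gen F) (κ : F × F) (l : List ℕ) :
    ops.foldl (evalStep b) (grProd l ⊗ₜ skewModel.incl F (decide (Even l.length)) κ) =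
      grProd (l ++ ops.map fun o => ν o.1) ⊗ₜ
        skewModel.incl F (decide (Even (l.length + ops.length)))
          ((ops.map Prod.snd).foldl coeffStep (κ, decide (Even l.length))).1 := by
  induction ops generalizing κ l with
  | nil => simp
  | cons o ops ih =>
    have e : evalStep b (grProd l ⊗ₜ skewModel.incl F (decide (Even l.length)) κ) o =
        grProd (l ++ [ν o.1]) ⊗ₜ skewModel.incl F (decide (Even (l ++ [ν o.1]).length))
          (coeffStep (κ, decide (Even l.length)) o.2).1 := by
      have hpar : decide (Even (l ++ [ν o.1]).length) = !decide (Even l.length) := by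
        simp [Nat.even_add_one, -Nat.not_even_iff_odd]
      have hbo := hb o (by simp)
      rw [hpar]
      rcases o with ⟨x, _ | _⟩
      · simp only [evalStep, hbo, Algebra.TensorProduct.tmul_mul_tmul, skewModel.incl_mul_gen,
          grProd_append_singleton, coeffStep]
        rfl
      · simp only [evalStep, hbo, Algebra.TensorProduct.tmul_mul_tmul, grGen_mul_grProd,
          coeffStep, if_true]
        -- At even length the Grassmann factors commute and the model supplies φ². At odd length the
        -- sign of the exchange cancels the sign in -φ. Both agree with `coeffStep`, where the first
        -- letter in `l` belongs to the initial product and so shifts the parity by one.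
        by_cases hl : Even l.length
        · simp [hl, skewModel.gen_mul_incl_true]
        · simp [hl, skewModel.gen_mul_incl_false, TensorProduct.neg_tmul, TensorProduct.tmul_neg]
    have hpar : decide (Even (l ++ [ν o.1]).length) = !decide (Even l.length) := by
      simp [Nat.even_add_one, -Nat.not_even_iff_odd]
    rw [List.foldl_cons, e, ih (fun o' ho' => hb o' (by simp [ho'])), hpar]
    simp only [List.map_cons, List.foldl_cons, List.append_assoc, List.singleton_append,
      List.length_append, List.length_cons, List.length_nil]
    congr 3
    rw [zero_add, add_assoc, add_comm 1]

theorem exists_mul_eq_foldl_evalStep {X : Type} {B : Type u} [Mul B] (b : X → B) (p q : B)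
    (ops : List (X × Bool)) : ∃ p' q', ops.foldl (evalStep b) (p * q) = p' * q' := by
  induction ops generalizing p q with
  | nil => exact ⟨p, q, rfl⟩
  | cons o ops ih =>
    rw [List.foldl_cons, evalStep]
    split_ifs
    · exact ih _ _
    · exact ih _ _

/-- When the letter of `o` is applied, the value accumulated so far is a product, and so is the
value of that letter. -/
theorem foldl_evalStep_eq_zero {X : Type} {B : Type u} [NonUnitalNonAssocRing B]
    (hB : ∀ x y z t : B, x * y * (z * t) = 0) (b : X → B) (p q : B) (ops : List (X × Bool))
    {o : X × Bool} (ho : o ∈ ops) {u v : B} (hu : b o.1 = u * v) :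
    ops.foldl (evalStep b) (p * q) = 0 := by
  obtain ⟨ops₁, ops₂, rfl⟩ := List.append_of_mem ho
  obtain ⟨p', q', h⟩ := exists_mul_eq_foldl_evalStep b p q ops₁
  have h0 : ∀ ops : List (X × Bool), ops.foldl (evalStep b) (0 : B) = 0 := by
    intro ops
    induction ops with
    | nil => rfl
    | cons o ops ih => simpa [evalStep] using ih
  rw [List.foldl_append, h, List.foldl_cons]
  have : evalStep b (p' * q') o = 0 := by
    simp [evalStep, hu, hB]
  rw [this, h0]

variable (F) in
/-- The point of the Grassmann envelope of the model at which the `i`-th variable is even. -/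
noncomputable def skewPoint {n : ℕ} (i : Fin n) (j : Fin n) :
    Grassmann F ⊗[F] (skewModel F).carrier :=
  if j = i then 1 ⊗ₜ (skewModel.gen F * skewModel.gen F) else grGen F j ⊗ₜ skewModel.gen F

theorem skewModel_metabelian (a b c d : (skewModel F).carrier) : (a * b) * (c * d) = 0 := by
  obtain ⟨_, _, _, _, _, rfl⟩ := skewModel.exists_mk a
  obtain ⟨_, _, _, _, _, rfl⟩ := skewModel.exists_mk b
  obtain ⟨_, _, _, _, _, rfl⟩ := skewModel.exists_mk c
  obtain ⟨_, _, _, _, _, rfl⟩ := skewModel.exists_mk d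
  simp only [skewModel.mk_mul_mk, skewModel.zero_eq]
  refine skewModel.mk_ext ?_ ?_ ?_ ?_ ?_ <;> ring

/-- The i-th variable takes a value in the square, so the word survives only if `i` is one of its
two innermost letters. The evaluation then starts from `y² * y`, with coefficient 1, or from `y *
y²`, with coefficient φ². -/
theorem evalWord_skewPoint {n : ℕ} (i j k : Fin n) (ops : List (Fin n × Bool))
    (h : (chainLetters j k ops).Nodup) (hi : i ∈ chainLetters j k ops) :
    evalWord (skewPoint F i) (chainWord j k ops) =
      if i = j then grProd ((k :: ops.map Prod.fst).map Fin.val) ⊗ₜ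
          skewModel.incl F (decide (Even (ops.length + 1)))
            (chainCoeff ((1, 0) : F × F) (ops.map Prod.snd))
      else if i = k then grProd ((j :: ops.map Prod.fst).map Fin.val) ⊗ₜ
          skewModel.incl F (decide (Even (ops.length + 1)))
            (mulPhiSq (chainCoeff ((1, 0) : F × F) (ops.map Prod.snd)))
      else 0 := by
  have hsq : skewPoint F i i = (1 ⊗ₜ skewModel.gen F) * (1 ⊗ₜ skewModel.gen F) := by
    simp [skewPoint]
  have hne : ∀ j, j ≠ i → skewPoint F i j = grGen F j ⊗ₜ skewModel.gen F := by
    intro j hj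
    simp [skewPoint, hj]
  simp only [chainLetters, List.nodup_cons, List.mem_cons, not_or] at h
  rw [evalWord_chainWord]
  have hlen : ∀ x : Fin n, decide (Even ([x].map Fin.val).length) = false := by simp
  have hops : ∀ x : Fin n, (x :: ops.map Prod.fst).map Fin.val =
      [x.val] ++ ops.map fun o => (o.1 : ℕ) := by intro x; simp
  split_ifs with h1 h2
  · subst h1
    have e : skewPoint F i i * skewPoint F i k = grProd [(k : ℕ)] ⊗ₜ
        skewModel.incl F (decide (Even [(k : ℕ)].length)) (1, 0) := by
      rw [hne k (Ne.symm h.1.1), skewPoint, if_pos rfl, Algebra.TensorProduct.tmul_mul_tmul,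
        skewModel.gen_mul_gen, skewModel.incl_mul_gen, one_mul, grProd_singleton]
      simp
    rw [e, foldl_evalStep_skewModel (skewPoint F i) Fin.val ops, hops]
    · simp [chainCoeff, add_comm]
    · intro o ho
      refine hne _ fun h0 => h.1.2 ?_
      exact List.mem_map.2 ⟨o, ho, h0⟩
  · subst h2
    have e : skewPoint F i j * skewPoint F i i = grProd [(j : ℕ)] ⊗ₜ
        skewModel.incl F (decide (Even [(j : ℕ)].length)) (mulPhiSq (1, 0)) := by
      rw [hne j (Ne.symm h1), skewPoint, if_pos rfl, Algebra.TensorProduct.tmul_mul_tmul,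
        skewModel.gen_mul_gen, skewModel.gen_mul_incl_true, mul_one, grProd_singleton]
      simp
    rw [e, foldl_evalStep_skewModel (skewPoint F i) Fin.val ops, hops]
    · rw [← chainCoeff_mulPhiSq]
      simp [chainCoeff, add_comm]
    · intro o ho
      refine hne _ fun h0 => h.2.1 ?_
      exact List.mem_map.2 ⟨o, ho, h0⟩
  · simp only [chainLetters, List.mem_cons, h1, h2, false_or] at hi
    obtain ⟨o, ho, rfl⟩ := List.mem_map.1 hi
    exact foldl_evalStep_eq_zero (tensor_metabelian skewModel_metabelian) _ _ _ ops ho hsq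

/-- The letters different from `i` in increasing order. -/
def otherLetters {n : ℕ} (i : Fin n) : List (Fin n) := (List.finRange n).erase i

/-- The essential point is that the same `T` governs both the values in the model and the values in
every algebra of the variety: what vanishes in the model vanishes everywhere, up to the cube. -/
theorem exists_coordinates [CharZero F] {n : ℕ} (hn : 3 ≤ n) (w : FreeMagma (Fin n))
    (hw : ∀ k, occurrences k w = 1) :
    ∃ (T : Fin n → F × F) (s : F),
      (∀ i, evalWord (skewPoint F i) w = grProd ((otherLetters i).map Fin.val) ⊗ₜ
        skewModel.incl F (decide (Even (n - 1))) (T i)) ∧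
      ∀ (B : Type u) [NonUnitalNonAssocRing B] [Module F B] [IsScalarTower F B B]
        [SMulCommClass F B B], IsAltMetabelian B → ∀ b : Fin n → B,
        evalWord b w = ∑ i, skewList (T i) (b i) ((otherLetters i).map b) + s • cubeTerm b := by
  rcases word_cases.{u} w with ⟨i, rfl⟩ | ⟨i, j, ops, rfl⟩ | h
  · exfalso
    have h1 := hw ⟨0, by omega⟩
    have h2 := hw ⟨1, by omega⟩
    simp only [occurrences] at h1 h2
    split_ifs at h1 h2 with h3 h4
    rw [h3] at h4
    simp at h4
  · have hperm := chainLetters_perm hw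
    have hnd : (chainLetters i j ops).Nodup := hperm.nodup_iff.2 (List.nodup_finRange n)
    have hij : i ≠ j := by
      simp only [chainLetters, List.nodup_cons, List.mem_cons, not_or] at hnd
      exact hnd.1.1
    have hlen : ops.length + 2 = n := by
      have := hperm.length_eq
      simpa [chainLetters] using this
    have hp1 : (j :: ops.map Prod.fst).Perm (otherLetters i) := by
      have := hperm.erase i
      simpa [chainLetters, otherLetters] using this
    have hp2 : (i :: ops.map Prod.fst).Perm (otherLetters j) := by
      have := (((List.Perm.swap i j (ops.map Prod.fst)).trans hperm)).erase j
      simpa [otherLetters] using this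
    -- The sign that sorts the letters is used below both for `grProd` in the model and for
    -- `skewList` in `B`.
    obtain ⟨ε₁, h1⟩ := exists_scalar_of_perm F hp1
    obtain ⟨ε₂, h2⟩ := exists_scalar_of_perm F hp2
    set κ := chainCoeff ((1, 0) : F × F) (ops.map Prod.snd) with hκ
    -- Only the two innermost letters can be distinguished; the coefficients κ and φ²κ are those of
    -- `skewWord_pair`.
    refine ⟨fun k => if k = i then ε₁ • κ else if k = j then ε₂ • mulPhiSq κ else 0,
      (κ.1 + κ.2) / 6, fun k => ?_, fun B _ _ _ _ hB b => ?_⟩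
    · rw [evalWord_skewPoint k i j ops hnd (hperm.mem_iff.2 (List.mem_finRange k))]
      have hpar : ops.length + 1 = n - 1 := by omega
      rw [hpar]
      beta_reduce
      split_ifs with hk1 hk2
      · subst hk1
        rw [h1 (fun l => (grProd (l.map Fin.val) : Grassmann F))
          (isSkewOnLists_grProd.comp_map _), map_smul, TensorProduct.smul_tmul]
      · subst hk2
        rw [h2 (fun l => (grProd (l.map Fin.val) : Grassmann F))
          (isSkewOnLists_grProd.comp_map _), map_smul, TensorProduct.smul_tmul]
      · rw [map_zero, TensorProduct.tmul_zero]
    · have hops : ops ≠ [] := by rintro rfl; simp at hlen; omega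
      rw [evalWord_chainWord_skewList (F := F) hB b i j ops hops hperm, ← hκ]
      congr 1
      beta_reduce
      rw [Finset.sum_eq_add i j hij]
      · rw [if_pos rfl, if_neg hij.symm, if_pos rfl, skewList_smul, skewList_smul,
          h1 (fun l => skewList κ (b i) (l.map b)) ((isSkewOnLists_skewList hB _ _).comp_map _),
          h2 (fun l => skewList (mulPhiSq κ) (b j) (l.map b))
            ((isSkewOnLists_skewList hB _ _).comp_map _)]
      · rintro k - ⟨hki, hkj⟩
        rw [if_neg hki, if_neg hkj]
        exact map_zero (skewListHom (b k) _)
      · simp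
      · simp
  · refine ⟨0, 0, fun i => ?_, fun B _ _ _ _ hB b => ?_⟩
    · rw [h _ (tensor_metabelian skewModel_metabelian), Pi.zero_apply, map_zero,
        TensorProduct.tmul_zero]
    · rw [h _ hB.2.2, zero_smul, add_zero, Finset.sum_eq_zero]
      intro k _
      exact map_zero (skewListHom (b k) _)

end Coordinates

/-! ### Superidentities of one odd generator are multiples of the cube. -/

section OddGenerator

variable {F : Type u} [Field F]

theorem tmul_ne_zero_of_ne_zero {g : Grassmann F} {M : Type u} [AddCommGroup M] [Module F M]
    {a : M} (hg : g ≠ 0) (ha : a ≠ 0) : g ⊗ₜ[F] a ≠ 0 := by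
  intro h
  refine hg ((Module.forall_dual_apply_eq_zero_iff F g).1 fun ξ => ?_)
  have h1 := congrArg (fun t => TensorProduct.lid F M (LinearMap.rTensor M ξ t)) h
  simpa [ha] using h1

theorem freeGen_mem (r s : ℕ) (x : Fin r ⊕ Fin s) :
    freeGen F r s x ∈ (freeAltMetabelian F r s).part (genParity x) :=
  freeWord_mem _ _ _

/-- The point is the image of a point of the envelope of the free superalgebra, under the map
sending the odd generator to `y`. -/
theorem lift_skewPoint_eq_zero [CharZero F] {n : ℕ} {f : FreeNonUnitalNonAssocAlgebra F (Fin n)}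
    (h : SatisfiesSuperidentity f (freeAltMetabelian F 0 1)) (i : Fin n) :
    FreeNonUnitalNonAssocAlgebra.lift F (skewPoint F i) f = 0 := by
  obtain ⟨φ, hφ, hφx⟩ := exists_hom_freeAltMetabelian (r := 0) (s := 1) (skewModel_mem (F := F))
    (fun _ => skewModel.gen F) (by
      rintro (x | x)
      · exact x.elim0
      · exact skewModel.mk_mem_one 1 0)
  set y := freeGen F 0 1 (.inr 0)
  have hy : y ∈ (freeAltMetabelian F 0 1).part 1 := freeGen_mem 0 1 (.inr 0)
  have hyy : y * y ∈ (freeAltMetabelian F 0 1).part 0 :=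
    (freeAltMetabelian F 0 1).mul_mem 1 1 y y hy hy
  rw [satisfiesSuperidentity_iff] at h
  have h1 := congrArg (grTensorMap (AlgHom.id F (Grassmann F)) φ)
    (h (fun j => if j = i then 1 ⊗ₜ (y * y) else grGen F j ⊗ₜ y) (fun j => by
      split_ifs
      · exact tmul_mem_grassmannEnvelope one_mem_grassmannPart hyy
      · exact tmul_mem_grassmannEnvelope (grGen_mem _) hy))
  rw [map_lift, map_zero] at h1
  rw [← h1]
  congr 2
  funext j
  rw [skewPoint]
  split_ifs
  · rw [grTensorMap_tmul, map_mul, hφx, map_one]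
  · rw [grTensorMap_tmul, hφx, AlgHom.id_apply]

/-- At the i-th point `f` takes the value of a nonzero Grassmann monomial tensored with the sum of
the i-th coordinates of its words. These sums vanish, and by linearity only the cube terms remain.
-/
theorem exists_lift_eq_smul_cubeTerm_of_three_le [CharZero F] {n : ℕ} (hn : 3 ≤ n)
    {f : FreeNonUnitalNonAssocAlgebra F (Fin n)} (hf : IsMultilinearPoly f)
    (h : ∀ i, FreeNonUnitalNonAssocAlgebra.lift F (skewPoint F i) f = 0) :
    ∃ γ : F, ∀ (B : Type u) [NonUnitalNonAssocRing B] [Module F B] [IsScalarTower F B B]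
      [SMulCommClass F B B], IsAltMetabelian B → ∀ b : Fin n → B,
      FreeNonUnitalNonAssocAlgebra.lift F b f = γ • cubeTerm b := by
  have hex : ∀ w : FreeMagma (Fin n), ∃ (T : Fin n → F × F) (s : F), f.coeff w ≠ 0 →
      (∀ i, evalWord (skewPoint F i) w = grProd ((otherLetters i).map Fin.val) ⊗ₜ
        skewModel.incl F (decide (Even (n - 1))) (T i)) ∧
      ∀ (B : Type u) [NonUnitalNonAssocRing B] [Module F B] [IsScalarTower F B B]
        [SMulCommClass F B B], IsAltMetabelian B → ∀ b : Fin n → B,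
        evalWord b w = ∑ i, skewList (T i) (b i) ((otherLetters i).map b) + s • cubeTerm b := by
    intro w
    by_cases hw : f.coeff w = 0
    · exact ⟨0, 0, fun h => absurd hw h⟩
    · obtain ⟨T, s, hTs⟩ := exists_coordinates (F := F) hn w (hf w hw)
      exact ⟨T, s, fun _ => hTs⟩
  choose T s hTs using hex
  refine ⟨∑ w ∈ f.coeff.support, f.coeff w * s w, fun B _ _ _ _ hB b => ?_⟩
  have hT : ∀ i, ∑ w ∈ f.coeff.support, f.coeff w • T w i = 0 := by
    intro i
    have hi := h i
    rw [lift_eq_sum, Finset.sum_congr rfl (fun w hw => by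
      rw [(hTs w (Finsupp.mem_support_iff.1 hw)).1 i, ← TensorProduct.tmul_smul, ← map_smul]),
      ← TensorProduct.tmul_sum, ← map_sum] at hi
    by_contra h0
    refine tmul_ne_zero_of_ne_zero (grProd_ne_zero ?_) ?_ hi
    · exact ((List.nodup_finRange n).erase i).map Fin.val_injective
    · exact fun h1 => h0 (skewModel.incl_injective _ (by rw [h1, map_zero]))
  rw [lift_eq_sum, Finset.sum_congr rfl (fun w hw => by
    rw [(hTs w (Finsupp.mem_support_iff.1 hw)).2 B hB b, smul_add, smul_smul, Finset.smul_sum]),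
    Finset.sum_add_distrib, Finset.sum_smul, Finset.sum_comm]
  rw [Finset.sum_eq_zero, zero_add]
  intro i _
  have := congrArg (skewListHom (b i) ((otherLetters i).map b)) (hT i)
  rw [map_sum, map_zero] at this
  rw [← this]
  exact Finset.sum_congr rfl fun w _ => (map_smul (skewListHom (b i) _) _ _).symm

theorem word_eq_of_length_le_two {n : ℕ} (hn : n < 3) (w : FreeMagma (Fin n))
    (hw : ∀ k, occurrences k w = 1) :
    (∃ hn : n = 1, w = .of ⟨0, by omega⟩) ∨
    (∃ hn : n = 2, w = .mul (.of ⟨0, by omega⟩) (.of ⟨1, by omega⟩) ∨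
      w = .mul (.of ⟨1, by omega⟩) (.of ⟨0, by omega⟩)) ∨
    ∀ (B : Type u) [NonUnitalNonAssocRing B], (∀ x y z t : B, x * y * (z * t) = 0) →
      ∀ b : Fin n → B, evalWord b w = 0 := by
  rcases word_cases.{u} w with ⟨i, rfl⟩ | ⟨i, j, ops, rfl⟩ | h
  · left
    have hn1 : n = 1 := by
      by_contra hne
      have h1 := hw ⟨0, by have := i.2; omega⟩
      have h2 := hw ⟨1, by have := i.2; omega⟩
      simp only [occurrences] at h1 h2
      split_ifs at h1 h2 with h3 h4
      rw [h3] at h4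
      simp at h4
    subst hn1
    exact ⟨rfl, by rw [Subsingleton.elim i]⟩
  · right; left
    have hperm := chainLetters_perm hw
    have hlen : ops.length + 2 = n := by
      have := hperm.length_eq
      simpa [chainLetters] using this
    obtain rfl : ops = [] := List.length_eq_zero_iff.1 (by omega)
    obtain rfl : n = 2 := by simpa using hlen.symm
    have hnd : (chainLetters i j []).Nodup := hperm.nodup_iff.2 (List.nodup_finRange 2)
    have hij : i ≠ j := by simpa [chainLetters] using hnd
    refine ⟨rfl, ?_⟩
    fin_cases i <;> fin_cases j
    · exact absurd rfl hij
    · exact .inl rfl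
    · exact .inr rfl
    · exact absurd rfl hij
  · exact .inr (.inr h)

theorem lift_eq_zero_of_length_lt_three [CharZero F] {n : ℕ} (hn : n < 3)
    {f : FreeNonUnitalNonAssocAlgebra F (Fin n)} (hf : IsMultilinearPoly f)
    (h : ∀ i, FreeNonUnitalNonAssocAlgebra.lift F (skewPoint F i) f = 0)
    (B : Type u) [NonUnitalNonAssocRing B] [Module F B] [IsScalarTower F B B]
    [SMulCommClass F B B] (hB : ∀ x y z t : B, x * y * (z * t) = 0) (b : Fin n → B) :
    FreeNonUnitalNonAssocAlgebra.lift F b f = 0 := by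
  obtain rfl | rfl | rfl : n = 0 ∨ n = 1 ∨ n = 2 := by omega
  · rw [lift_eq_sum, Finset.sum_eq_zero]
    intro w hw
    rcases word_eq_of_length_le_two.{u} hn w (hf w (Finsupp.mem_support_iff.1 hw)) with
      ⟨h, -⟩ | ⟨h, -⟩ | h
    · omega
    · omega
    · rw [h B hB, smul_zero]
  · have key : ∀ (B : Type u) [NonUnitalNonAssocRing B] [Module F B] [IsScalarTower F B B]
        [SMulCommClass F B B], (∀ x y z t : B, x * y * (z * t) = 0) → ∀ b : Fin 1 → B,
        FreeNonUnitalNonAssocAlgebra.lift F b f = f.coeff (.of 0) • b 0 := by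
      intro B _ _ _ _ hB b
      rw [lift_eq_sum, Finset.sum_eq_single (.of 0)]
      · rfl
      · intro w hw hne
        rcases word_eq_of_length_le_two.{u} hn w (hf w (Finsupp.mem_support_iff.1 hw)) with
          ⟨_, hw'⟩ | ⟨h, -⟩ | h
        · exact absurd hw' hne
        · omega
        · rw [h B hB, smul_zero]
      · intro h0
        rw [Finsupp.notMem_support_iff.1 h0, zero_smul]
    have h0 := h 0
    rw [key _ (tensor_metabelian skewModel_metabelian), skewPoint, if_pos rfl,
      skewModel.gen_mul_gen] at h0
    rw [key B hB, (smul_eq_zero.1 h0).resolve_right, zero_smul]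
    refine tmul_ne_zero_of_ne_zero one_ne_zero fun h1 => ?_
    have := skewModel.incl_injective _ (h1.trans (map_zero (skewModel.incl F true)).symm)
    simp at this
  · have key : ∀ (B : Type u) [NonUnitalNonAssocRing B] [Module F B] [IsScalarTower F B B]
        [SMulCommClass F B B], (∀ x y z t : B, x * y * (z * t) = 0) → ∀ b : Fin 2 → B,
        FreeNonUnitalNonAssocAlgebra.lift F b f =
          f.coeff (.mul (.of 0) (.of 1)) • (b 0 * b 1) +
          f.coeff (.mul (.of 1) (.of 0)) • (b 1 * b 0) := by
      intro B _ _ _ _ hB b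
      rw [lift_eq_sum, Finset.sum_eq_add (.mul (.of 0) (.of 1)) (.mul (.of 1) (.of 0))]
      · rfl
      · intro h
        injection h with h1 h2
        injection h1 with h1
        exact absurd h1 (by decide)
      · rintro w hw ⟨hne, hne'⟩
        rcases word_eq_of_length_le_two.{u} hn w (hf w (Finsupp.mem_support_iff.1 hw)) with
          ⟨h, -⟩ | ⟨_, hw' | hw'⟩ | h
        · omega
        · exact absurd hw' hne
        · exact absurd hw' hne'
        · rw [h B hB, smul_zero]
      · intro h0
        rw [Finsupp.notMem_support_iff.1 h0, zero_smul]
      · intro h0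
        rw [Finsupp.notMem_support_iff.1 h0, zero_smul]
    have h0 := h 0
    have e1 : skewPoint F (0 : Fin 2) 0 = 1 ⊗ₜ skewModel.incl F true (1, 0) := by
      rw [skewPoint, if_pos rfl, skewModel.gen_mul_gen]
    have e2 : skewPoint F (0 : Fin 2) 1 = grGen F 1 ⊗ₜ skewModel.gen F := by
      rw [skewPoint, if_neg (by decide)]
      rfl
    rw [key _ (tensor_metabelian skewModel_metabelian), e1, e2,
      Algebra.TensorProduct.tmul_mul_tmul, Algebra.TensorProduct.tmul_mul_tmul,
      skewModel.incl_mul_gen, skewModel.gen_mul_incl_true, one_mul, mul_one, Bool.not_true,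
      ← TensorProduct.tmul_smul, ← TensorProduct.tmul_smul, ← TensorProduct.tmul_add,
      ← map_smul, ← map_smul, ← map_add] at h0
    -- The products `y² * y` and `y * y²` have coefficients 1 and φ² in K, which are linearly
    -- independent over `F`; both coefficients of `f` must vanish.
    have h1 : f.coeff (.mul (.of 0) (.of 1)) • ((1, 0) : F × F) +
        f.coeff (.mul (.of 1) (.of 0)) • mulPhiSq ((1, 0) : F × F) = 0 := by
      by_contra hne
      refine tmul_ne_zero_of_ne_zero ?_ (fun h2 => hne ?_) h0
      · rw [← grProd_singleton]
        exact grProd_ne_zero (List.nodup_singleton 1)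
      · exact skewModel.incl_injective _ (h2.trans (map_zero _).symm)
    obtain ⟨h2, h3⟩ := Prod.ext_iff.1 h1
    simp only [mulPhiSq, Prod.fst_add, Prod.snd_add, Prod.smul_fst, Prod.smul_snd, smul_eq_mul,
      mul_zero, mul_neg, mul_one, zero_add, zero_sub, Prod.fst_zero, Prod.snd_zero,
      neg_eq_zero] at h2 h3
    rw [h3, neg_zero, add_zero] at h2
    rw [key B hB, h2, h3, zero_smul, zero_smul, add_zero]

/-- A multilinear identity of the free superalgebra on one odd generator holds in all
`Alt⁽²⁾`-algebras up to a multiple of the symmetrized cube. -/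
theorem exists_lift_eq_smul_cubeTerm [CharZero F] {n : ℕ}
    {f : FreeNonUnitalNonAssocAlgebra F (Fin n)} (hf : IsMultilinearPoly f)
    (h : SatisfiesSuperidentity f (freeAltMetabelian F 0 1)) :
    ∃ γ : F, ∀ (B : Type u) [NonUnitalNonAssocRing B] [Module F B] [IsScalarTower F B B]
      [SMulCommClass F B B], IsAltMetabelian B → ∀ b : Fin n → B,
      FreeNonUnitalNonAssocAlgebra.lift F b f = γ • cubeTerm b := by
  rcases lt_or_ge n 3 with hn | hn
  · refine ⟨0, fun B _ _ _ _ hB b => ?_⟩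
    rw [lift_eq_zero_of_length_lt_three hn hf (lift_skewPoint_eq_zero h) B hB.2.2, zero_smul]
  · exact exists_lift_eq_smul_cubeTerm_of_three_le hn hf (lift_skewPoint_eq_zero h)

end OddGenerator

/-! ### The defining identities, the cube polynomial, and reduction to the cube. -/

section Polynomials

variable {F : Type u} [Field F]

/-- A nonassociative word as a polynomial. -/
noncomputable def wordPoly (F : Type u) [Field F] {X : Type} (w : FreeMagma X) :
    FreeNonUnitalNonAssocAlgebra F X := MonoidAlgebra.single w (1 : F)

theorem lift_wordPoly {X : Type} {B : Type u} [NonUnitalNonAssocRing B] [Module F B]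
    [IsScalarTower F B B] [SMulCommClass F B B] (b : X → B) (w : FreeMagma X) :
    FreeNonUnitalNonAssocAlgebra.lift F b (wordPoly F w) = evalWord b w := by
  rw [wordPoly, lift_single, one_smul]

theorem isMultilinearPoly_wordPoly {n : ℕ} {w : FreeMagma (Fin n)}
    (hw : ∀ i, occurrences i w = 1) : IsMultilinearPoly (wordPoly F w) := by
  intro v hv
  by_cases h : w = v
  · rw [← h]; exact hw
  · exact absurd (by simp [wordPoly, h]) hv

theorem IsMultilinearPoly.add {n : ℕ} {f g : FreeNonUnitalNonAssocAlgebra F (Fin n)}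
    (hf : IsMultilinearPoly f) (hg : IsMultilinearPoly g) : IsMultilinearPoly (f + g) := by
  intro v hv
  by_cases h : f.coeff v = 0
  · refine hg v fun h' => hv ?_
    simp [h, h']
  · exact hf v h

theorem IsMultilinearPoly.sub {n : ℕ} {f g : FreeNonUnitalNonAssocAlgebra F (Fin n)}
    (hf : IsMultilinearPoly f) (hg : IsMultilinearPoly g) : IsMultilinearPoly (f - g) := by
  intro v hv
  by_cases h : f.coeff v = 0
  · refine hg v fun h' => hv ?_
    simp [h, h']
  · exact hf v h

/-- The left-normed word `(x y) z`. -/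
def leftWord {X : Type} (x y z : X) : FreeMagma X := .mul (.mul (.of x) (.of y)) (.of z)

/-- The right-normed word `x (y z)`. -/
def rightWord {X : Type} (x y z : X) : FreeMagma X := .mul (.of x) (.mul (.of y) (.of z))

variable (F) in
/-- The linearized left alternative law. -/
noncomputable def leftAltPoly : FreeNonUnitalNonAssocAlgebra F (Fin 3) :=
  wordPoly F (leftWord 0 1 2) - wordPoly F (rightWord 0 1 2) +
    (wordPoly F (leftWord 1 0 2) - wordPoly F (rightWord 1 0 2))

variable (F) in
/-- The linearized right alternative law. -/
noncomputable def rightAltPoly : FreeNonUnitalNonAssocAlgebra F (Fin 3) :=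
  wordPoly F (leftWord 0 1 2) - wordPoly F (rightWord 0 1 2) +
    (wordPoly F (leftWord 0 2 1) - wordPoly F (rightWord 0 2 1))

variable (F) in
/-- The metabelian law. -/
noncomputable def metabelianPoly : FreeNonUnitalNonAssocAlgebra F (Fin 4) :=
  wordPoly F (.mul (.mul (.of 0) (.of 1)) (.mul (.of 2) (.of 3)))

variable (F) in
/-- The symmetrized cube. -/
noncomputable def cubePoly : FreeNonUnitalNonAssocAlgebra F (Fin 3) :=
  wordPoly F (leftWord 0 1 2) + wordPoly F (leftWord 1 0 2) + wordPoly F (leftWord 0 2 1) +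
    wordPoly F (leftWord 2 0 1) + wordPoly F (leftWord 1 2 0) + wordPoly F (leftWord 2 1 0)

theorem isMultilinearPoly_leftAltPoly : IsMultilinearPoly (leftAltPoly F) :=
  .add (.sub (isMultilinearPoly_wordPoly (by decide)) (isMultilinearPoly_wordPoly (by decide)))
    (.sub (isMultilinearPoly_wordPoly (by decide)) (isMultilinearPoly_wordPoly (by decide)))

theorem isMultilinearPoly_rightAltPoly : IsMultilinearPoly (rightAltPoly F) :=
  .add (.sub (isMultilinearPoly_wordPoly (by decide)) (isMultilinearPoly_wordPoly (by decide)))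
    (.sub (isMultilinearPoly_wordPoly (by decide)) (isMultilinearPoly_wordPoly (by decide)))

theorem isMultilinearPoly_metabelianPoly : IsMultilinearPoly (metabelianPoly F) :=
  isMultilinearPoly_wordPoly (by decide)

theorem isMultilinearPoly_cubePoly : IsMultilinearPoly (cubePoly F) :=
  .add (.add (.add (.add (.add (isMultilinearPoly_wordPoly (by decide))
    (isMultilinearPoly_wordPoly (by decide))) (isMultilinearPoly_wordPoly (by decide)))
    (isMultilinearPoly_wordPoly (by decide))) (isMultilinearPoly_wordPoly (by decide)))
    (isMultilinearPoly_wordPoly (by decide))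

section

variable {B : Type u} [NonUnitalNonAssocRing B] [Module F B] [IsScalarTower F B B]
  [SMulCommClass F B B]

theorem lift_leftAltPoly (b : Fin 3 → B) :
    FreeNonUnitalNonAssocAlgebra.lift F b (leftAltPoly F) =
      b 0 * b 1 * b 2 - b 0 * (b 1 * b 2) + (b 1 * b 0 * b 2 - b 1 * (b 0 * b 2)) := by
  simp only [leftAltPoly, map_add, map_sub, lift_wordPoly]
  rfl

theorem lift_rightAltPoly (b : Fin 3 → B) :
    FreeNonUnitalNonAssocAlgebra.lift F b (rightAltPoly F) =
      b 0 * b 1 * b 2 - b 0 * (b 1 * b 2) + (b 0 * b 2 * b 1 - b 0 * (b 2 * b 1)) := by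
  simp only [rightAltPoly, map_add, map_sub, lift_wordPoly]
  rfl

theorem lift_metabelianPoly (b : Fin 4 → B) :
    FreeNonUnitalNonAssocAlgebra.lift F b (metabelianPoly F) = (b 0 * b 1) * (b 2 * b 3) := by
  rw [metabelianPoly, lift_wordPoly]
  rfl

theorem lift_cubePoly (b : Fin 3 → B) :
    FreeNonUnitalNonAssocAlgebra.lift F b (cubePoly F) = symCube (b 0) (b 1) (b 2) := by
  simp only [cubePoly, map_add, lift_wordPoly]
  rfl

theorem isAltMetabelian_iff_identities [CharZero F] : IsAltMetabelian B ↔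
    SatisfiesIdentity F (leftAltPoly F) B ∧ SatisfiesIdentity F (rightAltPoly F) B ∧
      SatisfiesIdentity F (metabelianPoly F) B := by
  have h2 : ∀ x : B, x + x = 0 → x = 0 := by
    intro x hx
    rw [← two_smul F x] at hx
    exact (smul_eq_zero.1 hx).resolve_left two_ne_zero
  constructor
  · intro hB
    refine ⟨fun b => ?_, fun b => ?_, fun b => ?_⟩
    · rw [lift_leftAltPoly]; exact hB.assoc_left _ _ _
    · rw [lift_rightAltPoly]; exact hB.assoc_right _ _ _
    · rw [lift_metabelianPoly]; exact hB.2.2 _ _ _ _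
  · rintro ⟨hL, hR, hZ⟩
    refine ⟨fun x y => h2 _ ?_, fun x y => h2 _ ?_, fun x y z t => ?_⟩
    · simpa [lift_leftAltPoly, associator] using hL ![x, x, y]
    · simpa [lift_rightAltPoly, associator] using hR ![x, y, y]
    · simpa [lift_metabelianPoly] using hZ ![x, y, z, t]

end

theorem altSV_subset [CharZero F] (r s : ℕ) : altSV F r s ⊆ altMetabelianSupervariety F := by
  intro B hB
  have h := isAltMetabelian_iff_identities (F := F).1 (freeAltMetabelian_mem (F := F) r s)
  exact isAltMetabelian_iff_identities (F := F).2
    ⟨hB 3 _ isMultilinearPoly_leftAltPoly h.1, hB 3 _ isMultilinearPoly_rightAltPoly h.2.1,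
      hB 4 _ isMultilinearPoly_metabelianPoly h.2.2⟩

/-- A superidentity of the larger free superalgebra also holds on one odd generator, hence equals γ
times the cube. If the cube fails, γ = 0 and the identity holds in the whole variety. -/
theorem subset_altSV [CharZero F] {r s : ℕ} (hs : 1 ≤ s)
    (hcube : ¬ SatisfiesSuperidentity (cubePoly F) (freeAltMetabelian F r s)) :
    altMetabelianSupervariety F ⊆ altSV F r s := by
  intro A hA n f hf h
  obtain ⟨γ, hγ⟩ := exists_lift_eq_smul_cubeTerm hf (h.of_le (Nat.zero_le r) hs)
  intro b
  rw [hγ _ hA]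
  by_cases hn : n = 3
  · subst hn
    suffices γ = 0 by rw [this, zero_smul]
    by_contra hγ0
    refine hcube fun c => ?_
    have := h c
    rw [hγ _ (freeAltMetabelian_mem r s)] at this
    exact (lift_cubePoly c).trans ((smul_eq_zero.1 this).resolve_left hγ0)
  · rw [cubeTerm, dif_neg hn, smul_zero]

/-- An identity of one odd generator is a multiple of the cube, which holds on two odd generators by
hypothesis. -/
theorem altSV_zero_one_eq [CharZero F]
    (hcube : SatisfiesSuperidentity (cubePoly F) (freeAltMetabelian F 0 2)) :
    altSV F 0 1 = altSV F 0 2 := by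
  refine (altSV_mono le_rfl one_le_two).antisymm ?_
  intro A hA n f hf h
  refine hA n f hf ?_
  obtain ⟨γ, hγ⟩ := exists_lift_eq_smul_cubeTerm hf h
  intro b
  rw [hγ _ (freeAltMetabelian_mem 0 2)]
  by_cases hn : n = 3
  · subst hn
    have h0 : cubeTerm b = 0 := (lift_cubePoly b).symm.trans (hcube b)
    rw [h0, smul_zero]
  · rw [cubeTerm, dif_neg hn, smul_zero]

end Polynomials

/-! ### The cube vanishes on two odd generators. -/

section CubeHolds

variable {F : Type u} [Field F]

theorem grFresh_mul (g h : Grassmann F) : grFresh F (g * h) = grFresh F g * grShift F h := by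
  simp [grFresh, mul_assoc]

/-- The product of the two fresh generators is even, hence central, and can be attached to either
factor. -/
theorem grFresh_mul' (g h : Grassmann F) : grFresh F (g * h) = grShift F g * grFresh F h := by
  have : grGen F 0 * grGen F 1 ∈ grassmannPart F 0 :=
    grassmannPart_mul_mem (i := 1) (j := 1) (grGen_mem 0) (grGen_mem 1)
  simp only [grFresh, LinearMap.comp_apply, LinearMap.mulLeft_apply, AlgHom.toLinearMap_apply,
    map_mul]
  rw [← mul_assoc, grassmann_even_comm this, mul_assoc]

theorem rTensor_grFresh_injective {M : Type u} [AddCommGroup M] [Module F M] :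
    Function.Injective (LinearMap.rTensor M (grFresh F)) := by
  obtain ⟨L, hL⟩ := grFresh_hasLeftInverse (F := F)
  refine Function.LeftInverse.injective (g := LinearMap.rTensor M L) fun x => ?_
  rw [← LinearMap.comp_apply, ← LinearMap.rTensor_comp, hL, LinearMap.rTensor_id,
    LinearMap.id_apply]

section

variable {M : Type u} [NonUnitalNonAssocRing M] [Module F M] [IsScalarTower F M M]
  [SMulCommClass F M M]

theorem rTensor_grFresh_mul (x y : Grassmann F ⊗[F] M) :
    LinearMap.rTensor M (grFresh F) (x * y) =
      LinearMap.rTensor M (grFresh F) x * grTensorMap (grShift F) (NonUnitalAlgHom.id F M) y := by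
  induction x with
  | zero => simp
  | add u v hu hv => simp only [add_mul, map_add, hu, hv]
  | tmul g a =>
    induction y with
    | zero => simp
    | add u v hu hv => simp only [mul_add, map_add, hu, hv]
    | tmul h b => simp [grFresh_mul]

theorem rTensor_grFresh_mul' (x y : Grassmann F ⊗[F] M) :
    LinearMap.rTensor M (grFresh F) (x * y) =
      grTensorMap (grShift F) (NonUnitalAlgHom.id F M) x * LinearMap.rTensor M (grFresh F) y := by
  induction x with
  | zero => simp
  | add u v hu hv => simp only [add_mul, map_add, hu, hv]
  | tmul g a =>
    induction y with
    | zero => simp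
    | add u v hu hv => simp only [mul_add, map_add, hu, hv]
    | tmul h b => simp [grFresh_mul']

theorem rTensor_grFresh_symCube (x y z : Grassmann F ⊗[F] M) :
    LinearMap.rTensor M (grFresh F) (symCube x y z) =
      symCube (LinearMap.rTensor M (grFresh F) x)
        (grTensorMap (grShift F) (NonUnitalAlgHom.id F M) y)
        (grTensorMap (grShift F) (NonUnitalAlgHom.id F M) z) := by
  simp only [symCube, map_add]
  rw [rTensor_grFresh_mul (x * y) z, rTensor_grFresh_mul x y, rTensor_grFresh_mul (y * x) z,
    rTensor_grFresh_mul' y x, rTensor_grFresh_mul (x * z) y, rTensor_grFresh_mul x z,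
    rTensor_grFresh_mul (z * x) y, rTensor_grFresh_mul' z x, rTensor_grFresh_mul' (y * z) x,
    rTensor_grFresh_mul' (z * y) x, map_mul, map_mul]

end

theorem symCube_product_of_mem [CharZero F] {A : Superalgebra F}
    (hA : A ∈ altMetabelianSupervariety F) {a b x y : Grassmann F ⊗[F] A.carrier}
    (ha : a ∈ grassmannEnvelope A) (hb : b ∈ grassmannEnvelope A) (hx : x ∈ grassmannEnvelope A)
    (hy : y ∈ grassmannEnvelope A) : symCube (a * b) x y = 0 :=
  congrArg Subtype.val (IsAltMetabelian.symCube_product (F := F) hA ⟨a, ha⟩ ⟨b, hb⟩ ⟨x, hx⟩ ⟨y, hy⟩)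

/-- The tensor `g ⊗ ab` need not be a product of two elements of the envelope, as `g` may not factor
with the right parities. Multiplication by two fresh generators makes it one without losing
information. -/
theorem symCube_tmul_mul [CharZero F] {A : Superalgebra F}
    (hA : A ∈ altMetabelianSupervariety F) {i j : ZMod 2} {g : Grassmann F} {a b : A.carrier}
    (hg : g ∈ grassmannPart F (i + j)) (ha : a ∈ A.part i) (hb : b ∈ A.part j)
    {x y : Grassmann F ⊗[F] A.carrier} (hx : x ∈ grassmannEnvelope A)
    (hy : y ∈ grassmannEnvelope A) : symCube (g ⊗ₜ (a * b)) x y = 0 := by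
  apply rTensor_grFresh_injective
  rw [map_zero, rTensor_grFresh_symCube]
  have hφ : IsGraded (NonUnitalAlgHom.id F A.carrier) (A := A) (C := A) := fun _ _ h => h
  have hx' := grTensorMap_mem (fun _ _ => grShift_mem) hφ hx
  have hy' := grTensorMap_mem (fun _ _ => grShift_mem) hφ hy
  have hg' := grShift_mem hg
  have h2 : ∀ i : ZMod 2, i = 0 ∨ i = 1 := by decide
  -- The fresh generators are distributed by parity: an even `a` takes both of them, an odd `a`
  -- takes one and leaves the other to `b`.
  rcases h2 i with rfl | rfl
  · have e : LinearMap.rTensor A.carrier (grFresh F) (g ⊗ₜ (a * b)) =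
        ((grGen F 0 * grGen F 1) ⊗ₜ a) * (grShift F g ⊗ₜ b) := by
      simp [grFresh, mul_assoc]
    rw [e]
    refine symCube_product_of_mem hA (tmul_mem_grassmannEnvelope (i := 0) ?_ ha)
      (tmul_mem_grassmannEnvelope (i := j) (by simpa using hg') hb) hx' hy'
    exact grassmannPart_mul_mem (i := 1) (j := 1) (grGen_mem 0) (grGen_mem 1)
  · have e : LinearMap.rTensor A.carrier (grFresh F) (g ⊗ₜ (a * b)) =
        (grGen F 0 ⊗ₜ a) * ((grGen F 1 * grShift F g) ⊗ₜ b) := by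
      simp [grFresh]
    rw [e]
    refine symCube_product_of_mem hA (tmul_mem_grassmannEnvelope (grGen_mem 0) ha)
      (tmul_mem_grassmannEnvelope (i := j) ?_ hb) hx' hy'
    have := grassmannPart_mul_mem (grGen_mem (F := F) 1) hg'
    rwa [← add_assoc, show (1 : ZMod 2) + 1 = 0 from rfl, zero_add] at this

/-- Exchanging the first two arguments leaves the factors from `M` unchanged and reverses the sign
of the Grassmann factor, so the six terms cancel in pairs. -/
theorem symCube_odd_self {M : Type u} [NonUnitalNonAssocRing M] [Module F M]
    [IsScalarTower F M M] [SMulCommClass F M M] {g h k : Grassmann F}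
    (hg : g ∈ grassmannPart F 1) (hh : h ∈ grassmannPart F 1) (hk : k ∈ grassmannPart F 1)
    (y z : M) : symCube (g ⊗ₜ[F] y) (h ⊗ₜ[F] y) (k ⊗ₜ[F] z) = 0 := by
  have e1 : h * g = -(g * h) := grassmann_odd_anticomm hh hg
  have e2 : h * k * g = -(g * k * h) := by
    rw [grassmann_odd_anticomm hh hk, neg_mul, mul_assoc, e1, mul_neg, neg_neg, ← mul_assoc,
      grassmann_odd_anticomm hk hg, neg_mul]
  have e3 : k * h * g = -(k * g * h) := by rw [mul_assoc, e1, mul_neg, mul_assoc]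
  simp only [symCube, Algebra.TensorProduct.tmul_mul_tmul]
  simp only [e1, e2, e3, neg_mul, TensorProduct.neg_tmul]
  abel

theorem symCube_add {B : Type u} [NonUnitalNonAssocRing B] (x x' y z : B) :
    symCube (x + x') y z = symCube x y z + symCube x' y z := by
  simp only [symCube, add_mul, mul_add]
  abel

theorem symCube_zero {B : Type u} [NonUnitalNonAssocRing B] (y z : B) :
    symCube 0 y z = 0 := by
  simp [symCube]

/-- The symmetrized cube vanishes as soon as it vanishes at the generators. -/
theorem symCube_eq_zero_of_gen [CharZero F] {r s : ℕ}
    {y z : Grassmann F ⊗[F] (freeAltMetabelian F r s).carrier}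
    (hy : y ∈ grassmannEnvelope (freeAltMetabelian F r s))
    (hz : z ∈ grassmannEnvelope (freeAltMetabelian F r s))
    (h : ∀ (x : Fin r ⊕ Fin s) (g : Grassmann F), g ∈ grassmannPart F (genParity x) →
      symCube (g ⊗ₜ freeGen F r s x) y z = 0)
    {x : Grassmann F ⊗[F] (freeAltMetabelian F r s).carrier}
    (hx : x ∈ grassmannEnvelope (freeAltMetabelian F r s)) : symCube x y z = 0 := by
  refine freeEnvelope_induction (p := fun x => symCube x y z = 0) (symCube_zero y z)
    (fun x x' hx hx' => ?_) h (fun i j g a b hg ha hb => ?_) hx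
  · rw [symCube_add, hx, hx', add_zero]
  · exact symCube_tmul_mul (freeAltMetabelian_mem r s) hg ha hb hy hz

theorem satisfiesSuperidentity_cubePoly [CharZero F] :
    SatisfiesSuperidentity (cubePoly F) (freeAltMetabelian F 0 2) := by
  rw [satisfiesSuperidentity_iff]
  intro b hb
  rw [lift_cubePoly]
  refine symCube_eq_zero_of_gen (hb 1) (hb 2) (fun x g hg => ?_) (hb 0)
  rw [symCube_swap_left]
  have hx := tmul_mem_grassmannEnvelope hg (freeGen_mem 0 2 x)
  refine symCube_eq_zero_of_gen hx (hb 2) (fun y h hh => ?_) (hb 1)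
  rw [symCube_swap_right, symCube_swap_left]
  have hy := tmul_mem_grassmannEnvelope hh (freeGen_mem 0 2 y)
  refine symCube_eq_zero_of_gen hy hx (fun z k hk => ?_) (hb 2)
  rcases x with x | x
  · exact x.elim0
  rcases y with y | y
  · exact y.elim0
  rcases z with z | z
  · exact z.elim0
  change g ∈ grassmannPart F 1 at hg
  change h ∈ grassmannPart F 1 at hh
  change k ∈ grassmannPart F 1 at hk
  -- Three indices in `Fin 2` cannot be distinct.
  have : z = y ∨ z = x ∨ y = x := by omega
  rcases this with rfl | rfl | rfl
  · exact symCube_odd_self hk hh hg _ _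
  · rw [symCube_swap_right]
    exact symCube_odd_self hk hg hh _ _
  · rw [symCube_swap_left, symCube_swap_right]
    exact symCube_odd_self hh hg hk _ _

end CubeHolds

/-! ### The cube is nonzero on one even generator and on three odd ones. -/

section CubeFails

variable {F : Type u} [Field F]

/-- A superidentity of the free `Alt⁽²⁾`-superalgebra holds at all pure tensors over the images of
the generators. -/
theorem SatisfiesSuperidentity.lift_tmul_eq_zero {n r s : ℕ}
    {f : FreeNonUnitalNonAssocAlgebra F (Fin n)}
    (h : SatisfiesSuperidentity f (freeAltMetabelian F r s)) {C : Superalgebra F}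
    (hC : C ∈ altMetabelianSupervariety F) (c : Fin r ⊕ Fin s → C.carrier)
    (hc : ∀ x, c x ∈ C.part (genParity x)) (x : Fin n → Fin r ⊕ Fin s) (g : Fin n → Grassmann F)
    (hg : ∀ k, g k ∈ grassmannPart F (genParity (x k))) :
    FreeNonUnitalNonAssocAlgebra.lift F (fun k => g k ⊗ₜ[F] c (x k)) f = 0 := by
  obtain ⟨φ, hφ, hφx⟩ := exists_hom_freeAltMetabelian hC c hc
  rw [satisfiesSuperidentity_iff] at h
  have h1 := congrArg (grTensorMap (AlgHom.id F (Grassmann F)) φ)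
    (h (fun k => g k ⊗ₜ freeGen F r s (x k)) (fun k =>
      tmul_mem_grassmannEnvelope (hg k) (freeGen_mem r s (x k))))
  rw [map_lift, map_zero] at h1
  rw [← h1]
  congr 2
  funext k
  rw [grTensorMap_tmul, hφx, AlgHom.id_apply]

/-- The inclusion of an algebra in its tensor product with the Grassmann algebra. -/
noncomputable def oneTmul (M : Type u) [NonUnitalNonAssocRing M] [Module F M]
    [IsScalarTower F M M] [SMulCommClass F M M] : M →ₙₐ[F] Grassmann F ⊗[F] M where
  toFun a := 1 ⊗ₜ a
  map_smul' c a := TensorProduct.tmul_smul c (1 : Grassmann F) a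
  map_zero' := TensorProduct.tmul_zero _ _
  map_add' a b := TensorProduct.tmul_add _ _ _
  map_mul' a b := by rw [Algebra.TensorProduct.tmul_mul_tmul, one_mul]

theorem oneTmul_injective {M : Type u} [NonUnitalNonAssocRing M] [Module F M]
    [IsScalarTower F M M] [SMulCommClass F M M] : Function.Injective (oneTmul (F := F) M) := by
  rw [injective_iff_map_eq_zero]
  intro a ha
  by_contra h0
  exact tmul_ne_zero_of_ne_zero one_ne_zero h0 ha

variable (F) in
/-- An algebra regarded as a superalgebra with zero odd part. -/
def evenSuperalgebra (B : Type u) [NonUnitalNonAssocRing B] [Module F B] [IsScalarTower F B B]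
    [SMulCommClass F B B] : Superalgebra F where
  carrier := B
  part i := if i = 0 then ⊤ else ⊥
  isCompl := isCompl_top_bot
  mul_mem i j a b ha hb := by
    have h2 : ∀ i : ZMod 2, i = 0 ∨ i = 1 := by decide
    rcases h2 i with rfl | rfl
    · rcases h2 j with rfl | rfl
      · trivial
      · have hb : b = 0 := hb
        rw [hb, mul_zero]
        exact Submodule.zero_mem _
    · have ha : a = 0 := ha
      rw [ha, zero_mul]
      exact Submodule.zero_mem _

variable {B : Type u} [NonUnitalNonAssocRing B] [Module F B] [IsScalarTower F B B]
    [SMulCommClass F B B]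

theorem evenSuperalgebra_mem [CharZero F] (hB : IsAltMetabelian B) :
    evenSuperalgebra F B ∈ altMetabelianSupervariety F := by
  have h1 : ∀ a : (evenSuperalgebra F B).carrier, a ∈ (evenSuperalgebra F B).part 1 → a = 0 :=
    fun a ha => ha
  have h2 : ∀ i : ZMod 2, i = 0 ∨ i = 1 := by decide
  apply mem_altMetabelianSupervariety_of_homogeneous
  · intro i j k a ha b hb c hc
    rcases h2 i with rfl | rfl
    · have : superSign F 0 j = 1 := by simp [superSign]
      rw [this, one_smul]
      exact hB.assoc_left a b c
    · rw [h1 a ha]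
      simp
  · intro i j k a ha b hb c hc
    rcases h2 j with rfl | rfl
    · have : superSign F 0 k = 1 := by simp [superSign]
      rw [this, one_smul]
      exact hB.assoc_right a b c
    · rw [h1 b hb]
      simp
  · exact hB.2.2

/-- A superidentity of the free `Alt⁽²⁾`-superalgebra on `r` even generators holds on all
`r`-element subsets of `Alt⁽²⁾`-algebras. -/
theorem SatisfiesSuperidentity.lift_comp_eq_zero [CharZero F] {n r : ℕ}
    {f : FreeNonUnitalNonAssocAlgebra F (Fin n)}
    (h : SatisfiesSuperidentity f (freeAltMetabelian F r 0)) (hB : IsAltMetabelian B)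
    (c : Fin r → B) (x : Fin n → Fin r) :
    FreeNonUnitalNonAssocAlgebra.lift F (fun k => c (x k)) f = 0 := by
  have h1 := h.lift_tmul_eq_zero (evenSuperalgebra_mem (F := F) hB)
    (Sum.elim c Fin.elim0) (by
      rintro (y | y)
      · trivial
      · exact y.elim0) (fun k => .inl (x k)) (fun _ => 1) (fun _ => one_mem_grassmannPart)
  let ι : B →ₙₐ[F] (evenSuperalgebra F B).carrier := NonUnitalAlgHom.id F B
  have h2 : oneTmul (F := F) _ (ι (FreeNonUnitalNonAssocAlgebra.lift F (fun k => c (x k)) f)) = 0 := by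
    rw [map_lift, map_lift]
    exact h1
  have h3 : ι (FreeNonUnitalNonAssocAlgebra.lift F (fun k => c (x k)) f) = 0 :=
    oneTmul_injective (F := F) (h2.trans (map_zero _).symm)
  exact h3

variable (F) in
/-- The multiplication of the algebra with basis `x, x², x³` and `x⁴ = 0`. -/
def truncMul : (F × F × F) →ₗ[F] (F × F × F) →ₗ[F] (F × F × F) :=
  LinearMap.mk₂ F (fun x y => (0, x.1 * y.1, x.1 * y.2.1 + x.2.1 * y.1))
    (by intro x x' y; ext <;> simp <;> ring)
    (by intro c x y; ext <;> simp <;> ring)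
    (by intro x y y'; ext <;> simp <;> ring)
    (by intro c x y; ext <;> simp <;> ring)

instance {M : Type u} [AddCommGroup M] [Module F M] (β : M →ₗ[F] M →ₗ[F] M) :
    IsScalarTower F (BilinAlgebra β) (BilinAlgebra β) :=
  ⟨fun c x y => LinearMap.map_smul₂ β c x y⟩

instance {M : Type u} [AddCommGroup M] [Module F M] (β : M →ₗ[F] M →ₗ[F] M) :
    SMulCommClass F (BilinAlgebra β) (BilinAlgebra β) :=
  ⟨fun c x y => (map_smul (β x) c y).symm⟩

theorem isAltMetabelian_of_assoc {B : Type u} [NonUnitalNonAssocRing B]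
    (h : ∀ x y z : B, x * y * z = x * (y * z)) (hZ : ∀ x y z t : B, (x * y) * (z * t) = 0) :
    IsAltMetabelian B :=
  ⟨fun x y => sub_eq_zero.2 (h x x y), fun x y => sub_eq_zero.2 (h x y y), hZ⟩

theorem isAltMetabelian_truncMul : IsAltMetabelian (BilinAlgebra (truncMul F)) := by
  refine isAltMetabelian_of_assoc ?_ ?_
  · rintro ⟨x₁, x₂, x₃⟩ ⟨y₁, y₂, y₃⟩ ⟨z₁, z₂, z₃⟩
    change ((0, 0 * z₁, 0 * z₂ + x₁ * y₁ * z₁) : F × F × F) =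
      (0, x₁ * 0, x₁ * (y₁ * z₁) + x₂ * 0)
    simp [mul_assoc]
  · rintro ⟨x₁, x₂, x₃⟩ ⟨y₁, y₂, y₃⟩ ⟨z₁, z₂, z₃⟩ ⟨t₁, t₂, t₃⟩
    change ((0, 0 * 0, 0 * (z₁ * t₁) + x₁ * y₁ * 0) : F × F × F) = 0
    simp

/-- With all arguments equal to `x` the symmetrized cube is `6 x³`. -/
theorem not_satisfiesSuperidentity_cubePoly_one_zero [CharZero F] :
    ¬ SatisfiesSuperidentity (cubePoly F) (freeAltMetabelian F 1 0) := by
  intro h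
  let x : BilinAlgebra (truncMul F) := ((1, 0, 0) : F × F × F)
  have h1 := h.lift_comp_eq_zero isAltMetabelian_truncMul (fun _ => x) (fun _ => 0)
  rw [lift_cubePoly] at h1
  have e : x * x * x = ((0, 0, 1) : F × F × F) := by
    change ((0, 0 * 1, 0 * 0 + 1 * 1 * 1) : F × F × F) = (0, 0, 1)
    simp
  have h2 : (6 : F) • (x * x * x) = 0 := by
    rw [← h1, symCube]
    module
  have h3 : x * x * x = 0 := (smul_eq_zero.1 h2).resolve_left (by norm_num)
  have h4 : ((0, 0, 1) : F × F × F) = 0 := e.symm.trans h3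
  simp at h4

theorem mem_altMetabelianSupervariety_of_assoc [CharZero F] {A : Superalgebra F}
    (h : ∀ x y z : A.carrier, x * y * z = x * (y * z))
    (hZ : ∀ x y z t : A.carrier, (x * y) * (z * t) = 0) : A ∈ altMetabelianSupervariety F := by
  apply mem_altMetabelianSupervariety_of_homogeneous
  · intro i j k a _ b _ c _
    rw [h, h, sub_self, sub_self, smul_zero, add_zero]
  · intro i j k a _ b _ c _
    rw [h, h, sub_self, sub_self, smul_zero, add_zero]
  · exact hZ

variable (F) in
/-- The multiplication of the exterior algebra of a three-dimensional space without unit. -/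
def crossMul : ((Fin 3 → F) × (Fin 3 → F) × F) →ₗ[F] ((Fin 3 → F) × (Fin 3 → F) × F) →ₗ[F]
    ((Fin 3 → F) × (Fin 3 → F) × F) :=
  LinearMap.mk₂ F (fun x y => (0, crossProduct x.1 y.1, x.1 ⬝ᵥ y.2.1 + x.2.1 ⬝ᵥ y.1))
    (by
      intro x x' y
      simp only [Prod.fst_add, Prod.snd_add, map_add, LinearMap.add_apply, add_dotProduct,
        Prod.mk_add_mk, add_zero]
      congr 2; ring)
    (by
      intro c x y
      simp only [Prod.smul_fst, Prod.smul_snd, map_smul, LinearMap.smul_apply, smul_dotProduct,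
        Prod.smul_mk, smul_zero, smul_add])
    (by
      intro x y y'
      simp only [Prod.fst_add, Prod.snd_add, map_add, dotProduct_add, Prod.mk_add_mk, add_zero]
      congr 2; ring)
    (by
      intro c x y
      simp only [Prod.smul_fst, Prod.smul_snd, map_smul, dotProduct_smul,
        Prod.smul_mk, smul_zero, smul_add])

variable (F) in
/-- The exterior algebra of a three-dimensional odd space, without unit. -/
def crossModel : Superalgebra F :=
  bilinSuperalgebra (crossMul F)
    (LinearMap.ker ((LinearMap.fst F (Fin 3 → F) ((Fin 3 → F) × F)).prod
      (LinearMap.snd F (Fin 3 → F) F ∘ₗ LinearMap.snd F (Fin 3 → F) ((Fin 3 → F) × F))))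
    (LinearMap.ker (LinearMap.fst F (Fin 3 → F) F ∘ₗ
      LinearMap.snd F (Fin 3 → F) ((Fin 3 → F) × F)))
    (by
      constructor
      · rw [Submodule.disjoint_def]
        rintro ⟨a, b, c⟩ h h'
        simp at h h'
        simp [h, h']
      · rw [codisjoint_iff, eq_top_iff]
        rintro ⟨a, b, c⟩ -
        exact Submodule.mem_sup.2 ⟨(0, b, 0), by simp, (a, 0, c), by simp, by simp⟩)
    (by
      rintro ⟨a, b, c⟩ h ⟨a', b', c'⟩ h'
      simp at h h'
      simp [crossMul, h, h'])
    (by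
      rintro ⟨a, b, c⟩ h ⟨a', b', c'⟩ h'
      simp at h h'
      simp [crossMul, h, h'])
    (by
      rintro ⟨a, b, c⟩ h ⟨a', b', c'⟩ h'
      simp at h h'
      simp [crossMul, h, h'])
    (by
      rintro ⟨a, b, c⟩ h ⟨a', b', c'⟩ h'
      simp at h h'
      simp [crossMul, h, h'])

/-- An element of the model. -/
def crossModel.mk (u v : Fin 3 → F) (t : F) : (crossModel F).carrier :=
  ((u, v, t) : (Fin 3 → F) × (Fin 3 → F) × F)

theorem crossModel.exists_mk (x : (crossModel F).carrier) : ∃ u v t, x = crossModel.mk u v t :=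
  ⟨_, _, _, rfl⟩

theorem crossModel.mk_mul_mk (u v u' v' : Fin 3 → F) (t t' : F) :
    crossModel.mk u v t * crossModel.mk u' v' t' =
      crossModel.mk 0 (crossProduct u u') (u ⬝ᵥ v' + v ⬝ᵥ u') := rfl

theorem crossModel.smul_mk (c : F) (u v : Fin 3 → F) (t : F) :
    c • crossModel.mk u v t = crossModel.mk (c • u) (c • v) (c * t) := rfl

theorem crossModel.zero_eq : (0 : (crossModel F).carrier) = crossModel.mk 0 0 0 := rfl

theorem crossModel.mk_mem_one (u : Fin 3 → F) : crossModel.mk u 0 0 ∈ (crossModel F).part 1 := by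
  change ((u, 0, 0) : (Fin 3 → F) × (Fin 3 → F) × F) ∈ LinearMap.ker _
  simp

/-- Associativity is the cyclic invariance of the scalar triple product; all products of four
elements vanish by degree. -/
theorem crossModel_mem [CharZero F] : crossModel F ∈ altMetabelianSupervariety F := by
  apply mem_altMetabelianSupervariety_of_assoc
  · intro x y z
    obtain ⟨u, v, t, rfl⟩ := crossModel.exists_mk x
    obtain ⟨u', v', t', rfl⟩ := crossModel.exists_mk y
    obtain ⟨u'', v'', t'', rfl⟩ := crossModel.exists_mk z
    simp only [crossModel.mk_mul_mk, map_zero, LinearMap.zero_apply, zero_dotProduct,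
      dotProduct_zero, zero_add, add_zero]
    rw [triple_product_permutation, triple_product_permutation, dotProduct_comm]
  · intro x y z w
    obtain ⟨u, v, t, rfl⟩ := crossModel.exists_mk x
    obtain ⟨u', v', t', rfl⟩ := crossModel.exists_mk y
    obtain ⟨u'', v'', t'', rfl⟩ := crossModel.exists_mk z
    obtain ⟨u₃, v₃, t₃, rfl⟩ := crossModel.exists_mk w
    simp [crossModel.mk_mul_mk, crossModel.zero_eq]

theorem crossModel.mk_triple (u v w : Fin 3 → F) :
    crossModel.mk u 0 0 * crossModel.mk v 0 0 * crossModel.mk w 0 0 =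
      (crossProduct u v ⬝ᵥ w) • crossModel.mk 0 0 1 := by
  simp [crossModel.mk_mul_mk, crossModel.smul_mk]

/-- The sign of permuting Grassmann generators cancels the sign of permuting the basis vectors in
the triple product, so the six terms are equal and add up. -/
theorem not_satisfiesSuperidentity_cubePoly_zero_three [CharZero F] :
    ¬ SatisfiesSuperidentity (cubePoly F) (freeAltMetabelian F 0 3) := by
  intro h
  have h1 := h.lift_tmul_eq_zero crossModel_mem
    (Sum.elim Fin.elim0 fun k => crossModel.mk (Pi.single k 1) 0 0) (by
      rintro (y | y)
      · exact y.elim0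
      · exact crossModel.mk_mem_one _) (fun k => .inr k) (fun k => grGen F k)
      (fun k => grGen_mem _)
  have e10 : grGen F 1 * grGen F 0 = -(grGen F 0 * grGen F 1) :=
    grassmann_odd_anticomm (grGen_mem 1) (grGen_mem 0)
  have e20 : grGen F 2 * grGen F 0 = -(grGen F 0 * grGen F 2) :=
    grassmann_odd_anticomm (grGen_mem 2) (grGen_mem 0)
  have e21 : grGen F 2 * grGen F 1 = -(grGen F 1 * grGen F 2) :=
    grassmann_odd_anticomm (grGen_mem 2) (grGen_mem 1)
  have e201 : grGen F 0 * grGen F 2 * grGen F 1 = -(grGen F 0 * grGen F 1 * grGen F 2) := by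
    rw [mul_assoc, e21, mul_neg, mul_assoc]
  have e120 : grGen F 1 * grGen F 2 * grGen F 0 = grGen F 0 * grGen F 1 * grGen F 2 := by
    rw [mul_assoc, e20, mul_neg, ← mul_assoc, e10, neg_mul, neg_neg]
  rw [lift_cubePoly] at h1
  simp only [symCube, Sum.elim_inr, Algebra.TensorProduct.tmul_mul_tmul,
    crossModel.mk_triple] at h1
  have h2 : (6 : F) • ((grGen F 0 * grGen F 1 * grGen F 2) ⊗ₜ[F]
      (crossModel.mk 0 0 1 : (crossModel F).carrier)) = 0 := by
    rw [← h1]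
    simp [e10, e20, e21, e201, e120, cross_apply, TensorProduct.neg_tmul,
      TensorProduct.tmul_neg]
    module
  refine tmul_ne_zero_of_ne_zero ?_ ?_ ((smul_eq_zero.1 h2).resolve_left (by norm_num))
  · have : grGen F 0 * grGen F 1 * grGen F 2 = grProd [0, 1, 2] := by
      simp [grProd, mul_assoc]
    rw [this]
    exact grProd_ne_zero (by decide)
  · intro h0
    have h0 : ((0, 0, 1) : (Fin 3 → F) × (Fin 3 → F) × F) = 0 := h0
    simp at h0

end CubeFails

/-! ### The polynomial that counts even generators. -/

section CommutatorPolynomial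

variable {F : Type u} [Field F]

/-- The multiplications by the letters `2, …, r + 1` on the right. -/
def tailOps (r : ℕ) : List (Fin (r + 2) × Bool) :=
  (List.finRange r).map fun k => (k.succ.succ, false)

theorem chainLetters_tailOps (r : ℕ) : chainLetters 0 1 (tailOps r) = List.finRange (r + 2) := by
  simp only [chainLetters, tailOps, List.finRange_succ, List.map_cons, List.map_map]
  rfl

variable (F) in
/-- The polynomial `[x₀, x₁] x₂ ⋯ xᵣ₊₁`. -/
noncomputable def commutatorPoly (r : ℕ) : FreeNonUnitalNonAssocAlgebra F (Fin (r + 2)) :=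
  wordPoly F (chainWord 0 1 (tailOps r)) - wordPoly F (chainWord 1 0 (tailOps r))

theorem chainLetters_tailOps_perm (r : ℕ) :
    (chainLetters 1 0 (tailOps r)).Perm (List.finRange (r + 2)) := by
  rw [← chainLetters_tailOps]
  exact List.Perm.swap _ _ _

theorem isMultilinearPoly_commutatorPoly (r : ℕ) : IsMultilinearPoly (commutatorPoly F r) := by
  refine .sub (isMultilinearPoly_wordPoly fun i => ?_) (isMultilinearPoly_wordPoly fun i => ?_)
  · rw [occurrences_chainWord, chainLetters_tailOps]
    exact List.count_eq_one_of_mem (List.nodup_finRange _) (List.mem_finRange i)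
  · rw [occurrences_chainWord, (chainLetters_tailOps_perm r).count_eq]
    exact List.count_eq_one_of_mem (List.nodup_finRange _) (List.mem_finRange i)

theorem foldl_evalStep_tailOps {B : Type u} [NonUnitalNonAssocRing B] (r : ℕ) (b : Fin (r + 2) → B)
    (u : B) : (tailOps r).foldl (evalStep b) u =
      rightFold u ((List.finRange r).map fun k => b k.succ.succ) := by
  rw [tailOps, List.foldl_map, rightFold, List.foldl_map]
  rfl

theorem lift_commutatorPoly {B : Type u} [NonUnitalNonAssocRing B] [Module F B]
    [IsScalarTower F B B] [SMulCommClass F B B] (r : ℕ) (b : Fin (r + 2) → B) :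
    FreeNonUnitalNonAssocAlgebra.lift F b (commutatorPoly F r) =
      rightFold (b 0 * b 1 - b 1 * b 0) ((List.finRange r).map fun k => b k.succ.succ) := by
  rw [commutatorPoly, map_sub, lift_wordPoly, lift_wordPoly, evalWord_chainWord,
    evalWord_chainWord, foldl_evalStep_tailOps, foldl_evalStep_tailOps, rightFold_sub]

/-- With the variable 0 at `y²`, the two words have coefficients 1 and φ², and right multiplications
do not change them; the difference 1 - φ² is nonzero. -/
theorem not_satisfiesSuperidentity_commutatorPoly_zero_one [CharZero F] (r : ℕ) :
    ¬ SatisfiesSuperidentity (commutatorPoly F r) (freeAltMetabelian F 0 1) := by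
  intro h
  have h1 := lift_skewPoint_eq_zero h 0
  have hnd := List.nodup_finRange (r + 2)
  rw [commutatorPoly, map_sub, lift_wordPoly, lift_wordPoly,
    evalWord_skewPoint 0 0 1 _ (by rw [chainLetters_tailOps]; exact hnd)
      (by rw [chainLetters_tailOps]; exact List.mem_finRange _),
    evalWord_skewPoint 0 1 0 _ ((chainLetters_tailOps_perm r).nodup_iff.2 hnd)
      ((chainLetters_tailOps_perm r).mem_iff.2 (List.mem_finRange _)),
    if_pos rfl, if_neg (by simp), if_pos rfl, ← TensorProduct.tmul_sub, ← map_sub] at h1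
  have hc : chainCoeff ((1, 0) : F × F) ((tailOps r).map Prod.snd) = (1, 0) := by
    have : ∀ (l : List (Fin r)) (s : Bool), ((l.map fun _ => false).foldl coeffStep
        (((1, 0) : F × F), s)).1 = (1, 0) := by
      intro l
      induction l with
      | nil => intro s; rfl
      | cons a l ih => intro s; exact ih _
    rw [chainCoeff, tailOps, List.map_map]
    exact this _ _
  refine tmul_ne_zero_of_ne_zero (grProd_ne_zero ?_) (fun h0 => ?_) h1
  · refine List.Nodup.map Fin.val_injective ?_
    have := (chainLetters_tailOps r).symm ▸ hnd
    exact (List.nodup_cons.1 this).2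
  · have := skewModel.incl_injective _ (h0.trans (map_zero _).symm)
    rw [hc] at this
    simp [mulPhiSq] at this

/-- A product with a factor in the square vanishes. -/
theorem rightFold_eq_zero_of_mem {B : Type u} [NonUnitalNonAssocRing B]
    (hZ : ∀ x y z t : B, (x * y) * (z * t) = 0) (p q : B) {u v : B} {l : List B}
    (h : u * v ∈ l) : rightFold (p * q) l = 0 := by
  induction l generalizing p q with
  | nil => simp at h
  | cons x l ih =>
    rw [rightFold_cons]
    rcases List.mem_cons.1 h with rfl | h
    · rw [hZ, rightFold_zero]
    · exact ih _ _ h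

theorem rightFold_eq_zero_of_span {B : Type u} [NonUnitalNonAssocRing B] [Module F B]
    [IsScalarTower F B B] [SMulCommClass F B B] {S : Set B} {n : ℕ} {u : B}
    (h : ∀ l : List B, l.length = n → (∀ a ∈ l, a ∈ S) → rightFold u l = 0) :
    ∀ l : List B, l.length = n → (∀ a ∈ l, a ∈ Submodule.span F S) → rightFold u l = 0 := by
  induction n generalizing u with
  | zero =>
    intro l hl _
    obtain rfl := List.length_eq_zero_iff.1 hl
    exact h [] rfl (by simp)
  | succ n ih =>
    rintro (_ | ⟨a, l⟩) hl hmem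
    · simp at hl
    · rw [rightFold_cons]
      refine ih (fun l' hl' hmem' => ?_) l (by simpa using hl) fun b hb => hmem b (by simp [hb])
      have ha := hmem a (by simp)
      clear hl hmem
      induction ha using Submodule.span_induction with
      | zero => rw [mul_zero, rightFold_zero]
      | add a b _ _ ha hb => rw [mul_add, rightFold_add, ha, hb, add_zero]
      | smul c a _ ha => rw [mul_smul_comm, rightFold_smul, ha, smul_zero]
      | mem a ha =>
        refine h (a :: l') (by simp [hl']) ?_
        rintro b hb
        rcases List.mem_cons.1 hb with rfl | hb
        · exact ha
        · exact hmem' b hb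

theorem commutator_rightFold_eq_zero_of_span {B : Type u} [NonUnitalNonAssocRing B] [Module F B]
    [IsScalarTower F B B] [SMulCommClass F B B] {S : Set B} {n : ℕ}
    (h : ∀ p ∈ S, ∀ q ∈ S, ∀ l : List B, l.length = n → (∀ a ∈ l, a ∈ S) →
      rightFold (p * q - q * p) l = 0) {p q : B} (hp : p ∈ Submodule.span F S)
    (hq : q ∈ Submodule.span F S) {l : List B} (hl : l.length = n)
    (hmem : ∀ a ∈ l, a ∈ Submodule.span F S) : rightFold (p * q - q * p) l = 0 := by
  induction hp using Submodule.span_induction with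
  | zero => rw [zero_mul, mul_zero, sub_zero, rightFold_zero]
  | add a b _ _ ha hb =>
    rw [add_mul, mul_add, add_sub_add_comm, rightFold_add, ha, hb, add_zero]
  | smul c a _ ha => rw [smul_mul_assoc, mul_smul_comm, ← smul_sub, rightFold_smul, ha, smul_zero]
  | mem p hp =>
    induction hq using Submodule.span_induction with
    | zero => rw [zero_mul, mul_zero, sub_zero, rightFold_zero]
    | add a b _ _ ha hb =>
      rw [add_mul, mul_add, add_sub_add_comm, rightFold_add, ha, hb, add_zero]
    | smul c a _ ha =>
      rw [smul_mul_assoc, mul_smul_comm, ← smul_sub, rightFold_smul, ha, smul_zero]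
    | mem q hq => exact rightFold_eq_zero_of_span (h p hp q hq) l hl hmem

section

variable [CharZero F] {B : Type u} [NonUnitalNonAssocRing B] [Module F B]
    [IsScalarTower F B B] [SMulCommClass F B B]

-- Both terms are skew functions of r + 1 letters taken from r generators, so some letter is
-- repeated.
omit [IsScalarTower F B B] [SMulCommClass F B B] in
include F in
theorem rightFold_commutator_product (hB : IsAltMetabelian B) {r : ℕ} (g : Fin r → B)
    (x : Fin r) (a b : B) {l : List (Fin r)} (hl : l.length = r) :
    rightFold (a * b * g x - g x * (a * b)) (l.map g) = 0 := by
  have hnd : ¬ (x :: l).Nodup := by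
    intro h
    have := h.length_le_card
    simp [hl] at this
  rw [rightFold_sub]
  have h1 : rightFold (a * b) ((x :: l).map g) = 0 :=
    ((isSkewOnLists_rightFold hB a b).comp_map g).eq_zero_of_not_nodup (F := F) hnd
  have h2 : leftRightFold (a * b) ((x :: l).map g) = 0 :=
    ((isSkewOnLists_leftRightFold (F := F) hB a b).comp_map g).eq_zero_of_not_nodup (F := F) hnd
  rw [List.map_cons, rightFold_cons] at h1
  rw [List.map_cons, leftRightFold] at h2
  rw [h1, h2, sub_zero]

-- In the normal form of each word, a skew function receives r + 1 letters from r generators and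
-- vanishes.
include F in
theorem rightFold_commutator_gen (hB : IsAltMetabelian B) {r : ℕ} (hr : 1 ≤ r) (g : Fin r → B)
    (x : Fin (r + 2) → Fin r) :
    rightFold (g (x 0) * g (x 1) - g (x 1) * g (x 0))
      ((List.finRange r).map fun k => g (x k.succ.succ)) = 0 := by
  rcases hr.eq_or_lt with rfl | hr
  -- For r = 1 there are three variables and a cube term could appear in each word; but the
  -- commutator of the single generator with itself is already zero.
  · rw [Subsingleton.elim (x 0) (x 1), sub_self, rightFold_zero]
  have h0 : ∀ (i j : Fin (r + 2)), (chainLetters i j (tailOps r)).Perm (List.finRange (r + 2)) →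
      evalWord (fun k => g (x k)) (chainWord i j (tailOps r)) = 0 := by
    intro i j hperm
    have hlen : (tailOps r).length = r := by simp [tailOps]
    rw [evalWord_chainWord_skewList (F := F) hB _ i j _ (by
      rintro h
      rw [h] at hlen
      simp at hlen
      omega) hperm]
    have hz : ∀ (κ : F × F) (p : B) (k : Fin (r + 2)), skewList κ p
        ((k :: (tailOps r).map Prod.fst).map fun k => g (x k)) = 0 := by
      intro κ p k
      have := ((isSkewOnLists_skewList hB κ p).comp_map g).eq_zero_of_not_nodup (F := F)
        (l := (k :: (tailOps r).map Prod.fst).map x) (fun h => by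
          have := h.length_le_card
          simp [hlen] at this)
      rwa [List.map_map] at this
    rw [hz, hz, cubeTerm, dif_neg (by omega), smul_zero, add_zero, add_zero]
  have h1 := lift_commutatorPoly (F := F) r fun k => g (x k)
  rw [← h1, commutatorPoly, map_sub, lift_wordPoly, lift_wordPoly,
    h0 _ _ (by rw [chainLetters_tailOps]), h0 _ _ (chainLetters_tailOps_perm r), sub_zero]

omit [CharZero F] in
theorem map_rightFold {B' G : Type*} [NonUnitalNonAssocRing B'] [FunLike G B B']
    [MulHomClass G B B'] (φ : G) (u : B) (l : List B) :
    φ (rightFold u l) = rightFold (φ u) (l.map φ) := by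
  induction l generalizing u with
  | nil => rfl
  | cons a l ih => rw [rightFold_cons, ih, map_mul, List.map_cons, rightFold_cons]

theorem exists_map_of_forall_mem_range {X Y : Type*} (g : X → Y) (l : List Y)
    (h : ∀ y ∈ l, y ∈ Set.range g) : ∃ l' : List X, l'.map g = l := by
  induction l with
  | nil => exact ⟨[], rfl⟩
  | cons y l ih =>
    obtain ⟨x, rfl⟩ := h y (by simp)
    obtain ⟨l', rfl⟩ := ih fun y hy => h y (by simp [hy])
    exact ⟨x :: l', rfl⟩

/-- The identity `[p, q] y₁ ⋯ yᵣ = 0` in alternative metabelian algebras on `r` generators. -/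
theorem rightFold_commutator_eq_zero (hB : IsAltMetabelian B) {r : ℕ} (hr : 1 ≤ r) (g : Fin r → B)
    (hS : Submodule.span F (Set.range g ∪ {x | ∃ a b, x = a * b}) = ⊤) (p q : B) {l : List B}
    (hl : l.length = r) : rightFold (p * q - q * p) l = 0 := by
  refine commutator_rightFold_eq_zero_of_span (S := Set.range g ∪ {x | ∃ a b, x = a * b})
    (fun p hp q hq l hl hmem => ?_) (by rw [hS]; trivial) (by rw [hS]; trivial) hl
    (fun a _ => by rw [hS]; trivial)
  by_cases hprod : ∃ u v : B, u * v ∈ l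
  · obtain ⟨u, v, huv⟩ := hprod
    rw [rightFold_sub, rightFold_eq_zero_of_mem hB.2.2 p q huv,
      rightFold_eq_zero_of_mem hB.2.2 q p huv, sub_zero]
  obtain ⟨l, rfl⟩ := exists_map_of_forall_mem_range g l fun y hy => by
    rcases hmem y hy with h | ⟨u, v, rfl⟩
    · exact h
    · exact absurd ⟨u, v, hy⟩ hprod
  rw [List.length_map] at hl
  rcases hp with ⟨x, rfl⟩ | ⟨a, b, rfl⟩ <;> rcases hq with ⟨y, rfl⟩ | ⟨c, d, rfl⟩
  · have := rightFold_commutator_gen (F := F) hB hr g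
      (Fin.cons x (Fin.cons y fun k : Fin r => l.get (k.cast hl.symm)))
    have e : ((List.finRange r).map fun k : Fin r => g (l.get (k.cast hl.symm))) = l.map g := by
      exact List.ext_getElem (by simp [hl]) (by simp)
    rw [← e]
    exact this
  · have := rightFold_commutator_product (F := F) hB g x c d hl
    rw [← neg_sub, rightFold_neg, this, neg_zero]
  · exact rightFold_commutator_product (F := F) hB g y a b hl
  · rw [hB.2.2, hB.2.2, sub_zero, rightFold_zero]

end

theorem exists_rightFold_tmul {M : Type u} [NonUnitalNonAssocRing M] [Module F M]
    [IsScalarTower F M M] [SMulCommClass F M M]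
    (l : List (Grassmann F ⊗[F] M)) (h : ∀ a ∈ l, ∃ g m, a = g ⊗ₜ[F] m) :
    ∃ (k : Grassmann F) (l' : List M), l'.length = l.length ∧
      ∀ (g : Grassmann F) (u : M), rightFold (g ⊗ₜ[F] u) l = (g * k) ⊗ₜ rightFold u l' := by
  induction l with
  | nil => exact ⟨1, [], rfl, fun g u => by simp⟩
  | cons a l ih =>
    obtain ⟨g', m, rfl⟩ := h a (by simp)
    obtain ⟨k, l', hlen, hl'⟩ := ih fun b hb => h b (by simp [hb])
    refine ⟨g' * k, m :: l', by simp [hlen], fun g u => ?_⟩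
    rw [rightFold_cons, Algebra.TensorProduct.tmul_mul_tmul, hl', rightFold_cons, mul_assoc]

theorem mem_span_even_of_mem_grassmannEnvelope {A : Superalgebra F} (h1 : A.part 1 = ⊥)
    {x : Grassmann F ⊗[F] A.carrier} (hx : x ∈ grassmannEnvelope A) :
    x ∈ Submodule.span F {x | ∃ g ∈ grassmannPart F 0, ∃ a : A.carrier, x = g ⊗ₜ[F] a} := by
  induction hx using grassmannEnvelope_induction with
  | zero => exact Submodule.zero_mem _
  | add x y _ _ hx hy => exact Submodule.add_mem _ hx hy
  | tmul i g a hg ha =>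
    have h2 : ∀ i : ZMod 2, i = 0 ∨ i = 1 := by decide
    rcases h2 i with rfl | rfl
    · exact Submodule.subset_span ⟨g, hg, a, rfl⟩
    · rw [h1, Submodule.mem_bot] at ha
      rw [ha, TensorProduct.tmul_zero]
      exact Submodule.zero_mem _

/-- Without an odd part the Grassmann coefficients are even, hence central, and factor out of the
commutator. -/
theorem satisfiesSuperidentity_commutatorPoly_of_even {A : Superalgebra F} (h1 : A.part 1 = ⊥)
    {r : ℕ} (h : ∀ (p q : A.carrier) (l : List A.carrier), l.length = r →
      rightFold (p * q - q * p) l = 0) : SatisfiesSuperidentity (commutatorPoly F r) A := by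
  rw [satisfiesSuperidentity_iff]
  intro b hb
  rw [lift_commutatorPoly]
  refine commutator_rightFold_eq_zero_of_span (n := r) ?_
    (mem_span_even_of_mem_grassmannEnvelope h1 (hb 0))
    (mem_span_even_of_mem_grassmannEnvelope h1 (hb 1)) (by simp) ?_
  · rintro _ ⟨g, hg, p, rfl⟩ _ ⟨g', hg', q, rfl⟩ l hl hmem
    obtain ⟨k, l', hl', hk⟩ := exists_rightFold_tmul l fun a ha => by
      obtain ⟨g, -, m, rfl⟩ := hmem a ha
      exact ⟨g, m, rfl⟩
    rw [Algebra.TensorProduct.tmul_mul_tmul, Algebra.TensorProduct.tmul_mul_tmul,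
      grassmann_even_comm hg, ← TensorProduct.tmul_sub, hk, h p q l' (hl'.trans hl),
      TensorProduct.tmul_zero]
  · intro a ha
    obtain ⟨k, -, rfl⟩ := List.mem_map.1 ha
    exact mem_span_even_of_mem_grassmannEnvelope h1 (hb _)

theorem parity_eq_zero {r : ℕ} (w : FreeMagma (Fin r ⊕ Fin 0)) : parity w = 0 := by
  induction w using FreeMagma.rec with
  | of x =>
    rcases x with x | x
    · rfl
    · exact x.elim0
  | mul v w hv hw =>
    change parity v + parity w = 0
    rw [hv, hw, add_zero]

theorem freeAltMetabelian_part_one (r : ℕ) : (freeAltMetabelian F r 0).part 1 = ⊥ := by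
  rw [freeAltMetabelian_part, Submodule.span_eq_bot]
  rintro _ ⟨w, hw, -⟩
  rw [parity_eq_zero] at hw
  exact absurd hw (by decide)

theorem freeAltMetabelian_span (r : ℕ) :
    Submodule.span F (Set.range (fun x : Fin r => freeGen F r 0 (.inl x)) ∪
      {x | ∃ a b, x = a * b}) = ⊤ := by
  have h0 : (freeAltMetabelian F r 0).part 0 = ⊤ := by
    have := (freeAltMetabelian F r 0).isCompl.sup_eq_top
    rwa [freeAltMetabelian_part_one, sup_bot_eq] at this
  rw [eq_top_iff, ← h0, freeAltMetabelian_part]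
  refine Submodule.span_mono ?_
  rintro _ ⟨w, -, rfl⟩
  rcases w with x | ⟨v, w⟩
  · rcases x with x | x
    · exact .inl ⟨x, rfl⟩
    · exact x.elim0
  · exact .inr ⟨_, _, freeWord_mul r 0 v w⟩

theorem isAltMetabelian_of_part_one {A : Superalgebra F} (hA : A ∈ altMetabelianSupervariety F)
    (h1 : A.part 1 = ⊥) : IsAltMetabelian A.carrier := by
  have h0 : A.part 0 = ⊤ := by
    have := A.isCompl.sup_eq_top
    rwa [h1, sup_bot_eq] at this
  have hmem : ∀ a : A.carrier, oneTmul (F := F) A.carrier a ∈ grassmannEnvelope A := fun a =>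
    tmul_mem_grassmannEnvelope one_mem_grassmannPart (by rw [h0]; trivial)
  have hi := oneTmul_injective (F := F) (M := A.carrier)
  rw [mem_altMetabelianSupervariety_iff] at hA
  refine ⟨fun x y => hi ?_, fun x y => hi ?_, fun x y z t => hi ?_⟩
  · rw [associator, map_sub, map_mul, map_mul, map_mul, map_mul, map_zero]
    exact hA.1 _ (hmem x) _ (hmem y)
  · rw [associator, map_sub, map_mul, map_mul, map_mul, map_mul, map_zero]
    exact hA.2.1 _ (hmem x) _ (hmem y)
  · rw [map_mul, map_mul, map_mul, map_zero]
    exact hA.2.2 _ (hmem x) _ (hmem y) _ (hmem z) _ (hmem t)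

theorem satisfiesSuperidentity_commutatorPoly [CharZero F] {r : ℕ} (hr : 1 ≤ r) :
    SatisfiesSuperidentity (commutatorPoly F r) (freeAltMetabelian F r 0) :=
  satisfiesSuperidentity_commutatorPoly_of_even (freeAltMetabelian_part_one r) fun p q _ hl =>
    rightFold_commutator_eq_zero (F := F)
      (isAltMetabelian_of_part_one (freeAltMetabelian_mem r 0) (freeAltMetabelian_part_one r)) hr _
      (freeAltMetabelian_span r) p q hl

theorem exists_rightFold_incl {X : Type*} (ν : X → ℕ) (κ : F × F) (l : List ℕ) (s : Bool)
    (ks : List X) : ∃ s', rightFold (grProd l ⊗ₜ skewModel.incl F s κ)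
      (ks.map fun k => grGen F (ν k) ⊗ₜ[F] skewModel.gen F) =
        grProd (l ++ ks.map ν) ⊗ₜ skewModel.incl F s' κ := by
  induction ks generalizing l s with
  | nil => exact ⟨s, by simp⟩
  | cons k ks ih =>
    obtain ⟨s', h⟩ := ih (l ++ [ν k]) !s
    refine ⟨s', ?_⟩
    rw [List.map_cons, rightFold_cons, Algebra.TensorProduct.tmul_mul_tmul,
      ← grProd_append_singleton, skewModel.incl_mul_gen, h, List.map_cons, List.append_assoc]
    rfl

/-- The envelope of the model is an ordinary algebra of the variety, so its elements may replace
even generators. With r + 2 variables and r + 1 elements one element is used twice, and it is chosen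
to play two roles. -/
theorem not_satisfiesSuperidentity_commutatorPoly_succ [CharZero F] {r : ℕ} (hr : 1 ≤ r) :
    ¬ SatisfiesSuperidentity (commutatorPoly F r) (freeAltMetabelian F (r + 1) 0) := by
  intro h
  obtain ⟨r, rfl⟩ := Nat.exists_eq_add_of_le' hr
  set y := skewModel.gen F
  have hy : y ∈ (skewModel F).part 1 := skewModel.mk_mem_one 1 0
  have hyy : y * y ∈ (skewModel F).part 0 := (skewModel F).mul_mem 1 1 y y hy hy
  -- The repeated element `X 0` contributes `y²` in one occurrence and `e₀ ⊗ y` in the other. Here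
  -- `r` has already been replaced by r + 1.
  let X : Fin (r + 2) → Grassmann F ⊗[F] (skewModel F).carrier := fun j =>
    if j = 0 then 1 ⊗ₜ (y * y) + grGen F 0 ⊗ₜ y else grGen F j ⊗ₜ y
  have hX : ∀ j, X j ∈ grassmannEnvelope (skewModel F) := by
    intro j
    simp only [X]
    split_ifs
    · exact add_mem (tmul_mem_grassmannEnvelope one_mem_grassmannPart hyy)
        (tmul_mem_grassmannEnvelope (grGen_mem _) hy)
    · exact tmul_mem_grassmannEnvelope (grGen_mem _) hy
  let x : Fin (r + 3) → Fin (r + 2) := Fin.cons 0 (Fin.cons 1 (Fin.cons 0 fun k => k.succ.succ))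
  have h1 := h.lift_comp_eq_zero (skewModel_mem (F := F)) (fun j => ⟨X j, hX j⟩) x
  have h2 := congrArg (NonUnitalSubalgebraClass.subtype (grassmannEnvelope (skewModel F)))
    ((lift_commutatorPoly (F := F) _ _).symm.trans h1)
  rw [map_rightFold, map_zero, List.finRange_succ, List.map_cons, List.map_map, List.map_cons,
    List.map_map] at h2
  have h3 : rightFold (X 0 * X 1 - X 1 * X 0)
      (X 0 :: (List.finRange r).map fun k : Fin r => grGen F ((k : ℕ) + 2) ⊗ₜ y) = 0 := h2
  have e00 : grGen F 0 * grGen F 0 = 0 := ExteriorAlgebra.ι_sq_zero _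
  have e10 : grGen F 0 * grGen F 1 = -(grGen F 1 * grGen F 0) :=
    grassmann_odd_anticomm (grGen_mem 0) (grGen_mem 1)
  have hX0 : X 0 = 1 ⊗ₜ (y * y) + grGen F 0 ⊗ₜ y := if_pos rfl
  have hX1 : X 1 = grGen F 1 ⊗ₜ y := if_neg (by simp)
  -- Using `y²` twice is killed by metabelianity and using `e₀` twice by `e₀² = 0`. Using `y²` in
  -- the last factor also gives a product of two products; so only `y²` inside the commutator and
  -- `e₀` after it survive.
  have e : (X 0 * X 1 - X 1 * X 0) * X 0 =
      grProd [1, 0] ⊗ₜ skewModel.incl F true ((1, 0) - mulPhiSq (1, 0)) := by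
    have hp : (grProd [1, 0] : Grassmann F) = grGen F 1 * grGen F 0 := by simp [grProd]
    have hu : skewModel.incl F true ((1, 0) - mulPhiSq (1, 0)) = y * y * y * y - y * (y * y) * y := by
      rw [skewModel.gen_mul_gen, skewModel.incl_mul_gen, skewModel.gen_mul_incl_true,
        Bool.not_true, skewModel.incl_mul_gen, skewModel.incl_mul_gen, Bool.not_false, ← map_sub]
    rw [hu, hX0, hX1, hp]
    simp only [add_mul, mul_add, sub_mul, Algebra.TensorProduct.tmul_mul_tmul, one_mul, mul_one,
      skewModel_metabelian, TensorProduct.tmul_zero, e10, neg_mul, mul_assoc (grGen F 1), e00,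
      mul_zero, neg_zero, TensorProduct.zero_tmul, TensorProduct.tmul_sub]
    abel
  rw [rightFold_cons, e] at h3
  obtain ⟨s', hs'⟩ := exists_rightFold_incl (F := F) (fun k : Fin r => (k : ℕ) + 2)
    ((1, 0) - mulPhiSq (1, 0)) [1, 0] true (List.finRange r)
  rw [hs'] at h3
  refine tmul_ne_zero_of_ne_zero (grProd_ne_zero ?_) (fun h0 => ?_) h3
  · have hnd : ((List.finRange r).map fun k : Fin r => (k : ℕ) + 2).Nodup :=
      (List.nodup_finRange r).map fun a b hab => by simpa [Fin.ext_iff] using hab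
    simpa using hnd
  · have := skewModel.incl_injective _ (h0.trans (map_zero _).symm)
    simp [mulPhiSq] at this

end CommutatorPolynomial

/-! ### Comparison of the supervarieties. -/

section Comparison

variable {F : Type u} [Field F]

/-- The free superalgebra generating the first class is itself a witness. -/
theorem not_altSV_subset {n r s r' s' : ℕ} {f : FreeNonUnitalNonAssocAlgebra F (Fin n)}
    (hf : IsMultilinearPoly f) (h : SatisfiesSuperidentity f (freeAltMetabelian F r s))
    (h' : ¬ SatisfiesSuperidentity f (freeAltMetabelian F r' s')) :
    ¬ altSV F r' s' ⊆ altSV F r s :=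
  fun hsub => h' (hsub (freeAltMetabelian_mem_altSV r' s') n f hf h)

theorem altSV_eq_of_pos [CharZero F] {r s : ℕ} (hr : 1 ≤ r) (hs : 1 ≤ s) :
    altSV F r s = altMetabelianSupervariety F :=
  (altSV_subset r s).antisymm (subset_altSV hs fun h =>
    not_satisfiesSuperidentity_cubePoly_one_zero (h.of_le hr (Nat.zero_le s)))

theorem altSV_eq_of_three_le [CharZero F] {r s : ℕ} (hs : 3 ≤ s) :
    altSV F r s = altMetabelianSupervariety F :=
  (altSV_subset r s).antisymm (subset_altSV (by omega) fun h =>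
    not_satisfiesSuperidentity_cubePoly_zero_three (h.of_le (Nat.zero_le r) hs))

end Comparison

theorem mainTheorem2 (F : Type u) [Field F] [CharZero F] :
    -- the first row is strictly increasing
    (∀ r : ℕ, 1 ≤ r → altSV F r 0 ⊂ altSV F (r + 1) 0) ∧
    -- the first row lies strictly below the second one
    (∀ r : ℕ, 1 ≤ r → altSV F r 0 ⊂ altSV F r 1) ∧
    -- the first column
    altSV F 0 1 = altSV F 0 2 ∧
    altSV F 0 2 ⊂ altSV F 0 3 ∧
    -- the first column lies strictly to the left of the second one in the rows `s = 1, 2`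
    altSV F 0 1 ⊂ altSV F 1 1 ∧
    altSV F 0 2 ⊂ altSV F 1 2 ∧
    -- all the remaining entries are equal, and equal to the whole supervariety
    (∀ r s : ℕ, 1 ≤ r → 1 ≤ s → altSV F r s = altMetabelianSupervariety F) ∧
    (∀ r s : ℕ, 3 ≤ s → altSV F r s = altMetabelianSupervariety F) ∧
    -- there are no inclusions between the first row and `V_{0,1} = V_{0,2}`
    (∀ r : ℕ, 1 ≤ r → ¬ altSV F r 0 ⊆ altSV F 0 1 ∧ ¬ altSV F 0 1 ⊆ altSV F r 0) := by
  have hcube := satisfiesSuperidentity_cubePoly (F := F)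
  have hcube' := hcube.of_le (Nat.zero_le 0) one_le_two
  have hfail : ∀ r s, 1 ≤ r →
      ¬ SatisfiesSuperidentity (cubePoly F) (freeAltMetabelian F r s) := fun r s hr h =>
    not_satisfiesSuperidentity_cubePoly_one_zero (h.of_le hr (Nat.zero_le s))
  have hcubeM := isMultilinearPoly_cubePoly (F := F)
  refine ⟨fun r hr => ⟨altSV_mono (Nat.le_succ r) le_rfl, ?_⟩,
    fun r hr => ⟨altSV_mono le_rfl (Nat.zero_le 1), ?_⟩, altSV_zero_one_eq hcube,
    ⟨altSV_mono le_rfl (Nat.le_succ 2), ?_⟩, ⟨altSV_mono (Nat.zero_le 1) le_rfl, ?_⟩,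
    ⟨altSV_mono (Nat.zero_le 1) le_rfl, ?_⟩, fun r s => altSV_eq_of_pos,
    fun r s => altSV_eq_of_three_le, fun r hr => ⟨?_, ?_⟩⟩
  · exact not_altSV_subset (isMultilinearPoly_commutatorPoly r)
      (satisfiesSuperidentity_commutatorPoly hr)
      (not_satisfiesSuperidentity_commutatorPoly_succ hr)
  · exact not_altSV_subset (isMultilinearPoly_commutatorPoly r)
      (satisfiesSuperidentity_commutatorPoly hr) fun h =>
      not_satisfiesSuperidentity_commutatorPoly_zero_one r (h.of_le (Nat.zero_le r) le_rfl)
  · exact not_altSV_subset hcubeM hcube not_satisfiesSuperidentity_cubePoly_zero_three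
  · exact not_altSV_subset hcubeM hcube' (hfail 1 1 le_rfl)
  · exact not_altSV_subset hcubeM hcube (hfail 1 2 le_rfl)
  · exact not_altSV_subset hcubeM hcube' (hfail r 0 hr)
  · exact not_altSV_subset (isMultilinearPoly_commutatorPoly r)
      (satisfiesSuperidentity_commutatorPoly hr)
      (not_satisfiesSuperidentity_commutatorPoly_zero_one r)
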